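/- **Setting.** Let $V$ be a non-empty finite set, $\Sigma$ the finite monoid of maps $V\to V$ under composition, and $\mu$ a probability on $\Sigma$. Write $\mathcal S(\rho)$ for the support of a law $\rho$, $\mu\rho$ for convolution of laws on $\Sigma$, $E(A)$ for the set of idempotents of $A\subset\Sigma$, $\omega_A$ for the uniform law on a non-empty finite set $A$, and identify a map with the Dirac mass at it. Maps act componentwise on tuples, and for a law $\rho$ on $\Sigma$ and a law $\Lambda$ on $V^m$, $\rho\Lambda$ is the law of $f\mathbf x$ with $f\sim\rho$ and $\mathbf x\sim\Lambda$ independent; $\Lambda$ is $\mu$-invariant if $\mu\Lambda=\Lambda$. Let $V^m_\times\subset V^m$ be the set of tuples with distinct entries. Let $S=\bigcup_{n\ge1}\mathcal S(\mu)^n$, let $\mathcal K$ be the set of subsequential limits of $(\mu^n)_n$, $p=\#\mathcal K$, let $\eta\in\mathcal K$ with $\eta^2=\eta$, and $\nu=\frac1p\sum_{k=0}^{p-1}\mu^k\eta$. Let $e\in E(\mathcal S(\eta))$, and put $L=E(\mathcal S(\eta)e)$, $H=e\mathcal S(\eta)e$, $G=e\mathcal S(\nu)e$; here $G$ is a group with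 unit $e$ and $H$ a normal subgroup of it (powers and inverses are taken in $G$). Let $\eta^L$ and $\eta^R$ be the laws of $ze(eze)^{-1}$ and $(eze)^{-1}ez$ for $z\sim\eta$. Let $\gamma\in G$ be such that $G/H=\{H,\gamma H,\dots,\gamma^{p-1}H\}$ and $\mu^k\eta=\eta^L\gamma^k\omega_H\eta^R$ for $0\le k<p$, and put $C=\{e,\gamma,\dots,\gamma^{p-1}\}$. Let $$m_\mu=\min\{\#(gV):g\in S\},\qquad W_\mu=\{\mathbf x\in V^{m_\mu}_\times: f\mathbf x\in V^{m_\mu}_\times\text{ for all }f\in S\},$$ and let $W\subset eW_\mu$ be such that $GW=eW_\mu$ and the product map $(f,g,\mathbf w)\mapsto fg\mathbf w$ is injective on $L\times G\times W$. Write $\mathbf x\mapsto(\mathbf x^L,\mathbf x^G,\mathbf x^W)$ for its inverse on $LGW$. An $m$-particle $\mu$-evolution is a pair of processes $\mathbf X=(\mathbf X_k)_{k\in\mathbb Z}$ in $V^m$ and $N=(N_k)_{k\in\mathbb Z}$ iid in $\Sigma$ on a probability space such that, for each $k$, $\mathbf X_k=N_k\mathbf X_{k-1}$ a.s., $N_k$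 is independent of $\sigma(\mathbf X_j,N_j:j\le k-1)$, and $N_k\sim\mu$; it is stationary if $(\mathbf X_{\cdot+1},N_{\cdot+1})$ and $(\mathbf X,N)$ have the same law. Put $\mathcal F^{\mathbf X}_k=\sigma(\mathbf X_j:j\le k)$, $\mathcal F^N_k=\sigma(N_j:j\le k)$, $\mathcal F^{\mathbf X}_{-\infty}=\bigcap_k\mathcal F^{\mathbf X}_k$. Inclusions and identities of $\sigma$-fields "a.s." hold after joining the null events (to the right-hand side, respectively to both sides). **Theorem.** There is an idempotent $\eta\in\mathcal K$, $E(\mathcal S(\eta))\neq\emptyset$, and for every $e\in E(\mathcal S(\eta))$ there exist $\gamma$ and $W$ as above. For all such choices, let $\Lambda$ be a $\mu$-invariant law on $V^{m_\mu}_\times$ and let $(\mathbf X,N)$ be a stationary $m_\mu$-particle $\mu$-evolution with $\mathbf X_k\sim\Lambda$ for all $k$. Then: 1. $\mathbf X_k\in LGW$ a.s. and $\mathbf X_k^L\sim\eta^L$ for all $k\in\mathbb Z$. Moreover, there exist a $C$-valued random variable $Y_C$, $H$-valued random variables $U^H_k$ ($k\in\mathbb Z$) and a $W$-valued random variable $\mathbf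 Z_W$ such that: 2. $\mathbf X_k^G=(\gamma^kY_C)U^H_k$ a.s., and $U^H_k$ is uniform on $H$, for all $k\in\mathbb Z$. 3. $\mathbf X_k^W=\mathbf Z_W$ a.s. for all $k\in\mathbb Z$. 4. With $M^G_{k,j}=\mathbf X^G_k(\mathbf X^G_j)^{-1}$ and $M^G_j=M^G_{j,j-1}$, for all $j\le k$ one has a.s. $M^G_{k,j}=M^G_kM^G_{k-1}\cdots M^G_{j+1}$ (the empty product being $e$) and $$\mathbf X_j=\mathbf X_j^L(M^G_{k,j})^{-1}(\gamma^kY_C)U^H_k\mathbf Z_W.$$ 5. With $\mathcal G^N_k=\sigma(\mathbf X^L_j,M^G_j:j\le k)$, for every $k\in\mathbb Z$: $\mathcal F^{\mathbf X}_k=\mathcal G^N_k\vee\mathcal F^{\mathbf X}_{-\infty}\vee\sigma(U^H_k)$ a.s.; $\mathcal G^N_k\subset\mathcal F^N_k$ a.s.; the three $\sigma$-fields $\mathcal F^N_k$, $\mathcal F^{\mathbf X}_{-\infty}$, $\sigma(U^H_k)$ are independent; and $\mathcal F^{\mathbf X}_{-\infty}=\sigma(Y_C,\mathbf Z_W)$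 a.s. 6. $Y_C$ is uniform on $C$ (if $\gamma^p=e$, then $C=\{\gamma^k:k\in\mathbb Z\}$ is a cyclic group, so that this is its Haar probability); $\mathbf Z_W\sim\Lambda_W$ for a law $\Lambda_W$ on $W$ with $\Lambda=\eta^L\omega_G\Lambda_W$; and $Y_C$ and $\mathbf Z_W$ are independent. -/

import Mathlib

open MeasureTheory ProbabilityTheory Filter Topology

noncomputable section

namespace ActionEvolution

universe u v

/-- Maps of `V` into itself form a monoid under composition (`Function.End V`); on this finite set
every subset is an event. -/
instance endMeasurableSpace (V : Type u) : MeasurableSpace (Function.End V) := ⊤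

instance endFinite (V : Type u) [Finite V] : Finite (Function.End V) :=
  inferInstanceAs (Finite (V → V))

/-! ### Laws on maps and on tuples -/

section Laws

variable {V : Type u} {m : ℕ}

/-- Componentwise action of a map on an `m`-tuple. -/
def act (f : Function.End V) (x : Fin m → V) : Fin m → V := fun i => f (x i)

/-- Convolution of two laws on maps. -/
def conv (μ ρ : PMF (Function.End V)) : PMF (Function.End V) :=
  μ.bind fun f => ρ.map fun g => f * g

/-- Convolution powers. -/
def convPow (μ : PMF (Function.End V)) : ℕ → PMF (Function.End V)
  | 0 => PMF.pure 1
  | n + 1 => conv μ (convPow μ n)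

/-- The law `μΛ` of `f x`, with `f` of law `μ` and `x` of law `Λ` independent. -/
def actLaw (μ : PMF (Function.End V)) (Λ : PMF (Fin m → V)) : PMF (Fin m → V) :=
  μ.bind fun f => Λ.map (act f)

/-- `Λ` is `μ`-invariant. -/
def IsInvariant (μ : PMF (Function.End V)) (Λ : PMF (Fin m → V)) : Prop :=
  Λ = actLaw μ Λ

open scoped Classical in
/-- The uniform law on a non-empty subset `A` of a finite set (a default value is returned for
empty `A`, which never occurs below). -/
def unif {α : Type u} [Finite α] [Nonempty α] (A : Set α) : PMF α :=
  if h : A.toFinite.toFinset.Nonempty then PMF.uniformOfFinset A.toFinite.toFinset h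
  else PMF.pure (Classical.arbitrary α)

/-- The semigroup `S` generated by the support of `μ`. -/
def genSemigroup (μ : PMF (Function.End V)) : Subsemigroup (Function.End V) :=
  Subsemigroup.closure μ.support

/-- The set `𝒦` of subsequential limits of the sequence `(μ ^ n)`. -/
def subseqLimits (μ : PMF (Function.End V)) : Set (PMF (Function.End V)) :=
  {ρ | ∃ φ : ℕ → ℕ, StrictMono φ ∧
    ∀ f, Tendsto (fun n => convPow μ (φ n) f) atTop (𝓝 (ρ f))}

/-- The number `p` of subsequential limits of `(μ ^ n)`. -/
def period (μ : PMF (Function.End V)) : ℕ := (subseqLimits μ).ncard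

/-- `m_μ`, the least cardinality of an image `gV`, `g ∈ S`. -/
def minRank (μ : PMF (Function.End V)) : ℕ :=
  sInf {n | ∃ g ∈ genSemigroup μ, n = (Set.range (g : V → V)).ncard}

/-- `W_μ`: the `m_μ`-tuples with distinct entries which are mapped by every element of `S` to a
tuple with distinct entries. -/
def tupleSet (μ : PMF (Function.End V)) : Set (Fin (minRank μ) → V) :=
  {x | Function.Injective x ∧ ∀ f ∈ genSemigroup μ, Function.Injective (act f x)}

end Laws

/-! ### Rees decomposition -/

section Rees

variable {V : Type u}

/-- `E(A)`: the idempotents in `A`. -/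
def idempotents (A : Set (Function.End V)) : Set (Function.End V) :=
  {f | f ∈ A ∧ f * f = f}

/-- `E(Ae)`. -/
def leftFactor (e : Function.End V) (A : Set (Function.End V)) : Set (Function.End V) :=
  idempotents ((fun z => z * e) '' A)

/-- `eAe`. -/
def groupFactor (e : Function.End V) (A : Set (Function.End V)) : Set (Function.End V) :=
  (fun z => e * z * e) '' A

open scoped Classical in
/-- The inverse of `g` in a group `G` of maps whose unit is `e` (and `e` if there is none). -/
def relInv (e : Function.End V) (G : Set (Function.End V)) (g : Function.End V) :
    Function.End V :=
  if h : ∃ x ∈ G, g * x = e ∧ x * g = e then h.choose else e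

/-- The power `g ^ k`, `k ∈ ℤ`, in a group `G` of maps whose unit is `e`. -/
def relZPow (e : Function.End V) (G : Set (Function.End V)) (g : Function.End V) :
    ℤ → Function.End V
  | Int.ofNat n => e * g ^ n
  | Int.negSucc n => relInv e G (e * g ^ (n + 1))

/-- The law `ρ^L` of `z^L = ze(eze)⁻¹`, for `z` of law `ρ`. -/
def leftLaw (e : Function.End V) (ρ : PMF (Function.End V)) : PMF (Function.End V) :=
  ρ.map fun z => z * e * relInv e (groupFactor e ρ.support) (e * z * e)

/-- The law `ρ^R` of `z^R = (eze)⁻¹ez`, for `z` of law `ρ`. -/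
def rightLaw (e : Function.End V) (ρ : PMF (Function.End V)) : PMF (Function.End V) :=
  ρ.map fun z => relInv e (groupFactor e ρ.support) (e * z * e) * (e * z)

/-- The product map `(f, g, w) ↦ f g w`. -/
def tupleProd {m : ℕ} (t : Function.End V × Function.End V × (Fin m → V)) : Fin m → V :=
  act (t.1 * t.2.1) t.2.2

/-- The choices attached to the infinite convolutions of `μ`:
* `η`, the idempotent element of `𝒦`, and `ν = p⁻¹ ∑_{k < p} μ^k η`;
* an idempotent `e` in the support of `η`; this determines `L = E(supp η e)`,
  `H = e supp η e` and `G = e supp ν e`;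
* `γ ∈ G` with `G/H = {H, γH, …, γ^{p-1}H}` and `μ^k η = η^L γ^k ω_H η^R` for `0 ≤ k < p`;
* `W ⊆ e W_μ` with `GW = e W_μ` for which the product map is injective on `L × G × W`. -/
structure Frame [Fintype V] [Nonempty V] (μ : PMF (Function.End V)) where
  η : PMF (Function.End V)
  ν : PMF (Function.End V)
  e : Function.End V
  γ : Function.End V
  W : Set (Fin (minRank μ) → V)
  η_mem : η ∈ subseqLimits μ
  η_idem : conv η η = η
  ν_eq : ∀ f, ν f = (period μ : ENNReal)⁻¹ *
    ∑ k ∈ Finset.range (period μ), conv (convPow μ k) η f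
  e_mem : e ∈ idempotents η.support
  γ_mem : γ ∈ groupFactor e ν.support
  γ_cosets : {A | ∃ g ∈ groupFactor e ν.support, A = (fun h => g * h) '' groupFactor e η.support}
    = {A | ∃ k < period μ, A = (fun h => e * γ ^ k * h) '' groupFactor e η.support}
  γ_law : ∀ k < period μ, conv (convPow μ k) η =
    conv (conv (conv (leftLaw e η) (PMF.pure (e * γ ^ k))) (unif (groupFactor e η.support)))
      (rightLaw e η)
  W_subset : W ⊆ act e '' tupleSet μ
  W_cover : Set.image2 act (groupFactor e ν.support) W = act e '' tupleSet μ
  W_inj : Set.InjOn tupleProd (leftFactor e η.support ×ˢ groupFactor e ν.support ×ˢ W)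

namespace Frame

variable [Fintype V] [Nonempty V] {μ : PMF (Function.End V)} (F : Frame μ)

/-- `L = E(supp η e)`. -/
def L : Set (Function.End V) := leftFactor F.e F.η.support

/-- `G = e supp ν e`. -/
def G : Set (Function.End V) := groupFactor F.e F.ν.support

/-- `H = e supp η e`. -/
def H : Set (Function.End V) := groupFactor F.e F.η.support

/-- `C = {e, γ, …, γ^{p-1}}`. -/
def C : Set (Function.End V) := {f | ∃ i < period μ, f = F.e * F.γ ^ i}

/-- The set `LGW`. -/
def LGW : Set (Fin (minRank μ) → V) := tupleProd '' (F.L ×ˢ F.G ×ˢ F.W)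

/-- The inverse in `G`. -/
def inv (g : Function.End V) : Function.End V := relInv F.e F.G g

/-- `γ ^ k` in `G`, for `k ∈ ℤ`. -/
def γpow (k : ℤ) : Function.End V := relZPow F.e F.G F.γ k

/-- The inverse `x ↦ (x^L, x^G, x^W)` of the product map on `LGW`. -/
def coords (x : Fin (minRank μ) → V) :
    Function.End V × Function.End V × (Fin (minRank μ) → V) :=
  haveI : Nonempty (Function.End V) := ⟨1⟩
  Function.invFunOn tupleProd (F.L ×ˢ F.G ×ˢ F.W) x

/-- `x^L`. -/
def projL (x : Fin (minRank μ) → V) : Function.End V := (F.coords x).1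

/-- `x^G`. -/
def projG (x : Fin (minRank μ) → V) : Function.End V := (F.coords x).2.1

/-- `x^W`. -/
def projW (x : Fin (minRank μ) → V) : Fin (minRank μ) → V := (F.coords x).2.2

/-- `M^G_{k,j} = X^G_k (X^G_j)⁻¹`. -/
def MG {Ω : Type v} (X : ℤ → Ω → Fin (minRank μ) → V) (k j : ℤ) (ω : Ω) : Function.End V :=
  F.projG (X k ω) * F.inv (F.projG (X j ω))

end Frame

end Rees

/-! ### σ-fields and evolutions -/

section Evolutions

variable {Ω : Type v}

/-- `σ(Z_j : j ≤ k)`. -/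
@[reducible]
def past {β : Type u} [MeasurableSpace β] (Z : ℤ → Ω → β) (k : ℤ) : MeasurableSpace Ω :=
  ⨆ (j : ℤ) (_ : j ≤ k), MeasurableSpace.comap (Z j) inferInstance

/-- The remote past `⋂_k σ(Z_j : j ≤ k)`. -/
@[reducible]
def remotePast {β : Type u} [MeasurableSpace β] (Z : ℤ → Ω → β) : MeasurableSpace Ω :=
  ⨅ k : ℤ, past Z k

/-- The σ-field generated by the null events. -/
@[reducible]
def nullField {mΩ : MeasurableSpace Ω} (P : Measure Ω) : MeasurableSpace Ω :=
  MeasurableSpace.generateFrom {s | MeasurableSet s ∧ P s = 0}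

/-- `𝒜 ⊆ ℬ` a.s. -/
def AsLe {mΩ : MeasurableSpace Ω} (P : Measure Ω) (A B : MeasurableSpace Ω) : Prop :=
  A ≤ B ⊔ nullField P

/-- `𝒜 = ℬ` a.s. -/
def AsEq {mΩ : MeasurableSpace Ω} (P : Measure Ω) (A B : MeasurableSpace Ω) : Prop :=
  A ⊔ nullField P = B ⊔ nullField P

/-- `(X, N)` is an `m`-particle `μ`-evolution. -/
structure IsEvolution {V : Type u} [MeasurableSpace V] {m : ℕ} [MeasurableSpace Ω]
    (P : Measure Ω) (μ : PMF (Function.End V))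
    (X : ℤ → Ω → Fin m → V) (N : ℤ → Ω → Function.End V) : Prop where
  measurable_X : ∀ k, Measurable (X k)
  measurable_N : ∀ k, Measurable (N k)
  iid : iIndepFun N P
  step : ∀ k, ∀ᵐ ω ∂P, X k ω = act (N k ω) (X (k - 1) ω)
  indep : ∀ k, Indep (MeasurableSpace.comap (N k) inferInstance)
    (past (fun j ω => (X j ω, N j ω)) (k - 1)) P
  law : ∀ k, HasLaw (N k) μ.toMeasure P

/-- `(X_{·+1}, N_{·+1})` and `(X, N)` have the same law. -/
def IsStationary {V : Type u} [MeasurableSpace V] {m : ℕ} [MeasurableSpace Ω]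
    (P : Measure Ω) (X : ℤ → Ω → Fin m → V) (N : ℤ → Ω → Function.End V) : Prop :=
  P.map (fun ω (k : ℤ) => (X (k + 1) ω, N (k + 1) ω)) = P.map (fun ω (k : ℤ) => (X k ω, N k ω))

end Evolutions

end ActionEvolution

end

open ActionEvolution

/-!
Let `η` be an idempotent limit point of the convolution powers of `μ` and `e` an idempotent in its
support.

*Structure of the limit points.* For `x`, `y` in the support of `η` one has `δ_{xy} η = δ_x η`
(`dirac_mul_mul_of_idempotent`), because bounded harmonic functions of the random walk with steps
of law `η` are constant along it; on a finite monoid this is the vanishing of a mean square.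
It follows that `H = e supp η e` is a group, that `eηe` is uniform on `H`, and that
`η = η^L ω_H η^R`. The limit points form a finite cyclic group with unit `η`, on which `ρ ↦ eρe` is
injective and multiplicative. Each `eρe` is the uniform law on a coset `aH = Ha`, and
`ρ = η^L a ω_H η^R` (`compress_eq`, `limit_eq`). These cosets make up the group `G`, and `G/H` is
cyclic, generated by the coset of any `γ` in the support of `eμηe`. The idempotent `e` has minimal
rank in `S`, so a tuple in `eW_μ` enumerates the image of `e`; hence `G` acts freely on `eW_μ`, and a
choice of orbit representatives yields `W` (`exists_frame`).

*Dynamics on `LGW`.* A map `f` in the support of `μ` moves `l g w` to `l' b g w`, where `l' ∈ L` and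
`b ∈ γH` depend on `f` and `l` only (`Frame.step_factorization`). So the `W`-coordinate is constant,
the coset of `γ^{-k} X_k^G` modulo `H` is constant (the phase, represented in `C` by `Y_C`), and `f`
commutes with the right action `(l g w) · c = l (g c) w` of `G` (`Frame.act_shift`). An invariant law
is `Λ = η^L ω_G Λ_W`, hence invariant under this right action. As the action permutes the phases
transitively and fixes the `W`-coordinate, the phase is uniform and independent of the
`W`-coordinate (`measure_inter_phase`).

*Independence.* Conditionally on an event of the remote past, the law of `X_k` is `μ^n Q_n` for every
`n`, and thus `ηQ` by compactness (`IsEvolution.exists_conditional_law`). Such a law is invariant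
under the right action of `H`, and this invariance persists when one conditions on the driving maps
as well, since these commute with the action. The factor of `X_k^G` in `H` is then uniform given
`F^N_k` and the remote past (`iIndep_past_remotePast_hPart`).

*σ-fields.* Almost surely some product `N_j ⋯ N_{j-n+1}` falls into the support of `η`, and such a
map determines the `L`-coordinate of the image of any point. Therefore `X_j^L`, and with it the
increment of `X_j^G`, is a function of the driving maps up to time `j` (`measurable_projL_past`).
The past of `X` is recovered from these, the phase, the `W`-coordinate and the factor in `H`. The
phase and the `W`-coordinate belong to the remote past; the remaining variables are independent of
it, so that the remote past is generated by these two (`measurableSet_comap_of_indep`,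
`asEq_remotePast`).
-/

open MeasureTheory ProbabilityTheory Filter Topology

noncomputable section

namespace ActionEvolution

universe u v w

set_option linter.unusedSectionVars false

/-! ### The compact monoid of laws -/

section Topology

variable {α : Type u} {β : Type v} {γ : Type w}

/-- Laws carry the topology of pointwise convergence. -/
instance pmfTopology : TopologicalSpace (PMF α) :=
  TopologicalSpace.induced (fun (ρ : PMF α) (a : α) => ρ a) inferInstance

theorem isEmbedding_pmf : IsEmbedding (fun (ρ : PMF α) (a : α) => ρ a) :=
  ⟨⟨rfl⟩, fun _ _ h => PMF.ext fun a => congrFun h a⟩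

theorem tendsto_pmf_iff {ι : Type*} {l : Filter ι} {u : ι → PMF α} {ρ : PMF α} :
    Tendsto u l (𝓝 ρ) ↔ ∀ a, Tendsto (fun n => u n a) l (𝓝 (ρ a)) := by
  rw [isEmbedding_pmf.tendsto_nhds_iff, tendsto_pi_nhds]
  rfl

theorem continuous_pmf_apply (a : α) : Continuous fun ρ : PMF α => ρ a :=
  (continuous_apply a).comp isEmbedding_pmf.continuous

instance : T2Space (PMF α) := isEmbedding_pmf.t2Space

instance [Finite α] : FirstCountableTopology (PMF α) :=
  isEmbedding_pmf.isInducing.firstCountableTopology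

instance [Finite α] : CompactSpace (PMF α) := by
  cases nonempty_fintype α
  have hr : Set.range (fun (ρ : PMF α) (a : α) => ρ a) = {f | ∑ a, f a = 1} := by
    ext f
    constructor
    · rintro ⟨ρ, rfl⟩
      simpa [tsum_fintype] using ρ.tsum_coe
    · intro hf
      exact ⟨PMF.ofFintype f hf, by ext a; simp⟩
  have hc : IsClosed (Set.range (fun (ρ : PMF α) (a : α) => ρ a)) := by
    rw [hr]
    exact isClosed_eq (continuous_finsetSum _ fun a _ => continuous_apply a) continuous_const
  exact (IsClosedEmbedding.mk isEmbedding_pmf hc).compactSpace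

theorem continuous_bind_map [Finite α] [Finite β] (φ : α → β → γ) :
    Continuous fun q : PMF α × PMF β => q.1.bind fun a => q.2.map (φ a) := by
  classical
  cases nonempty_fintype α
  cases nonempty_fintype β
  rw [continuous_iff_continuousAt]
  intro q
  rw [ContinuousAt, tendsto_pmf_iff]
  intro c
  simp only [PMF.bind_apply, PMF.map_apply, tsum_fintype]
  refine tendsto_finsetSum _ fun a _ => ?_
  refine ENNReal.Tendsto.mul
    (((continuous_pmf_apply a).comp continuous_fst).continuousAt.tendsto) (Or.inr ?_) ?_
    (Or.inr (PMF.apply_ne_top _ _))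
  · refine (ENNReal.sum_lt_top.2 fun b _ => ?_).ne
    split_ifs
    · exact PMF.apply_lt_top _ _
    · simp
  · refine tendsto_finsetSum _ fun b _ => ?_
    split_ifs
    · exact ((continuous_pmf_apply b).comp continuous_snd).continuousAt.tendsto
    · exact tendsto_const_nhds

end Topology

section Monoid

variable {V : Type u}

/-- Laws on maps form a monoid under convolution. -/
instance pmfMonoid : Monoid (PMF (Function.End V)) where
  mul := conv
  one := PMF.pure 1
  mul_assoc a b c := by
    change conv (conv a b) c = conv a (conv b c)
    simp only [conv, PMF.bind_bind, PMF.map_bind, PMF.bind_map, PMF.map_comp]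
    rfl
  one_mul a := by
    change conv (PMF.pure 1) a = a
    simp only [conv, PMF.pure_bind, one_mul]
    exact PMF.map_id a
  mul_one a := by
    change conv a (PMF.pure 1) = a
    simp only [conv, PMF.pure_map, mul_one, PMF.bind_pure]

theorem conv_eq_mul (ρ σ : PMF (Function.End V)) : conv ρ σ = ρ * σ := rfl

theorem mul_def (ρ σ : PMF (Function.End V)) : ρ * σ = ρ.bind fun f => σ.map fun g => f * g := rfl

theorem convPow_eq_pow (μ : PMF (Function.End V)) (n : ℕ) : convPow μ n = μ ^ n := by
  induction n with
  | zero => rfl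
  | succ n ih => rw [pow_succ', ← ih]; rfl

instance [Finite V] : ContinuousMul (PMF (Function.End V)) :=
  ⟨continuous_bind_map fun f g : Function.End V => f * g⟩

/-- The Dirac mass at a map. It is a synonym of `PMF.pure`, which makes products of laws readable. -/
def dirac (f : Function.End V) : PMF (Function.End V) := PMF.pure f

theorem dirac_mul_dirac (f g : Function.End V) : dirac f * dirac g = dirac (f * g) := by
  simp [mul_def, dirac, PMF.pure_bind, PMF.pure_map]

theorem dirac_mul (f : Function.End V) (ρ : PMF (Function.End V)) :
    dirac f * ρ = ρ.map fun g => f * g := by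
  simp [mul_def, dirac, PMF.pure_bind]

theorem mul_dirac (f : Function.End V) (ρ : PMF (Function.End V)) :
    ρ * dirac f = ρ.map fun g => g * f := by
  simp only [mul_def, dirac, PMF.pure_map]
  rfl

theorem bind_congr_support {α : Type u} {β : Type v} {p : PMF α} {f g : α → PMF β}
    (h : ∀ a ∈ p.support, f a = g a) : p.bind f = p.bind g := by
  ext b
  simp only [PMF.bind_apply]
  refine tsum_congr fun a => ?_
  by_cases ha : a ∈ p.support
  · rw [h a ha]
  · rw [(p.apply_eq_zero_iff a).2 ha, zero_mul, zero_mul]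

theorem mul_eq_bind_dirac (ρ σ : PMF (Function.End V)) :
    ρ * σ = ρ.bind fun f => dirac f * σ := by
  simp only [dirac_mul]; rfl

theorem mul_eq_bind_dirac' (ρ σ : PMF (Function.End V)) :
    ρ * σ = σ.bind fun g => ρ * dirac g := by
  simp only [mul_def, dirac, PMF.pure_map]
  rw [PMF.bind_comm]
  rfl

theorem mul_congr_left {ρ σ τ : PMF (Function.End V)}
    (h : ∀ f ∈ ρ.support, dirac f * σ = dirac f * τ) : ρ * σ = ρ * τ := by
  rw [mul_eq_bind_dirac, mul_eq_bind_dirac ρ τ]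
  exact bind_congr_support h

theorem mul_eq_right {ρ σ τ : PMF (Function.End V)}
    (h : ∀ f ∈ ρ.support, dirac f * σ = τ) : ρ * σ = τ := by
  rw [mul_eq_bind_dirac, bind_congr_support h, PMF.bind_const]

theorem mul_eq_left {ρ σ τ : PMF (Function.End V)}
    (h : ∀ f ∈ ρ.support, σ * dirac f = τ) : σ * ρ = τ := by
  rw [mul_eq_bind_dirac', bind_congr_support h, PMF.bind_const]

theorem mem_support_mul {ρ σ : PMF (Function.End V)} {h : Function.End V} :
    h ∈ (ρ * σ).support ↔ ∃ f ∈ ρ.support, ∃ g ∈ σ.support, f * g = h := by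
  simp only [mul_def, PMF.mem_support_bind_iff, PMF.mem_support_map_iff]

theorem mul_mem_support {ρ σ : PMF (Function.End V)} {f g : Function.End V}
    (hf : f ∈ ρ.support) (hg : g ∈ σ.support) : f * g ∈ (ρ * σ).support :=
  mem_support_mul.2 ⟨f, hf, g, hg, rfl⟩

theorem mem_support_dirac_mul {ρ : PMF (Function.End V)} {f h : Function.End V} :
    h ∈ (dirac f * ρ).support ↔ ∃ g ∈ ρ.support, f * g = h := by
  rw [dirac_mul, PMF.mem_support_map_iff]

theorem mem_support_mul_dirac {ρ : PMF (Function.End V)} {f h : Function.End V} :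
    h ∈ (ρ * dirac f).support ↔ ∃ g ∈ ρ.support, g * f = h := by
  rw [mul_dirac, PMF.mem_support_map_iff]

variable {m : ℕ}

theorem actLaw_mul (ρ σ : PMF (Function.End V)) (Λ : PMF (Fin m → V)) :
    actLaw (ρ * σ) Λ = actLaw ρ (actLaw σ Λ) := by
  simp only [actLaw, mul_def, PMF.bind_bind, PMF.map_bind, PMF.bind_map, PMF.map_comp]
  rfl

theorem actLaw_one (Λ : PMF (Fin m → V)) : actLaw 1 Λ = Λ := by
  change actLaw (PMF.pure 1) Λ = Λ
  simp only [actLaw, PMF.pure_bind]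
  exact PMF.map_id Λ

theorem continuous_actLaw [Finite V] :
    Continuous fun q : PMF (Function.End V) × PMF (Fin m → V) => actLaw q.1 q.2 :=
  continuous_bind_map act

theorem actLaw_dirac (f : Function.End V) (Λ : PMF (Fin m → V)) :
    actLaw (dirac f) Λ = Λ.map (act f) := by
  simp [actLaw, dirac, PMF.pure_bind]

theorem actLaw_eq_bind_dirac (ρ : PMF (Function.End V)) (Λ : PMF (Fin m → V)) :
    actLaw ρ Λ = ρ.bind fun f => actLaw (dirac f) Λ := by
  simp only [actLaw_dirac]; rfl

theorem actLaw_eq_bind (ρ : PMF (Function.End V)) (Λ : PMF (Fin m → V)) :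
    actLaw ρ Λ = Λ.bind fun x => ρ.map fun f => act f x := by
  simp only [actLaw, ← PMF.bind_pure_comp]
  rw [PMF.bind_comm]
  rfl

theorem mem_support_actLaw {ρ : PMF (Function.End V)} {Λ : PMF (Fin m → V)} {y : Fin m → V} :
    y ∈ (actLaw ρ Λ).support ↔ ∃ f ∈ ρ.support, ∃ x ∈ Λ.support, act f x = y := by
  simp only [actLaw, PMF.mem_support_bind_iff, PMF.mem_support_map_iff]

theorem act_mul (f g : Function.End V) (x : Fin m → V) : act (f * g) x = act f (act g x) := rfl

end Monoid

/-! ### Limit points of powers in a compact monoid -/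

section LimitPoints

variable {M : Type u} [Monoid M] [TopologicalSpace M]

/-- The subsequential limits of the sequence `(a ^ n)`. -/
def powerLimits (a : M) : Set M :=
  {x | ∃ φ : ℕ → ℕ, StrictMono φ ∧ Tendsto (fun n => a ^ φ n) atTop (𝓝 x)}

variable {a x y η : M}

theorem iterate_mul_left_eq_pow_mul {M : Type u} [Monoid M] (a η : M) (n : ℕ) :
    (fun x => a * x)^[n] η = a ^ n * η := by
  induction n with
  | zero => simp
  | succ n ih => rw [Function.iterate_succ_apply', ih, pow_succ', mul_assoc]

theorem mem_powerLimits_of_tendsto {φ : ℕ → ℕ} (hφ : Tendsto φ atTop atTop)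
    (h : Tendsto (fun n => a ^ φ n) atTop (𝓝 x)) : x ∈ powerLimits a := by
  obtain ⟨ψ, hψ, hψ'⟩ := strictMono_subseq_of_tendsto_atTop hφ
  exact ⟨φ ∘ ψ, hψ', h.comp hψ.tendsto_atTop⟩

theorem mul_mem_powerLimits [ContinuousMul M] (hx : x ∈ powerLimits a) (hy : y ∈ powerLimits a) :
    x * y ∈ powerLimits a := by
  obtain ⟨φ, hφ, hx⟩ := hx
  obtain ⟨ψ, hψ, hy⟩ := hy
  refine ⟨fun n => φ n + ψ n, hφ.add hψ, ?_⟩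
  simpa only [pow_add] using hx.mul hy

theorem pow_mul_mem_powerLimits [ContinuousMul M] (hx : x ∈ powerLimits a) (k : ℕ) :
    a ^ k * x ∈ powerLimits a := by
  obtain ⟨φ, hφ, hx⟩ := hx
  refine ⟨fun n => k + φ n, fun i j h => Nat.add_lt_add_left (hφ h) k, ?_⟩
  simpa only [pow_add] using tendsto_const_nhds.mul hx

theorem commute_of_mem_powerLimits [ContinuousMul M] [T2Space M] (hx : x ∈ powerLimits a)
    (hc : Commute y a) : Commute y x := by
  obtain ⟨φ, -, hx⟩ := hx
  refine tendsto_nhds_unique (tendsto_const_nhds.mul hx) ?_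
  refine (hx.mul tendsto_const_nhds).congr fun n => ?_
  exact (hc.pow_right (φ n)).eq.symm

theorem commute_powerLimits [ContinuousMul M] [T2Space M] (hx : x ∈ powerLimits a)
    (hy : y ∈ powerLimits a) : Commute x y :=
  commute_of_mem_powerLimits hy (commute_of_mem_powerLimits hx (Commute.refl a)).symm

theorem powerLimits_nonempty [CompactSpace M] [FirstCountableTopology M] (a : M) :
    (powerLimits a).Nonempty := by
  obtain ⟨x, -, φ, hφ, hx⟩ := isCompact_univ.isSeqCompact (x := fun n => a ^ n) fun _ => trivial
  exact ⟨x, φ, hφ, hx⟩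

theorem mem_powerLimits_iff_mapClusterPt [FirstCountableTopology M] :
    x ∈ powerLimits a ↔ MapClusterPt x atTop fun n => a ^ n := by
  constructor
  · rintro ⟨φ, hφ, hx⟩
    exact hx.mapClusterPt.of_comp hφ.tendsto_atTop
  · intro h
    obtain ⟨φ, hφ, hx⟩ := h.tendsto_subseq
    exact ⟨φ, hφ, hx⟩

theorem isClosed_powerLimits [FirstCountableTopology M] (a : M) : IsClosed (powerLimits a) := by
  have : powerLimits a = {x | MapClusterPt x atTop fun n => a ^ n} :=
    Set.ext fun _ => mem_powerLimits_iff_mapClusterPt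
  rw [this]
  exact isClosed_setOfPred_clusterPt

theorem exists_idempotent_powerLimits [ContinuousMul M] [T2Space M] [CompactSpace M]
    [FirstCountableTopology M] (a : M) : ∃ η ∈ powerLimits a, η * η = η :=
  exists_idempotent_in_compact_subsemigroup (fun _ => continuous_id.mul continuous_const)
    (powerLimits a) (powerLimits_nonempty a) (isClosed_powerLimits a).isCompact
    fun _ hx _ hy => mul_mem_powerLimits hx hy

/-- Any limit point is a multiple of any other: subtract the exponents. -/
theorem exists_mul_eq_of_mem_powerLimits [ContinuousMul M] [T2Space M] [CompactSpace M]
    [FirstCountableTopology M] (hx : x ∈ powerLimits a) (hy : y ∈ powerLimits a) :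
    ∃ z ∈ powerLimits a, y * z = x := by
  obtain ⟨φ, hφ, hx⟩ := hx
  obtain ⟨ψ, hψ, hy⟩ := hy
  have hb : ∀ n, ψ n + n ≤ φ (ψ n + n) := fun n => hφ.le_apply
  have hd : StrictMono fun n => ψ n + n := hψ.add strictMono_id
  obtain ⟨z, -, τ, hτ, hz⟩ := isCompact_univ.isSeqCompact
    (x := fun n => a ^ (φ (ψ n + n) - ψ n)) fun _ => trivial
  refine ⟨z, ?_, ?_⟩
  · refine mem_powerLimits_of_tendsto (φ := fun n => φ (ψ (τ n) + τ n) - ψ (τ n)) ?_ hz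
    refine tendsto_atTop_mono (fun n => ?_) hτ.tendsto_atTop
    have := hb (τ n)
    omega
  · have h1 := (hy.comp hτ.tendsto_atTop).mul hz
    refine tendsto_nhds_unique h1 ?_
    refine ((hx.comp hd.tendsto_atTop).comp hτ.tendsto_atTop).congr fun n => ?_
    simp only [Function.comp_apply, ← pow_add]
    congr 1
    have := hb (τ n)
    omega

/-- Two powers satisfy `a ^ i * η = a ^ j * η`, and `a ^ i * η` is cancelled by multiplying with a
limit point inverse to it. -/
theorem idempotent_mem_periodicPts [ContinuousMul M] [T2Space M] [CompactSpace M]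
    [FirstCountableTopology M] (hη : η ∈ powerLimits a) (hfin : (powerLimits a).Finite) :
    η ∈ Function.periodicPts (fun x => a * x) := by
  have hsub : Set.range (fun n => a ^ n * η) ⊆ powerLimits a := by
    rintro _ ⟨n, rfl⟩
    exact pow_mul_mem_powerLimits hη n
  have := (hfin.subset hsub).to_subtype
  obtain ⟨i, j, hij, h⟩ := Finite.exists_ne_map_eq_of_infinite
    (Set.rangeFactorization fun n => a ^ n * η)
  wlog hlt : i < j generalizing i j
  · exact this j i hij.symm h.symm (by omega)
  replace h : a ^ i * η = a ^ j * η := congrArg Subtype.val h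
  obtain ⟨z, -, hz⟩ := exists_mul_eq_of_mem_powerLimits hη (pow_mul_mem_powerLimits hη i)
  refine Function.mk_mem_periodicPts (n := j - i) (by omega) ?_
  rw [Function.IsPeriodicPt, Function.IsFixedPt, iterate_mul_left_eq_pow_mul]
  rw [← hz, ← mul_assoc, ← mul_assoc, ← pow_add, Nat.sub_add_cancel hlt.le, ← h]

section Idempotent

variable [ContinuousMul M] [T2Space M] [CompactSpace M] [FirstCountableTopology M]
  (hη : η ∈ powerLimits a) (hηη : η * η = η)

include hη hηη

/-- The idempotent limit point is a unit for the limit points, which thus form a group. -/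
theorem idempotent_mul_powerLimits (hx : x ∈ powerLimits a) : η * x = x := by
  obtain ⟨z, -, rfl⟩ := exists_mul_eq_of_mem_powerLimits hx hη
  rw [← mul_assoc, hηη]

theorem powerLimits_mul_idempotent (hx : x ∈ powerLimits a) : x * η = x := by
  rw [(commute_powerLimits hx hη).eq, idempotent_mul_powerLimits hη hηη hx]

variable (hfin : (powerLimits a).Finite)

include hfin

theorem exists_pow_mul_eq (hx : x ∈ powerLimits a) : ∃ n, a ^ n * η = x := by
  have hsub : Set.range (fun n => a ^ n * η) ⊆ powerLimits a := by
    rintro _ ⟨n, rfl⟩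
    exact pow_mul_mem_powerLimits hη n
  have hcl : IsClosed (Set.range fun n => a ^ n * η) := (hfin.subset hsub).isClosed
  have hx' := powerLimits_mul_idempotent hη hηη hx
  obtain ⟨φ, -, hφ⟩ := hx
  have := hcl.mem_of_tendsto (hφ.mul tendsto_const_nhds)
    (Eventually.of_forall fun n => ⟨φ n, rfl⟩)
  rwa [hx'] at this

/-- The limit points are the `a ^ k * η`, for `k` below the minimal period of `η`. -/
theorem ncard_powerLimits :
    (powerLimits a).ncard = Function.minimalPeriod (fun x => a * x) η := by
  have hper := idempotent_mem_periodicPts hη hfin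
  have : powerLimits a = (fun n => (fun x => a * x)^[n] η) ''
      (Finset.range (Function.minimalPeriod (fun x => a * x) η) : Set ℕ) := by
    ext x
    constructor
    · intro hx
      obtain ⟨n, rfl⟩ := exists_pow_mul_eq hη hηη hfin hx
      refine ⟨n % Function.minimalPeriod (fun x => a * x) η, ?_, ?_⟩
      · simpa using Nat.mod_lt _ (Function.minimalPeriod_pos_of_mem_periodicPts hper)
      · simp only [Function.iterate_mod_minimalPeriod_eq]
        exact iterate_mul_left_eq_pow_mul a η n
    · rintro ⟨n, -, rfl⟩
      simp only [iterate_mul_left_eq_pow_mul]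
      exact pow_mul_mem_powerLimits hη n
  rw [this, Set.InjOn.ncard_image, Set.ncard_coe_finset, Finset.card_range]
  simpa [Set.InjOn] using Function.iterate_injOn_Iio_minimalPeriod (f := fun x => a * x) (x := η)

theorem ncard_powerLimits_pos : 0 < (powerLimits a).ncard := by
  rw [ncard_powerLimits hη hηη hfin]
  exact Function.minimalPeriod_pos_of_mem_periodicPts (idempotent_mem_periodicPts hη hfin)

theorem pow_mod_mul_idempotent (n : ℕ) : a ^ (n % (powerLimits a).ncard) * η = a ^ n * η := by
  rw [ncard_powerLimits hη hηη hfin, ← iterate_mul_left_eq_pow_mul,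
    Function.iterate_mod_minimalPeriod_eq, iterate_mul_left_eq_pow_mul]

theorem pow_mul_idempotent_injOn {i j : ℕ} (hi : i < (powerLimits a).ncard)
    (hj : j < (powerLimits a).ncard) (h : a ^ i * η = a ^ j * η) : i = j := by
  rw [ncard_powerLimits hη hηη hfin] at hi hj
  rw [← iterate_mul_left_eq_pow_mul, ← iterate_mul_left_eq_pow_mul] at h
  exact Function.iterate_injOn_Iio_minimalPeriod hi hj h

end Idempotent

end LimitPoints

theorem subseqLimits_eq_powerLimits {V : Type u} (μ : PMF (Function.End V)) :
    subseqLimits μ = powerLimits μ := by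
  ext ρ
  simp only [subseqLimits, powerLimits, Set.mem_ofPred_eq, tendsto_pmf_iff, convPow_eq_pow]

/-! ### Idempotent laws -/

section Expectation

variable {α : Type u} {β : Type v} [Fintype α] [Fintype β]

/-- The expectation of a real function under a law on a finite set. -/
def expect (p : PMF α) (F : α → ℝ) : ℝ := ∑ a, (p a).toReal * F a

theorem expect_map (p : PMF α) (f : α → β) (F : β → ℝ) :
    expect (p.map f) F = expect p fun a => F (f a) := by
  classical
  simp only [expect, PMF.map_apply, tsum_fintype]
  have h : ∀ b, (∑ a, if b = f a then p a else 0).toReal =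
      ∑ a, if b = f a then (p a).toReal else 0 := by
    intro b
    rw [ENNReal.toReal_sum]
    · refine Finset.sum_congr rfl fun a _ => ?_
      split_ifs <;> simp
    · intro a _
      split_ifs
      · exact PMF.apply_ne_top _ _
      · simp
  simp only [h, Finset.sum_mul, ite_mul, zero_mul]
  rw [Finset.sum_comm]
  simp

theorem expect_bind (p : PMF α) (f : α → PMF β) (F : β → ℝ) :
    expect (p.bind f) F = expect p fun a => expect (f a) F := by
  simp only [expect, PMF.bind_apply, tsum_fintype]
  have h : ∀ b, (∑ a, p a * f a b).toReal = ∑ a, (p a).toReal * (f a b).toReal := by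
    intro b
    rw [ENNReal.toReal_sum]
    · simp only [ENNReal.toReal_mul]
    · intro a _
      exact ENNReal.mul_ne_top (PMF.apply_ne_top _ _) (PMF.apply_ne_top _ _)
  simp only [h, Finset.sum_mul, Finset.mul_sum, mul_assoc]
  rw [Finset.sum_comm]

theorem pmf_ext_of_expect {p q : PMF α} (h : ∀ F, expect p F = expect q F) : p = q := by
  classical
  ext a
  have := h (Pi.single a 1)
  simp only [expect, Pi.single_apply, mul_ite, mul_one, mul_zero, Finset.sum_ite_eq',
    Finset.mem_univ, if_true] at this
  exact (ENNReal.toReal_eq_toReal_iff' (PMF.apply_ne_top _ _) (PMF.apply_ne_top _ _)).1 this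

theorem sum_toReal_pmf (p : PMF α) : ∑ a, (p a).toReal = 1 := by
  rw [← ENNReal.toReal_sum fun a _ => PMF.apply_ne_top _ _, ← tsum_fintype (L := .unconditional _),
    p.tsum_coe, ENNReal.toReal_one]

/-- A Liouville property: if the law `p` is the image of `p ⊗ p` under an operation `m`, then a
function which is harmonic, `ψ x = ∑ y, p y ψ (m x y)`, satisfies `ψ (m x y) = ψ x` on the support.
Indeed the mean square of `ψ (m x y) - ψ x` vanishes. -/
theorem harmonic_eq_of_image_prod (p : PMF α) (m : α → α → α)
    (hm : ∀ F : α → ℝ, (expect p fun x => expect p fun y => F (m x y)) = expect p F)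
    {ψ : α → ℝ} (hψ : ∀ x, (expect p fun y => ψ (m x y)) = ψ x) {x y : α}
    (hx : x ∈ p.support) (hy : y ∈ p.support) : ψ (m x y) = ψ x := by
  have hsq : ∑ x, ∑ y, (p x).toReal * (p y).toReal * (ψ (m x y) - ψ x) ^ 2 = 0 := by
    have h1 := hm fun z => ψ z ^ 2
    have h2 : ∀ x, ∑ y, (p y).toReal * (ψ (m x y) - ψ x) ^ 2
        = (expect p fun y => ψ (m x y) ^ 2) - ψ x ^ 2 := by
      intro x
      have h3 : ∀ y, (p y).toReal * (ψ (m x y) - ψ x) ^ 2 = (p y).toReal * ψ (m x y) ^ 2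
          - 2 * ψ x * ((p y).toReal * ψ (m x y)) + (p y).toReal * ψ x ^ 2 := fun y => by ring
      simp only [h3, Finset.sum_add_distrib, Finset.sum_sub_distrib, ← Finset.mul_sum,
        ← Finset.sum_mul, sum_toReal_pmf]
      have h4 := hψ x
      simp only [expect] at h4 ⊢
      rw [h4]
      ring
    simp only [mul_assoc, ← Finset.mul_sum, h2, mul_sub, Finset.sum_sub_distrib]
    simp only [expect] at h1 ⊢
    rw [h1, sub_self]
  have hnn : ∀ x y, 0 ≤ (p x).toReal * (p y).toReal * (ψ (m x y) - ψ x) ^ 2 := fun x y => by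
    positivity
  have h5 := (Finset.sum_eq_zero_iff_of_nonneg fun x _ =>
    Finset.sum_nonneg fun y _ => hnn x y).1 hsq x (Finset.mem_univ x)
  have h6 := (Finset.sum_eq_zero_iff_of_nonneg fun y _ => hnn x y).1 h5 y (Finset.mem_univ y)
  have hx0 : (p x).toReal ≠ 0 := ENNReal.toReal_ne_zero.2 ⟨hx, PMF.apply_ne_top _ _⟩
  have hy0 : (p y).toReal ≠ 0 := ENNReal.toReal_ne_zero.2 ⟨hy, PMF.apply_ne_top _ _⟩
  have h7 : (ψ (m x y) - ψ x) ^ 2 = 0 := by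
    rcases mul_eq_zero.1 h6 with h | h
    · exact absurd h (mul_ne_zero hx0 hy0)
    · exact h
  exact sub_eq_zero.1 (pow_eq_zero_iff two_ne_zero |>.1 h7)

end Expectation

section IdempotentLaw

theorem expect_mul {V : Type u} [Fintype (Function.End V)] (ρ σ : PMF (Function.End V))
    (F : Function.End V → ℝ) :
    expect (ρ * σ) F = expect ρ fun x => expect σ fun y => F (x * y) := by
  simp only [mul_def, expect_bind, expect_map]

variable {V : Type u} [Finite V] {η : PMF (Function.End V)}

/-- For an idempotent law `η` and `x`, `y` in its support, `δ_{xy} η = δ_x η`: for each test function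
`F`, the function `x ↦ E F(xz)`, `z ∼ η`, is harmonic for the random walk with steps of law `η`.
The group structure of `e supp η e` and the product form of `η` rest on this identity. -/
theorem dirac_mul_mul_of_idempotent (hη : η * η = η) {x y : Function.End V}
    (hx : x ∈ η.support) (hy : y ∈ η.support) : dirac (x * y) * η = dirac x * η := by
  cases nonempty_fintype (Function.End V)
  refine pmf_ext_of_expect fun F => ?_
  have hm : ∀ G : Function.End V → ℝ,
      (expect η fun x => expect η fun y => G (x * y)) = expect η G := fun G => by
    rw [← expect_mul, hη]
  simp only [dirac_mul, expect_map]
  refine harmonic_eq_of_image_prod η (fun x y => x * y) hm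
    (ψ := fun x => expect η fun z => F (x * z)) (fun x => ?_) hx hy
  simp only [mul_assoc]
  exact hm fun w => F (x * w)

end IdempotentLaw

/-! ### Units of a corner monoid -/

/-- The invertible elements of the monoid `eMe` attached to an idempotent `e` of a monoid `M`. -/
@[ext]
structure CornerUnit {M : Type u} [Monoid M] {e : M} (he : e * e = e) where
  val : M
  inv : M
  e_mul_val : e * val = val
  val_mul_e : val * e = val
  e_mul_inv : e * inv = inv
  inv_mul_e : inv * e = inv
  val_inv : val * inv = e
  inv_val : inv * val = e

namespace CornerUnit

variable {M : Type u} [Monoid M] {e : M} {he : e * e = e}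

theorem val_injective : Function.Injective (val : CornerUnit he → M) := by
  intro a b h
  have : a.inv = b.inv := by
    calc a.inv = a.inv * e := a.inv_mul_e.symm
      _ = a.inv * (a.val * b.inv) := by rw [h, b.val_inv]
      _ = b.inv := by rw [← mul_assoc, a.inv_val, b.e_mul_inv]
  exact CornerUnit.ext h this

instance : Group (CornerUnit he) where
  mul a b :=
    { val := a.val * b.val
      inv := b.inv * a.inv
      e_mul_val := by rw [← mul_assoc, a.e_mul_val]
      val_mul_e := by rw [mul_assoc, b.val_mul_e]
      e_mul_inv := by rw [← mul_assoc, b.e_mul_inv]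
      inv_mul_e := by rw [mul_assoc, a.inv_mul_e]
      val_inv := by rw [mul_assoc, ← mul_assoc b.val, b.val_inv, a.e_mul_inv, a.val_inv]
      inv_val := by rw [mul_assoc, ← mul_assoc a.inv, a.inv_val, b.e_mul_val, b.inv_val] }
  one := ⟨e, e, he, he, he, he, he, he⟩
  inv a := ⟨a.inv, a.val, a.e_mul_inv, a.inv_mul_e, a.e_mul_val, a.val_mul_e, a.inv_val, a.val_inv⟩
  mul_assoc a b c := val_injective (mul_assoc a.val b.val c.val)
  one_mul a := val_injective a.e_mul_val
  mul_one a := val_injective a.val_mul_e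
  inv_mul_cancel a := val_injective a.inv_val

theorem val_mul (a b : CornerUnit he) : (a * b).val = a.val * b.val := rfl

theorem val_one : (1 : CornerUnit he).val = e := rfl

theorem val_mul_val_inv (a : CornerUnit he) : a.val * a⁻¹.val = e := a.val_inv

theorem val_inv_mul_val (a : CornerUnit he) : a⁻¹.val * a.val = e := a.inv_val

theorem val_pow (a : CornerUnit he) (n : ℕ) : (a ^ n).val = e * a.val ^ n := by
  induction n with
  | zero => simp [val_one]
  | succ n ih => rw [pow_succ, val_mul, ih, pow_succ, mul_assoc]

theorem finite [Finite M] : Finite (CornerUnit he) := Finite.of_injective _ val_injective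

end CornerUnit

/-- In a set containing the inverse of a unit of the corner, `relInv` is that inverse. -/
theorem relInv_val {V : Type u} {e : Function.End V} {he : e * e = e}
    {A : Set (Function.End V)} (a : CornerUnit he) (hA : a⁻¹.val ∈ A) (hAe : ∀ x ∈ A, e * x = x) :
    relInv e A a.val = a⁻¹.val := by
  have h : ∃ x ∈ A, a.val * x = e ∧ x * a.val = e :=
    ⟨a⁻¹.val, hA, a.val_inv, a.inv_val⟩
  rw [relInv, dif_pos h]
  obtain ⟨h1, h2, h3⟩ := h.choose_spec
  calc h.choose = e * h.choose := (hAe _ h1).symm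
    _ = a⁻¹.val * a.val * h.choose := by rw [a.val_inv_mul_val]
    _ = a⁻¹.val := by rw [mul_assoc, h2, a⁻¹.val_mul_e]

/-! ### Uniform laws -/

section Uniform

variable {α : Type u} {β : Type v} [Finite α] [Nonempty α] [Finite β] [Nonempty β]

open scoped Classical in
theorem unif_apply {A : Set α} (hA : A.Nonempty) (a : α) :
    unif A a = if a ∈ A then (A.ncard : ENNReal)⁻¹ else 0 := by
  have h : A.toFinite.toFinset.Nonempty := by simpa using hA
  rw [unif, dif_pos h, PMF.uniformOfFinset_apply, Set.ncard_eq_toFinset_card A]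
  simp

theorem support_unif {A : Set α} (hA : A.Nonempty) : (unif A).support = A := by
  have h : A.toFinite.toFinset.Nonempty := by simpa using hA
  rw [unif, dif_pos h, PMF.support_uniformOfFinset]
  simp

theorem map_unif_of_bijOn {A : Set α} {B : Set β} {f : α → β} (h : Set.BijOn f A B)
    (hA : A.Nonempty) : (unif A).map f = unif B := by
  classical
  have hB : B.Nonempty := h.image_eq ▸ hA.image f
  have hc : A.ncard = B.ncard := by
    rw [← h.image_eq, h.injOn.ncard_image]
  ext b
  rw [PMF.map_apply, unif_apply hB]
  split_ifs with hb
  · obtain ⟨a, ha, rfl⟩ := h.surjOn hb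
    rw [tsum_eq_single a]
    · rw [if_pos rfl, unif_apply hA, if_pos ha, hc]
    · intro a' hne
      split_ifs with he
      · rw [unif_apply hA, if_neg]
        exact fun ha' => hne (h.injOn ha' ha he.symm)
      · rfl
  · refine ENNReal.tsum_eq_zero.2 fun a => ?_
    split_ifs with he
    · rw [unif_apply hA, if_neg]
      exact fun ha => hb (he ▸ h.mapsTo ha)
    · rfl

end Uniform

/-- The set of maps underlying a subgroup of the units of a corner. -/
def groupSet {M : Type u} [Monoid M] {e : M} {he : e * e = e} (K : Subgroup (CornerUnit he)) :
    Set M := CornerUnit.val '' (K : Set (CornerUnit he))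

section GroupSet

variable {V : Type u} [Finite V] {e : Function.End V} {he : e * e = e}
  (K : Subgroup (CornerUnit he))

omit [Finite V] in
theorem groupSet_nonempty : (groupSet K).Nonempty := ⟨e, 1, K.one_mem, rfl⟩

theorem dirac_mul_unif {a : CornerUnit he} (ha : a ∈ K) :
    dirac a.val * unif (groupSet K) = unif (groupSet K) := by
  rw [dirac_mul]
  refine map_unif_of_bijOn ⟨?_, ?_, ?_⟩ (groupSet_nonempty K)
  · rintro _ ⟨b, hb, rfl⟩
    exact ⟨a * b, K.mul_mem ha hb, rfl⟩
  · rintro _ ⟨b, hb, rfl⟩ _ ⟨c, hc, rfl⟩ h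
    have : a * b = a * c := CornerUnit.val_injective h
    rw [mul_left_cancel this]
  · rintro _ ⟨b, hb, rfl⟩
    exact ⟨(a⁻¹ * b).val, ⟨_, K.mul_mem (K.inv_mem ha) hb, rfl⟩,
      congrArg CornerUnit.val (mul_inv_cancel_left a b)⟩

theorem unif_mul_dirac {a : CornerUnit he} (ha : a ∈ K) :
    unif (groupSet K) * dirac a.val = unif (groupSet K) := by
  rw [mul_dirac]
  refine map_unif_of_bijOn ⟨?_, ?_, ?_⟩ (groupSet_nonempty K)
  · rintro _ ⟨b, hb, rfl⟩
    exact ⟨b * a, K.mul_mem hb ha, rfl⟩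
  · rintro _ ⟨b, hb, rfl⟩ _ ⟨c, hc, rfl⟩ h
    have : b * a = c * a := CornerUnit.val_injective h
    rw [mul_right_cancel this]
  · rintro _ ⟨b, hb, rfl⟩
    exact ⟨(b * a⁻¹).val, ⟨_, K.mul_mem hb (K.inv_mem ha), rfl⟩,
      congrArg CornerUnit.val (inv_mul_cancel_right b a)⟩

theorem unif_mul_of_support_subset {ρ : PMF (Function.End V)} (h : ρ.support ⊆ groupSet K) :
    unif (groupSet K) * ρ = unif (groupSet K) := by
  refine mul_eq_left fun f hf => ?_
  obtain ⟨a, ha, rfl⟩ := h hf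
  exact unif_mul_dirac K ha

theorem unif_mul_unif : unif (groupSet K) * unif (groupSet K) = unif (groupSet K) :=
  unif_mul_of_support_subset K (support_unif (groupSet_nonempty K)).subset

theorem mem_support_dirac_mul_unif {a : CornerUnit he} {f : Function.End V} :
    f ∈ (dirac a.val * unif (groupSet K)).support ↔ ∃ b ∈ K, f = (a * b).val := by
  rw [mem_support_dirac_mul, support_unif (groupSet_nonempty K)]
  constructor
  · rintro ⟨_, ⟨b, hb, rfl⟩, rfl⟩
    exact ⟨b, hb, rfl⟩
  · rintro ⟨b, hb, rfl⟩
    exact ⟨_, ⟨b, hb, rfl⟩, rfl⟩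

theorem mem_support_unif_mul_dirac {a : CornerUnit he} {f : Function.End V} :
    f ∈ (unif (groupSet K) * dirac a.val).support ↔ ∃ b ∈ K, f = (b * a).val := by
  rw [mem_support_mul_dirac, support_unif (groupSet_nonempty K)]
  constructor
  · rintro ⟨_, ⟨b, hb, rfl⟩, rfl⟩
    exact ⟨b, hb, rfl⟩
  · rintro ⟨b, hb, rfl⟩
    exact ⟨_, ⟨b, hb, rfl⟩, rfl⟩

end GroupSet

/-! ### Rees decomposition of an idempotent law -/

section Rees

variable {V : Type u} [Finite V] {η : PMF (Function.End V)} {e : Function.End V}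

omit [Finite V] in
theorem mul_mem_support_of_idempotent (hη : η * η = η) {x y : Function.End V}
    (hx : x ∈ η.support) (hy : y ∈ η.support) : x * y ∈ η.support := by
  have := mul_mem_support hx hy
  rwa [hη] at this

theorem exists_mul_eq_of_idempotent (hη : η * η = η) (he : e * e = e) (heη : e ∈ η.support)
    {z : Function.End V} (hz : z ∈ η.support) :
    ∃ t ∈ groupFactor e η.support, e * z * e * t = e := by
  have h1 : e ∈ (dirac e * η).support := mem_support_dirac_mul.2 ⟨e, heη, he⟩
  rw [← dirac_mul_mul_of_idempotent hη heη (mul_mem_support_of_idempotent hη hz heη),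
    mem_support_dirac_mul] at h1
  obtain ⟨t, ht, hte⟩ := h1
  refine ⟨e * t * e, ⟨t, ht, rfl⟩, ?_⟩
  calc e * z * e * (e * t * e) = e * (z * (e * e)) * t * e := by simp only [mul_assoc]
    _ = e := by rw [he, hte, he]

/-- The elements of `e supp η e` are invertible in the corner, with inverses in `e supp η e`. -/
theorem exists_cornerUnit (hη : η * η = η) (he : e * e = e) (heη : e ∈ η.support)
    {z : Function.End V} (hz : z ∈ η.support) :
    ∃ a : CornerUnit he, a.val = e * z * e ∧ a⁻¹.val ∈ groupFactor e η.support := by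
  obtain ⟨h', ⟨t, ht, rfl⟩, h1⟩ := exists_mul_eq_of_idempotent hη he heη hz
  obtain ⟨h'', ⟨s, hs, rfl⟩, h2⟩ := exists_mul_eq_of_idempotent hη he heη ht
  have hl : ∀ x, e * (e * x * e) = e * x * e := fun x => by rw [← mul_assoc, ← mul_assoc, he]
  have hr : ∀ x, e * x * e * e = e * x * e := fun x => by rw [mul_assoc, he]
  have h3 : e * z * e = e * s * e := by
    calc e * z * e = e * z * e * (e * t * e * (e * s * e)) := by rw [h2, hr]
      _ = e * s * e := by rw [← mul_assoc, h1, hl]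
  refine ⟨⟨e * z * e, e * t * e, hl z, hr z, hl t, hr t, h1, ?_⟩, rfl, t, ht, rfl⟩
  rw [h3, h2]

/-- The group `H = e supp η e`, as a group of units of the corner. -/
def supportGroup (hη : η * η = η) (he : e * e = e) (heη : e ∈ η.support) :
    Subgroup (CornerUnit he) where
  carrier := {a | a.val ∈ groupFactor e η.support}
  mul_mem' := by
    rintro a b ⟨z, hz, hza⟩ ⟨w, hw, hwb⟩
    refine ⟨z * e * w, mul_mem_support_of_idempotent hη
      (mul_mem_support_of_idempotent hη hz heη) hw, ?_⟩
    change _ = a.val * b.val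
    rw [← hza, ← hwb]
    calc e * (z * e * w) * e = e * z * (e * w) * e := by simp only [mul_assoc]
      _ = e * z * (e * e * w) * e := by rw [he]
      _ = _ := by simp only [mul_assoc]
  one_mem' := ⟨e, heη, by simp only [he]; rfl⟩
  inv_mem' := by
    rintro a ⟨z, hz, hza⟩
    obtain ⟨b, hb, hb'⟩ := exists_cornerUnit hη he heη hz
    have : a = b := CornerUnit.val_injective (by rw [hb, ← hza])
    rwa [this]

variable (hη : η * η = η) (he : e * e = e) (heη : e ∈ η.support)

theorem groupSet_supportGroup : groupSet (supportGroup hη he heη) = groupFactor e η.support := by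
  ext f
  constructor
  · rintro ⟨a, ha, rfl⟩
    exact ha
  · rintro ⟨z, hz, rfl⟩
    obtain ⟨a, ha, -⟩ := exists_cornerUnit hη he heη hz
    exact ⟨a, ⟨z, hz, ha.symm⟩, ha⟩

include hη he heη

omit [Finite V] he in
theorem groupFactor_subset_support : groupFactor e η.support ⊆ η.support := by
  rintro _ ⟨z, hz, rfl⟩
  exact mul_mem_support_of_idempotent hη (mul_mem_support_of_idempotent hη heη hz) heη

/-- The corner unit `eze`, for `z` in the support of `η`. -/
theorem exists_mem_supportGroup {z : Function.End V} (hz : z ∈ η.support) :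
    ∃ a ∈ supportGroup hη he heη, a.val = e * z * e ∧
      relInv e (groupFactor e η.support) (e * z * e) = a⁻¹.val := by
  obtain ⟨a, ha, ha'⟩ := exists_cornerUnit hη he heη hz
  refine ⟨a, ⟨z, hz, ha.symm⟩, ha, ?_⟩
  rw [← ha, relInv_val a ha']
  rintro _ ⟨x, -, rfl⟩
  simp only [← mul_assoc, he]

theorem leftFactor_mul_self {l : Function.End V} (hl : l ∈ leftFactor e η.support) :
    e * l = e ∧ l * e = l ∧ l ∈ η.support := by
  obtain ⟨⟨z, hz, rfl⟩, hi⟩ := hl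
  simp only at hi ⊢
  refine ⟨?_, by rw [mul_assoc, he], mul_mem_support_of_idempotent hη hz heη⟩
  obtain ⟨a, -, ha, -⟩ := exists_mem_supportGroup hη he heη hz
  have h1 : a * a = a := by
    apply CornerUnit.val_injective
    rw [CornerUnit.val_mul, ha]
    calc e * z * e * (e * z * e) = e * (z * (e * e) * z * e) := by simp only [mul_assoc]
      _ = e * (z * e * (z * e)) := by rw [he]; simp only [mul_assoc]
      _ = e * z * e := by rw [hi, mul_assoc]
  rw [← mul_assoc, ← ha, _root_.mul_eq_left.1 h1]
  rfl

/-- `z (eze)⁻¹ z = z` on the support of an idempotent law, that is `z = z^L (eze) z^R`. -/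
theorem mul_cornerUnit_inv_mul {z : Function.End V} (hz : z ∈ η.support) {a : CornerUnit he}
    (ha : a ∈ supportGroup hη he heη) (haz : a.val = e * z * e) : z * a⁻¹.val * z = z := by
  have hv : a⁻¹.val ∈ η.support :=
    groupFactor_subset_support hη heη (inv_mem ha)
  have hz' : z ∈ (dirac z * η).support := by
    rw [← hη, mem_support_mul] at hz
    obtain ⟨x, hx, y, hy, rfl⟩ := hz
    rw [dirac_mul_mul_of_idempotent hη hx hy]
    exact mem_support_dirac_mul.2 ⟨y, hy, rfl⟩
  rw [← dirac_mul_mul_of_idempotent hη hz hv, mem_support_dirac_mul] at hz'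
  obtain ⟨t, -, ht⟩ := hz'
  have hid : a⁻¹.val * z * a⁻¹.val = a⁻¹.val := by
    rw [← a⁻¹.val_mul_e]
    nth_rw 2 [← a⁻¹.e_mul_val]
    calc a⁻¹.val * e * z * (e * a⁻¹.val * e) = a⁻¹.val * (e * z * e) * a⁻¹.val * e := by
          simp only [mul_assoc]
      _ = a⁻¹.val * e := by rw [← haz, a.val_inv_mul_val, a⁻¹.e_mul_val]
  nth_rw 2 [← ht]
  calc z * a⁻¹.val * (z * a⁻¹.val * t) = z * (a⁻¹.val * z * a⁻¹.val) * t := by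
        simp only [mul_assoc]
    _ = z := by rw [hid, ht]

theorem support_leftLaw_subset : (leftLaw e η).support ⊆ leftFactor e η.support := by
  intro f hf
  rw [leftLaw, PMF.mem_support_map_iff] at hf
  obtain ⟨z, hz, rfl⟩ := hf
  obtain ⟨a, ha, haz, hr⟩ := exists_mem_supportGroup hη he heη hz
  rw [hr]
  refine ⟨⟨z * a⁻¹.val, mul_mem_support_of_idempotent hη hz
    (groupFactor_subset_support hη heη (inv_mem ha)), ?_⟩, ?_⟩
  · simp only [mul_assoc, a⁻¹.val_mul_e, a⁻¹.e_mul_val]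
  · have := mul_cornerUnit_inv_mul hη he heη hz ha haz
    rw [mul_assoc z e, a⁻¹.e_mul_val, ← mul_assoc, this]

theorem support_rightLaw_subset {r : Function.End V} (hr : r ∈ (rightLaw e η).support) :
    r ∈ η.support ∧ e * r = r ∧ r * e = e := by
  rw [rightLaw, PMF.mem_support_map_iff] at hr
  obtain ⟨z, hz, rfl⟩ := hr
  obtain ⟨a, ha, haz, hr⟩ := exists_mem_supportGroup hη he heη hz
  rw [hr]
  refine ⟨mul_mem_support_of_idempotent hη (groupFactor_subset_support hη heη (inv_mem ha))
    (mul_mem_support_of_idempotent hη heη hz), by rw [← mul_assoc, a⁻¹.e_mul_val], ?_⟩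
  rw [mul_assoc, ← haz, a.val_inv_mul_val]

/-- `eηe` is the uniform law on `H`. -/
theorem dirac_mul_idempotent_mul_dirac :
    dirac e * η * dirac e = unif (groupFactor e η.support) := by
  rw [← groupSet_supportGroup hη he heη]
  set K := supportGroup hη he heη
  have hK : groupSet K = groupFactor e η.support := groupSet_supportGroup hη he heη
  have h1 : unif (groupSet K) * (dirac e * η * dirac e) = dirac e * η * dirac e := by
    refine mul_eq_right fun f hf => ?_
    rw [support_unif (groupSet_nonempty K)] at hf
    have hfη : f ∈ η.support := groupFactor_subset_support hη heη (hK ▸ hf)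
    obtain ⟨a, -, rfl⟩ := hf
    rw [← mul_assoc, ← mul_assoc, dirac_mul_dirac, a.val_mul_e]
    nth_rw 1 [← a.e_mul_val]
    rw [dirac_mul_mul_of_idempotent hη heη hfη]
  rw [← h1]
  refine unif_mul_of_support_subset K fun f hf => ?_
  rw [hK]
  obtain ⟨g, hg, rfl⟩ := mem_support_mul_dirac.1 hf
  obtain ⟨z, hz, rfl⟩ := mem_support_dirac_mul.1 hg
  exact ⟨z, hz, rfl⟩

omit he in
theorem idempotent_mul_dirac_mul : η * dirac e * η = η := by
  have : η * (dirac e * η) = η * η := by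
    refine mul_congr_left fun f hf => ?_
    rw [← mul_assoc, dirac_mul_dirac, dirac_mul_mul_of_idempotent hη hf heη]
  rw [mul_assoc, this, hη]

theorem idempotent_mul_dirac_mul_unif :
    η * dirac e * unif (groupFactor e η.support) =
      leftLaw e η * unif (groupFactor e η.support) := by
  rw [← groupSet_supportGroup hη he heη]
  set K := supportGroup hη he heη
  have h1 : leftLaw e η = η.bind fun z =>
      dirac (z * e * relInv e (groupFactor e η.support) (e * z * e)) := by
    rw [leftLaw, ← PMF.bind_pure_comp]; rfl
  have h2 : ∀ (φ : Function.End V → Function.End V) (σ : PMF (Function.End V)),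
      (η.bind fun z => dirac (φ z)) * σ = η.bind fun z => dirac (φ z) * σ := by
    intro φ σ
    rw [mul_eq_bind_dirac, PMF.bind_bind]
    simp only [dirac, PMF.pure_bind]
  rw [mul_assoc, mul_eq_bind_dirac, h1, h2]
  refine bind_congr_support fun z hz => ?_
  obtain ⟨a, ha, haz, hr⟩ := exists_mem_supportGroup hη he heη hz
  rw [hr, ← mul_assoc, dirac_mul_dirac]
  have : z * e = z * e * a⁻¹.val * a.val := by
    rw [mul_assoc _ _ a.val, a.val_inv_mul_val, mul_assoc, he]
  nth_rw 1 [this]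
  rw [← dirac_mul_dirac, mul_assoc, dirac_mul_unif K ha]

theorem unif_mul_dirac_mul_idempotent :
    unif (groupFactor e η.support) * (dirac e * η) =
      unif (groupFactor e η.support) * rightLaw e η := by
  rw [← groupSet_supportGroup hη he heη]
  set K := supportGroup hη he heη
  have h1 : rightLaw e η = η.bind fun z =>
      dirac (relInv e (groupFactor e η.support) (e * z * e) * (e * z)) := by
    rw [rightLaw, ← PMF.bind_pure_comp]; rfl
  have h2 : ∀ (φ : Function.End V → Function.End V) (σ : PMF (Function.End V)),
      σ * (η.bind fun z => dirac (φ z)) = η.bind fun z => σ * dirac (φ z) := by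
    intro φ σ
    rw [mul_eq_bind_dirac', PMF.bind_bind]
    simp only [dirac, PMF.pure_bind]
  rw [← mul_assoc, mul_eq_bind_dirac', h1, h2]
  refine bind_congr_support fun z hz => ?_
  obtain ⟨a, ha, haz, hr⟩ := exists_mem_supportGroup hη he heη hz
  rw [hr, mul_assoc, dirac_mul_dirac]
  have : e * z = a.val * (a⁻¹.val * (e * z)) := by
    rw [← mul_assoc, a.val_mul_val_inv, ← mul_assoc, he]
  nth_rw 1 [this]
  rw [← dirac_mul_dirac, ← mul_assoc, unif_mul_dirac K ha]

end Rees

/-! ### The limit points of the convolution powers -/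

section Limits

variable {V : Type u} [Finite V] {μ η : PMF (Function.End V)} {e : Function.End V}

omit [Finite V] in
/-- The support of a limit point is contained in `S`: a law close to it has a larger support. -/
theorem support_subset_genSemigroup {ρ : PMF (Function.End V)} (hρ : ρ ∈ powerLimits μ) :
    ρ.support ⊆ genSemigroup μ := by
  intro f hf
  have hpow : ∀ n, ∀ g ∈ (μ ^ (n + 1)).support, g ∈ genSemigroup μ := by
    intro n
    induction n with
    | zero =>
      intro g hg
      rw [zero_add, pow_one] at hg
      exact Subsemigroup.subset_closure hg
    | succ n ih =>
      intro g hg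
      rw [pow_succ, mem_support_mul] at hg
      obtain ⟨a, ha, b, hb, rfl⟩ := hg
      exact mul_mem (ih a ha) (Subsemigroup.subset_closure hb)
  obtain ⟨φ, hφ, h⟩ := hρ
  have h1 := (tendsto_pmf_iff.1 h f).eventually_ne hf
  obtain ⟨n, hn, hn0⟩ := (h1.and (eventually_gt_atTop 0)).exists
  have hpos : 0 < φ n := hn0.trans_le hφ.le_apply
  obtain ⟨k, hk⟩ := Nat.exists_eq_succ_of_ne_zero hpos.ne'
  rw [hk] at hn
  exact hpow k f hn

variable (hμ : η ∈ powerLimits μ) (hη : η * η = η) (he : e * e = e) (heη : e ∈ η.support)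

omit [Finite V] in
theorem dirac_idempotent (he : e * e = e) : dirac e * dirac e = dirac e := by
  rw [dirac_mul_dirac, he]

include hμ hη heη

/-- On `𝒦`, compression by `e` is multiplicative. -/
theorem compress_mul_compress {ρ σ : PMF (Function.End V)} (he : e * e = e)
    (hρ : ρ ∈ powerLimits μ) (hσ : σ ∈ powerLimits μ) :
    dirac e * ρ * dirac e * (dirac e * σ * dirac e) = dirac e * (ρ * σ) * dirac e := by
  have h1 := powerLimits_mul_idempotent hμ hη hρ
  have h2 := idempotent_mul_powerLimits hμ hη hσ
  have h3 := idempotent_mul_dirac_mul hη heη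
  calc dirac e * ρ * dirac e * (dirac e * σ * dirac e)
      = dirac e * ρ * (dirac e * dirac e) * σ * dirac e := by simp only [mul_assoc]
    _ = dirac e * (ρ * η) * dirac e * (η * σ) * dirac e := by rw [dirac_idempotent he, h1, h2]
    _ = dirac e * (ρ * (η * dirac e * η) * σ) * dirac e := by simp only [mul_assoc]
    _ = _ := by rw [h3, h1]

/-- A limit point is recovered from its compression by `e`. -/
theorem expand_compress {ρ : PMF (Function.End V)} (he : e * e = e) (hρ : ρ ∈ powerLimits μ) :
    η * dirac e * (dirac e * ρ * dirac e) * (dirac e * η) = ρ := by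
  have h1 := powerLimits_mul_idempotent hμ hη hρ
  have h2 := idempotent_mul_powerLimits hμ hη hρ
  have h3 := idempotent_mul_dirac_mul hη heη
  calc η * dirac e * (dirac e * ρ * dirac e) * (dirac e * η)
      = η * (dirac e * dirac e) * ρ * (dirac e * dirac e) * η := by simp only [mul_assoc]
    _ = η * dirac e * (η * (ρ * η)) * dirac e * η := by rw [dirac_idempotent he, h1, h2]
    _ = η * dirac e * η * ρ * (η * dirac e * η) := by simp only [mul_assoc]
    _ = ρ := by rw [h3, h2, h1]

/-- A limit point is determined by its compression. -/
theorem eq_of_compress_eq {ρ σ : PMF (Function.End V)} (he : e * e = e)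
    (hρ : ρ ∈ powerLimits μ) (hσ : σ ∈ powerLimits μ)
    (h : dirac e * ρ * dirac e = dirac e * σ * dirac e) : ρ = σ := by
  rw [← expand_compress hμ hη heη he hρ, h, expand_compress hμ hη heη he hσ]

/-- Products of elements of the compressions of two mutually inverse limit points lie in `H`. -/
theorem compress_mul_mem {ρ σ : PMF (Function.End V)} (hρ : ρ ∈ powerLimits μ)
    (hσ : σ ∈ powerLimits μ) (hρσ : ρ * σ = η) {f g : Function.End V}
    (hf : f ∈ (dirac e * ρ * dirac e).support) (hg : g ∈ (dirac e * σ * dirac e).support) :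
    ∃ a ∈ supportGroup hη he heη, a.val = f * g := by
  have h := mul_mem_support hf hg
  rw [compress_mul_compress hμ hη heη he hρ hσ, hρσ, dirac_mul_idempotent_mul_dirac hη he heη,
    ← groupSet_supportGroup hη he heη, support_unif (groupSet_nonempty _)] at h
  exact h

omit [Finite V] hμ hη heη in
theorem compress_support {ρ : PMF (Function.End V)} {f : Function.End V} (he : e * e = e)
    (hf : f ∈ (dirac e * ρ * dirac e).support) : e * f = f ∧ f * e = f := by
  obtain ⟨g, hg, rfl⟩ := mem_support_mul_dirac.1 hf
  obtain ⟨z, hz, rfl⟩ := mem_support_dirac_mul.1 hg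
  exact ⟨by simp only [← mul_assoc, he], by rw [mul_assoc, he]⟩

/-- The supports of the compressions of the limit points consist of units of the corner. -/
theorem exists_cornerUnit_of_mem_compress {ρ : PMF (Function.End V)} (hρ : ρ ∈ powerLimits μ)
    {f : Function.End V} (hf : f ∈ (dirac e * ρ * dirac e).support) :
    ∃ a : CornerUnit he, a.val = f := by
  obtain ⟨σ, hσ, hρσ⟩ := exists_mul_eq_of_mem_powerLimits hμ hρ
  have hσρ : σ * ρ = η := by rw [(commute_powerLimits hσ hρ).eq, hρσ]
  obtain ⟨g, hg⟩ := (dirac e * σ * dirac e).support_nonempty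
  obtain ⟨b, -, hb⟩ := compress_mul_mem hμ hη he heη hρ hσ hρσ hf hg
  obtain ⟨c, -, hc⟩ := compress_mul_mem hμ hη he heη hσ hρ hσρ hg hf
  obtain ⟨hf1, hf2⟩ := compress_support he hf
  obtain ⟨hg1, hg2⟩ := compress_support he hg
  have hgb : g * b⁻¹.val = c⁻¹.val * g := by
    calc g * b⁻¹.val = e * g * b⁻¹.val := by rw [hg1]
      _ = c⁻¹.val * (g * f) * g * b⁻¹.val := by rw [← hc, c.val_inv_mul_val]
      _ = c⁻¹.val * (g * ((f * g) * b⁻¹.val)) := by simp only [mul_assoc]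
      _ = c⁻¹.val * g := by rw [← hb, b.val_mul_val_inv, hg2]
  refine ⟨⟨f, g * b⁻¹.val, hf1, hf2, by rw [← mul_assoc, hg1], by rw [mul_assoc, b⁻¹.val_mul_e],
    by rw [← mul_assoc, ← hb, b.val_mul_val_inv], ?_⟩, rfl⟩
  rw [hgb, mul_assoc, ← hc, c.val_inv_mul_val]

/-- The compression of a limit point is the uniform law on a coset `aH = Ha`. -/
theorem compress_eq {ρ : PMF (Function.End V)} (hρ : ρ ∈ powerLimits μ) {a : CornerUnit he}
    (ha : a.val ∈ (dirac e * ρ * dirac e).support) :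
    dirac e * ρ * dirac e = dirac a.val * unif (groupFactor e η.support) ∧
    dirac e * ρ * dirac e = unif (groupFactor e η.support) * dirac a.val := by
  obtain ⟨σ, hσ, hρσ⟩ := exists_mul_eq_of_mem_powerLimits hμ hρ
  have hσρ : σ * ρ = η := by rw [(commute_powerLimits hσ hρ).eq, hρσ]
  obtain ⟨g, hg⟩ := (dirac e * σ * dirac e).support_nonempty
  obtain ⟨c, rfl⟩ := exists_cornerUnit_of_mem_compress hμ hη he heη hσ hg
  have hac : ∀ b : CornerUnit he, b.val ∈ (dirac e * ρ * dirac e).support →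
      b * c ∈ supportGroup hη he heη ∧ c * b ∈ supportGroup hη he heη := by
    intro b hb
    obtain ⟨d, hd, hd'⟩ := compress_mul_mem hμ hη he heη hρ hσ hρσ hb hg
    obtain ⟨d', hd'', hd'''⟩ := compress_mul_mem hμ hη he heη hσ hρ hσρ hg hb
    rw [← CornerUnit.val_mul] at hd' hd'''
    rw [← CornerUnit.val_injective hd', ← CornerUnit.val_injective hd''']
    exact ⟨hd, hd''⟩
  have hω := dirac_mul_idempotent_mul_dirac hη he heη
  have hG := groupSet_supportGroup hη he heη
  constructor
  · have h1 := compress_mul_compress hμ hη heη he hρ hμ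
    rw [powerLimits_mul_idempotent hμ hη hρ, hω] at h1
    rw [← h1]
    refine mul_eq_right fun f hf => ?_
    obtain ⟨b, rfl⟩ := exists_cornerUnit_of_mem_compress hμ hη he heη hρ hf
    have hk : a⁻¹ * b ∈ supportGroup hη he heη := by
      have := mul_mem (inv_mem (hac a ha).2) (hac b hf).2
      simpa [mul_assoc] using this
    have hb : b.val = a.val * (a⁻¹ * b).val := by
      rw [← CornerUnit.val_mul, mul_inv_cancel_left]
    rw [hb, ← dirac_mul_dirac, mul_assoc, ← hG, dirac_mul_unif _ hk]
  · have h1 := compress_mul_compress hμ hη heη he hμ hρ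
    rw [idempotent_mul_powerLimits hμ hη hρ, hω] at h1
    rw [← h1]
    refine mul_eq_left fun f hf => ?_
    obtain ⟨b, rfl⟩ := exists_cornerUnit_of_mem_compress hμ hη he heη hρ hf
    have hk : b * a⁻¹ ∈ supportGroup hη he heη := by
      have := mul_mem (hac b hf).1 (inv_mem (hac a ha).1)
      simpa [mul_assoc] using this
    have hb : b.val = (b * a⁻¹).val * a.val := by
      rw [← CornerUnit.val_mul, inv_mul_cancel_right]
    rw [hb, ← dirac_mul_dirac, ← mul_assoc, ← hG, unif_mul_dirac _ hk]

/-- Every limit point has the form `η^L a ω_H η^R`. -/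
theorem limit_eq {ρ : PMF (Function.End V)} (hρ : ρ ∈ powerLimits μ) {a : CornerUnit he}
    (ha : a.val ∈ (dirac e * ρ * dirac e).support) :
    ρ = leftLaw e η * dirac a.val * unif (groupFactor e η.support) * rightLaw e η := by
  obtain ⟨h1, h2⟩ := compress_eq hμ hη he heη hρ ha
  have hω : unif (groupFactor e η.support) * unif (groupFactor e η.support) =
      unif (groupFactor e η.support) := by
    rw [← groupSet_supportGroup hη he heη, unif_mul_unif]
  have hL := idempotent_mul_dirac_mul_unif hη he heη
  have hR := unif_mul_dirac_mul_idempotent hη he heη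
  rw [← expand_compress hμ hη heη he hρ]
  set ω := unif (groupFactor e η.support)
  have h3 : dirac e * ρ * dirac e = ω * dirac a.val * ω := by
    rw [mul_assoc ω, ← h1, h2, ← mul_assoc, hω]
  calc η * dirac e * (dirac e * ρ * dirac e) * (dirac e * η)
      = (η * dirac e * ω) * dirac a.val * (ω * (dirac e * η)) := by
        rw [h3]; simp only [mul_assoc]
    _ = leftLaw e η * (ω * dirac a.val) * (ω * rightLaw e η) := by
        rw [hL, hR]; simp only [mul_assoc]
    _ = leftLaw e η * (dirac a.val * ω) * (ω * rightLaw e η) := by rw [← h1, h2]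
    _ = leftLaw e η * dirac a.val * (ω * ω) * rightLaw e η := by simp only [mul_assoc]
    _ = _ := by rw [hω]

/-- There are finitely many limit points, since `a` ranges over a finite set in `limit_eq`. -/
theorem finite_powerLimits (he : e * e = e) : (powerLimits μ).Finite := by
  have : (powerLimits μ) ⊆ Set.range fun a : CornerUnit he =>
      leftLaw e η * dirac a.val * unif (groupFactor e η.support) * rightLaw e η := by
    intro ρ hρ
    obtain ⟨f, hf⟩ := (dirac e * ρ * dirac e).support_nonempty
    obtain ⟨a, rfl⟩ := exists_cornerUnit_of_mem_compress hμ hη he heη hρ hf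
    exact ⟨a, (limit_eq hμ hη he heη hρ hf).symm⟩
  have := CornerUnit.finite (he := he)
  exact (Set.finite_range _).subset ‹_›

/-- If `a` is in the compression of `μη`, then `a ^ k` is in the compression of `μ ^ k η`. -/
theorem compress_pow_mul {a : CornerUnit he}
    (ha : a.val ∈ (dirac e * (μ * η) * dirac e).support) (k : ℕ) :
    (a ^ k).val ∈ (dirac e * (μ ^ k * η) * dirac e).support := by
  have hk : ∀ k, μ ^ k * η ∈ powerLimits μ := fun k => pow_mul_mem_powerLimits hμ k
  induction k with
  | zero =>
    rw [pow_zero, pow_zero, one_mul, dirac_mul_idempotent_mul_dirac hη he heη,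
      ← groupSet_supportGroup hη he heη, support_unif (groupSet_nonempty _)]
    exact ⟨1, one_mem _, rfl⟩
  | succ k ih =>
    have h1 : μ * η * (μ ^ k * η) = μ ^ (k + 1) * η := by
      rw [mul_assoc, idempotent_mul_powerLimits hμ hη (hk k), ← mul_assoc, pow_succ']
    have h2 : μ * η ∈ powerLimits μ := by simpa using hk 1
    rw [← h1, ← compress_mul_compress hμ hη heη he h2 (hk k), pow_succ', CornerUnit.val_mul]
    exact mul_mem_support ha ih

/-- The group `G`, as a group of units of the corner: the union of the supports of the compressions
`eρe` of the limit points `ρ`. It equals `e supp ν e` for the average `ν` of the limit points. -/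
def limitGroup (he : e * e = e) : Subgroup (CornerUnit he) where
  carrier := {a | ∃ ρ ∈ powerLimits μ, a.val ∈ (dirac e * ρ * dirac e).support}
  mul_mem' := by
    rintro a b ⟨ρ, hρ, ha⟩ ⟨σ, hσ, hb⟩
    refine ⟨ρ * σ, mul_mem_powerLimits hρ hσ, ?_⟩
    rw [← compress_mul_compress hμ hη heη he hρ hσ]
    exact mul_mem_support ha hb
  one_mem' := by
    refine ⟨η, hμ, ?_⟩
    rw [dirac_mul_idempotent_mul_dirac hη he heη,
      ← groupSet_supportGroup hη he heη, support_unif (groupSet_nonempty _)]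
    exact ⟨1, one_mem _, rfl⟩
  inv_mem' := by
    rintro a ⟨ρ, hρ, ha⟩
    obtain ⟨σ, hσ, hρσ⟩ := exists_mul_eq_of_mem_powerLimits hμ hρ
    obtain ⟨g, hg⟩ := (dirac e * σ * dirac e).support_nonempty
    obtain ⟨c, rfl⟩ := exists_cornerUnit_of_mem_compress hμ hη he heη hσ hg
    obtain ⟨d, hd, hd'⟩ := compress_mul_mem hμ hη he heη hρ hσ hρσ ha hg
    have h1 : a * c = d := CornerUnit.val_injective hd'.symm
    have h2 : a⁻¹ = c * d⁻¹ := by rw [← h1]; group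
    refine ⟨σ, hσ, ?_⟩
    rw [(compress_eq hμ hη he heη hσ hg).1, ← groupSet_supportGroup hη he heη,
      mem_support_dirac_mul_unif]
    exact ⟨d⁻¹, inv_mem hd, congrArg CornerUnit.val h2⟩

theorem period_pos (he : e * e = e) : 0 < period μ := by
  rw [period, subseqLimits_eq_powerLimits]
  exact ncard_powerLimits_pos hμ hη (finite_powerLimits hμ hη heη he)

theorem pow_mod_period_mul (he : e * e = e) (n : ℕ) : μ ^ (n % period μ) * η = μ ^ n * η := by
  rw [period, subseqLimits_eq_powerLimits]
  exact pow_mod_mul_idempotent hμ hη (finite_powerLimits hμ hη heη he) n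

theorem exists_lt_period_pow_mul_eq (he : e * e = e) {ρ : PMF (Function.End V)}
    (hρ : ρ ∈ powerLimits μ) : ∃ k < period μ, μ ^ k * η = ρ := by
  obtain ⟨n, rfl⟩ := exists_pow_mul_eq hμ hη (finite_powerLimits hμ hη heη he) hρ
  exact ⟨n % period μ, Nat.mod_lt _ (period_pos hμ hη heη he), pow_mod_period_mul hμ hη heη he n⟩

theorem pow_mul_injOn_period (he : e * e = e) {i j : ℕ} (hi : i < period μ) (hj : j < period μ)
    (h : μ ^ i * η = μ ^ j * η) : i = j := by
  rw [period, subseqLimits_eq_powerLimits] at hi hj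
  exact pow_mul_idempotent_injOn hμ hη (finite_powerLimits hμ hη heη he) hi hj h

/-- The cosets `γ^k H`, `k < p`, partition `G`. -/
theorem existsUnique_coset {γ : CornerUnit he}
    (hγ : γ.val ∈ (dirac e * (μ * η) * dirac e).support) {a : CornerUnit he}
    (ha : a ∈ limitGroup hμ hη heη he) :
    ∃! k, k < period μ ∧ (γ ^ k)⁻¹ * a ∈ supportGroup hη he heη := by
  have hk : ∀ k, μ ^ k * η ∈ powerLimits μ := fun k => pow_mul_mem_powerLimits hμ k
  have hcoset : ∀ k, (γ ^ k)⁻¹ * a ∈ supportGroup hη he heη ↔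
      a.val ∈ (dirac e * (μ ^ k * η) * dirac e).support := by
    intro k
    rw [(compress_eq hμ hη he heη (hk k) (compress_pow_mul hμ hη he heη hγ k)).1,
      ← groupSet_supportGroup hη he heη, mem_support_dirac_mul_unif]
    constructor
    · intro h
      exact ⟨_, h, by rw [mul_inv_cancel_left]⟩
    · rintro ⟨b, hb, h⟩
      rw [CornerUnit.val_injective h, inv_mul_cancel_left]
      exact hb
  simp only [hcoset]
  obtain ⟨ρ, hρ, haρ⟩ := ha
  obtain ⟨k, hkp, rfl⟩ := exists_lt_period_pow_mul_eq hμ hη heη he hρ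
  refine ⟨k, ⟨hkp, haρ⟩, ?_⟩
  rintro j ⟨hjp, haj⟩
  refine pow_mul_injOn_period hμ hη heη he hjp hkp ?_
  refine eq_of_compress_eq hμ hη heη he (hk j) (hk k) ?_
  rw [(compress_eq hμ hη he heη (hk j) haj).1, (compress_eq hμ hη he heη (hk k) haρ).1]

variable {ν : PMF (Function.End V)} (hν : ∀ f, ν f = (period μ : ENNReal)⁻¹ *
    ∑ k ∈ Finset.range (period μ), conv (convPow μ k) η f)

include hν

/-- The support of `ν` is the union of the supports of the limit points. -/
theorem mem_support_average (he : e * e = e) {f : Function.End V} :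
    f ∈ ν.support ↔ ∃ ρ ∈ powerLimits μ, f ∈ ρ.support := by
  rw [PMF.mem_support_iff, hν f]
  have hp : (period μ : ENNReal)⁻¹ ≠ 0 := ENNReal.inv_ne_zero.2 (ENNReal.natCast_ne_top _)
  rw [mul_ne_zero_iff, and_iff_right hp, Ne, Finset.sum_eq_zero_iff]
  push Not
  constructor
  · rintro ⟨k, -, hk⟩
    rw [convPow_eq_pow, conv_eq_mul] at hk
    exact ⟨_, pow_mul_mem_powerLimits hμ k, hk⟩
  · rintro ⟨ρ, hρ, hf⟩
    obtain ⟨k, hk, rfl⟩ := exists_lt_period_pow_mul_eq hμ hη heη he hρ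
    exact ⟨k, Finset.mem_range.2 hk, by rw [convPow_eq_pow, conv_eq_mul]; exact hf⟩

theorem groupSet_limitGroup (he : e * e = e) :
    groupSet (limitGroup hμ hη heη he) = groupFactor e ν.support := by
  ext f
  constructor
  · rintro ⟨a, ⟨ρ, hρ, ha⟩, rfl⟩
    obtain ⟨g, hg, hga⟩ := mem_support_mul_dirac.1 ha
    obtain ⟨z, hz, rfl⟩ := mem_support_dirac_mul.1 hg
    exact ⟨z, (mem_support_average hμ hη heη hν he).2 ⟨ρ, hρ, hz⟩, hga⟩
  · rintro ⟨z, hz, rfl⟩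
    obtain ⟨ρ, hρ, hz⟩ := (mem_support_average hμ hη heη hν he).1 hz
    have h : e * z * e ∈ (dirac e * ρ * dirac e).support :=
      mem_support_mul_dirac.2 ⟨_, mem_support_dirac_mul.2 ⟨z, hz, rfl⟩, rfl⟩
    obtain ⟨a, ha⟩ := exists_cornerUnit_of_mem_compress hμ hη he heη hρ h
    exact ⟨a, ⟨ρ, hρ, ha ▸ h⟩, ha⟩

/-- The kernel `supp ν` is a left ideal of `S`. -/
theorem genSemigroup_mul_mem_support (he : e * e = e) {f g : Function.End V}
    (hg : g ∈ genSemigroup μ) (hf : f ∈ ν.support) : g * f ∈ ν.support := by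
  induction hg using Subsemigroup.closure_induction generalizing f with
  | mem g hg =>
    rw [mem_support_average hμ hη heη hν he] at hf ⊢
    obtain ⟨ρ, hρ, hf⟩ := hf
    refine ⟨μ * ρ, ?_, mul_mem_support hg hf⟩
    simpa using pow_mul_mem_powerLimits hρ 1
  | mul g h _ _ ih1 ih2 =>
    rw [mul_assoc]
    exact ih1 (ih2 hf)

end Limits

/-! ### Existence of frames -/

section Existence

variable {V : Type u}

theorem act_mem_tupleSet {μ : PMF (Function.End V)} {f : Function.End V}
    {x : Fin (minRank μ) → V} (hf : f ∈ genSemigroup μ) (hx : x ∈ tupleSet μ) :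
    act f x ∈ tupleSet μ := by
  refine ⟨hx.2 f hf, fun g hg => ?_⟩
  rw [← act_mul]
  exact hx.2 _ (mul_mem hg hf)

theorem image_coset_eq {M : Type u} [Monoid M] {e : M} {he : e * e = e}
    (K : Subgroup (CornerUnit he)) {a b : CornerUnit he} (h : a⁻¹ * b ∈ K) :
    (fun h => b.val * h) '' groupSet K = (fun h => a.val * h) '' groupSet K := by
  have key : ∀ {a b : CornerUnit he}, a⁻¹ * b ∈ K →
      (fun h => b.val * h) '' groupSet K ⊆ (fun h => a.val * h) '' groupSet K := by
    rintro a b h _ ⟨_, ⟨c, hc, rfl⟩, rfl⟩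
    exact ⟨_, ⟨a⁻¹ * b * c, mul_mem h hc, rfl⟩,
      congrArg CornerUnit.val (show a * (a⁻¹ * b * c) = b * c by group)⟩
  exact (key h).antisymm (key (by simpa using inv_mem h))

variable [Finite V] {μ η ν : PMF (Function.End V)} {e : Function.End V}
  (hμ : η ∈ powerLimits μ) (hη : η * η = η) (heη : e ∈ η.support)
  (hν : ∀ f, ν f = (period μ : ENNReal)⁻¹ *
    ∑ k ∈ Finset.range (period μ), conv (convPow μ k) η f)

include hμ hη heη hν

/-- The idempotent `e` has minimal rank: `ege` is invertible for every `g ∈ S`. -/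
theorem ncard_range_eq_minRank (he : e * e = e) : (Set.range (e : V → V)).ncard = minRank μ := by
  apply le_antisymm
  · have hne : {n | ∃ g ∈ genSemigroup μ, n = (Set.range (g : V → V)).ncard}.Nonempty :=
      ⟨_, e, support_subset_genSemigroup hμ heη, rfl⟩
    obtain ⟨g, hg, hgr⟩ := Nat.sInf_mem hne
    rw [minRank, hgr]
    have hge : g * e ∈ ν.support := genSemigroup_mul_mem_support hμ hη heη hν he hg
      ((mem_support_average hμ hη heη hν he).2 ⟨η, hμ, heη⟩)
    have : e * (g * e) * e ∈ groupSet (limitGroup hμ hη heη he) := by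
      rw [groupSet_limitGroup hμ hη heη hν he]
      exact ⟨_, hge, rfl⟩
    obtain ⟨a, -, ha⟩ := this
    have h1 : e = a⁻¹.val * e * g * (e * e) := by
      calc e = a⁻¹.val * a.val := a.val_inv_mul_val.symm
        _ = _ := by rw [ha]; simp only [mul_assoc]
    have h2 : Set.range (e : V → V) ⊆
        (a⁻¹.val * e : Function.End V) '' Set.range (g : V → V) := by
      rintro _ ⟨v, rfl⟩
      exact ⟨g ((e * e : Function.End V) v), ⟨_, rfl⟩, (congrFun h1 v).symm⟩
    exact (Set.ncard_le_ncard h2 (Set.toFinite _)).trans (Set.ncard_image_le (Set.toFinite _))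
  · exact Nat.sInf_le ⟨e, support_subset_genSemigroup hμ heη, rfl⟩

/-- Tuples in `eW_μ` enumerate the image of `e`. -/
theorem range_eq_of_mem_image (he : e * e = e) {x : Fin (minRank μ) → V}
    (hx : x ∈ act e '' tupleSet μ) : Set.range x = Set.range (e : V → V) := by
  obtain ⟨y, hy, rfl⟩ := hx
  have hinj := hy.2 e (support_subset_genSemigroup hμ heη)
  refine Set.eq_of_subset_of_ncard_le ?_ ?_ (Set.toFinite _)
  · rintro _ ⟨i, rfl⟩
    exact ⟨y i, rfl⟩
  · rw [ncard_range_eq_minRank hμ hη heη hν he, ← Set.image_univ,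
      Set.ncard_image_of_injective _ hinj, Set.ncard_univ]
    simp

/-- A tuple in `eW_μ` enumerates the image of `e`, so a map factoring through `e` is determined by
its value on it; hence `G` acts freely on `eW_μ`. -/
theorem eq_of_act_eq (he : e * e = e) {f g : Function.End V} (hf : f * e = f) (hg : g * e = g)
    {x : Fin (minRank μ) → V} (hx : x ∈ act e '' tupleSet μ) (h : act f x = act g x) :
    f = g := by
  funext v
  obtain ⟨i, hi⟩ : e v ∈ Set.range x := by
    rw [range_eq_of_mem_image hμ hη heη hν he hx]
    exact ⟨v, rfl⟩
  have := congrFun h i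
  simp only [act, hi] at this
  rw [← hf, ← hg]
  exact this

omit hν in
theorem limitGroup_act_mem (he : e * e = e) {a : CornerUnit he}
    (ha : a ∈ limitGroup hμ hη heη he) {x : Fin (minRank μ) → V}
    (hx : x ∈ act e '' tupleSet μ) : act a.val x ∈ act e '' tupleSet μ := by
  obtain ⟨y, hy, rfl⟩ := hx
  obtain ⟨ρ, hρ, hρa⟩ := ha
  obtain ⟨g, hg, hga⟩ := mem_support_mul_dirac.1 hρa
  obtain ⟨z, hz, rfl⟩ := mem_support_dirac_mul.1 hg
  have heS := support_subset_genSemigroup hμ heη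
  refine ⟨act a.val (act e y), ?_, ?_⟩
  · rw [← hga]
    exact act_mem_tupleSet (mul_mem (mul_mem heS (support_subset_genSemigroup hρ hz)) heS)
      (act_mem_tupleSet heS hy)
  · rw [← act_mul, a.e_mul_val]

/-- A set of representatives of the orbits of `G` in `eW_μ`. -/
theorem exists_orbit_representatives (he : e * e = e) :
    ∃ W : Set (Fin (minRank μ) → V), W ⊆ act e '' tupleSet μ ∧
      Set.image2 act (groupFactor e ν.support) W = act e '' tupleSet μ ∧
      Set.InjOn tupleProd (leftFactor e η.support ×ˢ groupFactor e ν.support ×ˢ W) := by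
  let G := limitGroup hμ hη heη he
  let A : Set (Fin (minRank μ) → V) := act e '' tupleSet μ
  have hG : groupSet G = groupFactor e ν.support := groupSet_limitGroup hμ hη heη hν he
  have hA : ∀ x ∈ A, act e x = x := by
    rintro _ ⟨y, -, rfl⟩
    rw [← act_mul, he]
  let s : Setoid A :=
    { r := fun x y => ∃ a ∈ G, act a.val x.1 = y.1
      iseqv :=
        { refl := fun x => ⟨1, one_mem _, hA _ x.2⟩
          symm := by
            rintro x y ⟨a, ha, h⟩
            refine ⟨a⁻¹, inv_mem ha, ?_⟩
            rw [← h, ← act_mul, a.val_inv_mul_val, hA _ x.2]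
          trans := by
            rintro x y z ⟨a, ha, h⟩ ⟨b, hb, h'⟩
            refine ⟨b * a, mul_mem hb ha, ?_⟩
            rw [← h', ← h]
            rfl } }
  refine ⟨Set.range fun q : Quotient s => q.out.1, ?_, ?_, ?_⟩
  · rintro _ ⟨q, rfl⟩
    exact q.out.2
  · rw [← hG]
    ext x
    constructor
    · rintro ⟨_, ⟨a, ha, rfl⟩, _, ⟨q, rfl⟩, rfl⟩
      exact limitGroup_act_mem hμ hη heη he ha q.out.2
    · intro hx
      obtain ⟨a, ha, h⟩ := Quotient.exact (Quotient.out_eq (s := s) ⟦⟨x, hx⟩⟧)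
      exact ⟨_, ⟨a, ha, rfl⟩, _, ⟨_, rfl⟩, h⟩
  · rw [← hG]
    rintro ⟨l, _, _⟩ ⟨hl, ⟨a, ha, rfl⟩, q, rfl⟩ ⟨l', _, _⟩ ⟨hl', ⟨b, hb, rfl⟩, q', rfl⟩ h
    obtain ⟨h1, h2, -⟩ := leftFactor_mul_self hη he heη hl
    obtain ⟨h1', h2', -⟩ := leftFactor_mul_self hη he heη hl'
    simp only [tupleProd] at h h1 h2 h1' h2'
    have h3 : act a.val q.out.1 = act b.val q'.out.1 := by
      have := congrArg (act e) h
      rwa [← act_mul, ← act_mul, ← mul_assoc, ← mul_assoc, h1, h1', a.e_mul_val,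
        b.e_mul_val] at this
    have hq : q = q' := by
      rw [← Quotient.out_eq q, ← Quotient.out_eq q']
      refine Quotient.sound ⟨b⁻¹ * a, mul_mem (inv_mem hb) ha, ?_⟩
      rw [CornerUnit.val_mul, act_mul, h3, ← act_mul, b.val_inv_mul_val, hA _ q'.out.2]
    subst hq
    have hab : a.val = b.val := eq_of_act_eq hμ hη heη hν he a.val_mul_e b.val_mul_e q.out.2 h3
    have hll : l = l' := by
      refine eq_of_act_eq hμ hη heη hν he h2 h2' (limitGroup_act_mem hμ hη heη he ha q.out.2) ?_
      rw [← act_mul, ← act_mul, h, hab]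
    rw [hll, hab]

end Existence

theorem exists_average {V : Type u} [Finite V] {μ : PMF (Function.End V)}
    (η : PMF (Function.End V)) (hp : 0 < period μ) :
    ∃ ν : PMF (Function.End V), ∀ f, ν f = (period μ : ENNReal)⁻¹ *
      ∑ k ∈ Finset.range (period μ), conv (convPow μ k) η f := by
  cases nonempty_fintype (Function.End V)
  refine ⟨PMF.ofFintype (fun f => (period μ : ENNReal)⁻¹ *
    ∑ k ∈ Finset.range (period μ), conv (convPow μ k) η f) ?_, fun f => rfl⟩
  rw [← Finset.mul_sum, Finset.sum_comm]
  have : ∀ k, ∑ f, conv (convPow μ k) η f = 1 := fun k => by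
    rw [← tsum_fintype (L := .unconditional _), PMF.tsum_coe]
  simp only [this, Finset.sum_const, Finset.card_range, nsmul_eq_mul, mul_one]
  exact ENNReal.inv_mul_cancel (by exact_mod_cast hp.ne') (ENNReal.natCast_ne_top _)

/-- With `γ` any element in the support of `eμηe`, the powers `γ ^ k` satisfy the requirements on
the cosets and on the laws `μ ^ k η`. -/
theorem exists_frame {V : Type u} [Fintype V] [Nonempty V] {μ η : PMF (Function.End V)}
    {e : Function.End V} (hμ : η ∈ powerLimits μ) (hη : η * η = η) (heη : e ∈ η.support)
    (he : e * e = e) : ∃ F : Frame μ, F.η = η ∧ F.e = e := by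
  obtain ⟨ν, hν⟩ := exists_average η (period_pos hμ hη heη he)
  obtain ⟨W, hW1, hW2, hW3⟩ := exists_orbit_representatives hμ hη heη hν he
  have hk : ∀ k, μ ^ k * η ∈ powerLimits μ := fun k => pow_mul_mem_powerLimits hμ k
  have hG : groupSet (limitGroup hμ hη heη he) = groupFactor e ν.support :=
    groupSet_limitGroup hμ hη heη hν he
  have hH := groupSet_supportGroup hη he heη
  obtain ⟨g, hg⟩ := (dirac e * (μ * η) * dirac e).support_nonempty
  obtain ⟨γ, rfl⟩ := exists_cornerUnit_of_mem_compress hμ hη he heη (by simpa using hk 1) hg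
  have hγ := compress_pow_mul hμ hη he heη hg
  have hγG : ∀ k, γ ^ k ∈ limitGroup hμ hη heη he := fun k => ⟨_, hk k, hγ k⟩
  refine ⟨⟨η, ν, e, γ.val, W, ?_, hη, hν, ⟨heη, he⟩, ?_, ?_, ?_, hW1, hW2, hW3⟩, rfl, rfl⟩
  · rwa [subseqLimits_eq_powerLimits]
  · rw [← hG]
    exact ⟨γ, by simpa using hγG 1, rfl⟩
  · rw [← hG, ← hH]
    ext A
    constructor
    · rintro ⟨_, ⟨a, ha, rfl⟩, rfl⟩
      obtain ⟨k, ⟨hkp, hka⟩, -⟩ := existsUnique_coset hμ hη he heη hg ha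
      refine ⟨k, hkp, ?_⟩
      rw [image_coset_eq _ hka, γ.val_pow]
    · rintro ⟨k, -, rfl⟩
      refine ⟨_, ⟨_, hγG k, rfl⟩, ?_⟩
      rw [γ.val_pow]
  · intro k _
    rw [convPow_eq_pow, ← γ.val_pow]
    exact limit_eq hμ hη he heη (hk k) (hγ k)

/-! ### Coordinates on `LGW` -/

namespace Frame

variable {V : Type u} [Fintype V] [Nonempty V] {μ : PMF (Function.End V)} (F : Frame μ)

theorem hμ : F.η ∈ powerLimits μ := subseqLimits_eq_powerLimits μ ▸ F.η_mem

theorem hη : F.η * F.η = F.η := F.η_idem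

theorem heη : F.e ∈ F.η.support := F.e_mem.1

theorem he : F.e * F.e = F.e := F.e_mem.2

/-- `G`, as a group of units of the corner. -/
def gGroup : Subgroup (CornerUnit F.he) := limitGroup F.hμ F.hη F.heη F.he

/-- `H`, as a group of units of the corner. -/
def hGroup : Subgroup (CornerUnit F.he) := supportGroup F.hη F.he F.heη

theorem groupSet_gGroup : groupSet F.gGroup = F.G :=
  groupSet_limitGroup F.hμ F.hη F.heη F.ν_eq F.he

theorem groupSet_hGroup : groupSet F.hGroup = F.H :=
  groupSet_supportGroup F.hη F.he F.heη

theorem mem_gGroup {a : CornerUnit F.he} : a ∈ F.gGroup ↔ a.val ∈ F.G := by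
  rw [← groupSet_gGroup]
  constructor
  · exact fun h => ⟨a, h, rfl⟩
  · rintro ⟨b, hb, h⟩
    rwa [← CornerUnit.val_injective h]

theorem mem_hGroup {a : CornerUnit F.he} : a ∈ F.hGroup ↔ a.val ∈ F.H := Iff.rfl

theorem hGroup_le_gGroup : F.hGroup ≤ F.gGroup := by
  intro a ha
  refine ⟨F.η, F.hμ, ?_⟩
  rw [dirac_mul_idempotent_mul_dirac F.hη F.he F.heη, ← groupSet_supportGroup F.hη F.he F.heη,
    support_unif (groupSet_nonempty _)]
  exact ⟨a, ha, rfl⟩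

/-- `H` is normal in `G`. -/
theorem conj_mem_hGroup {a b : CornerUnit F.he} (ha : a ∈ F.gGroup) (hb : b ∈ F.hGroup) :
    a * b * a⁻¹ ∈ F.hGroup := by
  obtain ⟨ρ, hρ, haρ⟩ := ha
  obtain ⟨h1, h2⟩ := compress_eq F.hμ F.hη F.he F.heη hρ haρ
  have h3 : (a * b).val ∈ (dirac F.e * ρ * dirac F.e).support := by
    rw [h1, ← groupSet_supportGroup F.hη F.he F.heη, mem_support_dirac_mul_unif]
    exact ⟨b, hb, rfl⟩
  rw [h2, ← groupSet_supportGroup F.hη F.he F.heη, mem_support_unif_mul_dirac] at h3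
  obtain ⟨c, hc, h⟩ := h3
  rw [CornerUnit.val_injective h, mul_inv_cancel_right]
  exact hc

theorem conj_mem_hGroup' {a b : CornerUnit F.he} (ha : a ∈ F.gGroup) (hb : b ∈ F.hGroup) :
    a⁻¹ * b * a ∈ F.hGroup := by
  simpa using F.conj_mem_hGroup (inv_mem ha) hb

theorem inv_val {a : CornerUnit F.he} (ha : a ∈ F.gGroup) : F.inv a.val = a⁻¹.val := by
  refine relInv_val a (F.mem_gGroup.1 (inv_mem ha)) ?_
  rintro _ ⟨z, -, rfl⟩
  simp only [← mul_assoc, F.he]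

theorem dirac_mul_leftLaw : dirac F.e * leftLaw F.e F.η = dirac F.e := by
  refine mul_eq_left fun l hl => ?_
  rw [dirac_mul_dirac, (leftFactor_mul_self F.hη F.he F.heη
    (support_leftLaw_subset F.hη F.he F.heη hl)).1]

theorem rightLaw_mul_dirac : rightLaw F.e F.η * dirac F.e = dirac F.e := by
  refine mul_eq_right fun r hr => ?_
  rw [dirac_mul_dirac, (support_rightLaw_subset F.hη F.he F.heη hr).2.2]

/-- The element `γ` of a frame lies in the support of `eμηe`: this is read off the formula for
`μη` when the period exceeds one. -/
theorem exists_γ : ∃ γ : CornerUnit F.he, γ.val = F.γ ∧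
    γ.val ∈ (dirac F.e * (μ * F.η) * dirac F.e).support := by
  have h := F.γ_mem
  change F.γ ∈ F.G at h
  rw [← groupSet_gGroup] at h
  obtain ⟨γ, hγG, hγ⟩ := h
  refine ⟨γ, hγ, ?_⟩
  rcases (Nat.succ_le_iff.2 (period_pos F.hμ F.hη F.heη F.he)).eq_or_lt with hp | hp
  · -- for period one, `μη = η` is the only limit point
    have h1 := pow_mod_period_mul F.hμ F.hη F.heη F.he 1
    simp only [← hp, Nat.mod_self, pow_zero, pow_one, one_mul, Nat.succ_eq_add_one,
      zero_add] at h1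
    obtain ⟨ρ, hρ, hρ'⟩ := hγG
    obtain ⟨k, hk, rfl⟩ := exists_lt_period_pow_mul_eq F.hμ F.hη F.heη F.he hρ
    have hk0 : k = 0 := by omega
    rw [hk0, pow_zero, one_mul] at hρ'
    rw [← h1]
    exact hρ'
  · have h1 := F.γ_law 1 hp
    simp only [convPow_eq_pow, conv_eq_mul, pow_one] at h1
    have hγe : F.e * F.γ = γ.val := by rw [← hγ, γ.e_mul_val]
    have hH : groupFactor F.e F.η.support = groupSet F.hGroup := F.groupSet_hGroup.symm
    rw [h1, hγe, hH]
    have h2 : dirac F.e * (leftLaw F.e F.η * PMF.pure γ.val * unif (groupSet F.hGroup) *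
        rightLaw F.e F.η) * dirac F.e = dirac F.e * leftLaw F.e F.η * dirac γ.val *
        unif (groupSet F.hGroup) * (rightLaw F.e F.η * dirac F.e) := by
      simp only [mul_assoc, dirac]
    have h3 := unif_mul_dirac F.hGroup (one_mem F.hGroup)
    rw [CornerUnit.val_one] at h3
    rw [h2, F.dirac_mul_leftLaw, F.rightLaw_mul_dirac, dirac_mul_dirac, γ.e_mul_val, mul_assoc, h3,
      mem_support_dirac_mul_unif]
    exact ⟨1, one_mem _, by rw [mul_one]⟩

/-- `γ`, as a unit of the corner. -/
def gen : CornerUnit F.he := F.exists_γ.choose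

theorem gen_val : F.gen.val = F.γ := F.exists_γ.choose_spec.1

theorem gen_mem_support : F.gen.val ∈ (dirac F.e * (μ * F.η) * dirac F.e).support :=
  F.exists_γ.choose_spec.2

theorem gen_mem : F.gen ∈ F.gGroup :=
  ⟨_, by simpa using pow_mul_mem_powerLimits F.hμ 1, F.gen_mem_support⟩

theorem gen_zpow_mem (k : ℤ) : F.gen ^ k ∈ F.gGroup := zpow_mem F.gen_mem k

theorem γpow_eq (k : ℤ) : F.γpow k = (F.gen ^ k).val := by
  cases k with
  | ofNat n =>
    simp only [Int.ofNat_eq_natCast, zpow_natCast, CornerUnit.val_pow, gen_val]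
    rfl
  | negSucc n =>
    rw [zpow_negSucc, ← F.inv_val (pow_mem F.gen_mem _), CornerUnit.val_pow, gen_val]
    rfl

theorem mem_C {f : Function.End V} : f ∈ F.C ↔ ∃ i < period μ, f = (F.gen ^ i).val := by
  simp only [CornerUnit.val_pow, gen_val]
  rfl

theorem existsUnique_coset {a : CornerUnit F.he} (ha : a ∈ F.gGroup) :
    ∃! k, k < period μ ∧ (F.gen ^ k)⁻¹ * a ∈ F.hGroup :=
  ActionEvolution.existsUnique_coset F.hμ F.hη F.he F.heη F.gen_mem_support ha

/-- If `γ^p = e` then `C` is the cyclic group generated by `γ`. -/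
theorem C_eq_range (h : F.e * F.γ ^ period μ = F.e) : F.C = Set.range F.γpow := by
  have h1 : F.gen ^ period μ = 1 := by
    apply CornerUnit.val_injective
    rw [CornerUnit.val_pow, gen_val, h, CornerUnit.val_one]
  have hp : (0 : ℤ) < period μ := by exact_mod_cast period_pos F.hμ F.hη F.heη F.he
  ext f
  rw [mem_C]
  constructor
  · rintro ⟨i, -, rfl⟩
    exact ⟨i, by rw [γpow_eq, zpow_natCast]⟩
  · rintro ⟨k, rfl⟩
    obtain ⟨i, hi⟩ := Int.eq_ofNat_of_zero_le (Int.emod_nonneg k hp.ne')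
    refine ⟨i, by have := Int.emod_lt_of_pos k hp; omega, ?_⟩
    rw [γpow_eq, ← zpow_natCast, ← hi]
    congr 1
    conv_lhs => rw [← Int.mul_ediv_add_emod k (period μ), zpow_add, zpow_mul, zpow_natCast, h1,
      one_zpow, one_mul]

theorem L_spec {l : Function.End V} (hl : l ∈ F.L) : F.e * l = F.e ∧ l * F.e = l ∧
    l ∈ F.η.support := leftFactor_mul_self F.hη F.he F.heη hl

/-- The point of `LGW` with given coordinates. -/
def point (l : Function.End V) (a : CornerUnit F.he) (w : Fin (minRank μ) → V) :
    Fin (minRank μ) → V := act (l * a.val) w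

theorem mem_LGW {x : Fin (minRank μ) → V} :
    x ∈ F.LGW ↔ ∃ l ∈ F.L, ∃ a ∈ F.gGroup, ∃ w ∈ F.W, x = F.point l a w := by
  rw [LGW, ← groupSet_gGroup]
  constructor
  · rintro ⟨⟨l, _, w⟩, ⟨hl, ⟨a, ha, rfl⟩, hw⟩, rfl⟩
    exact ⟨l, hl, a, ha, w, hw, rfl⟩
  · rintro ⟨l, hl, a, ha, w, hw, rfl⟩
    exact ⟨⟨l, a.val, w⟩, ⟨hl, ⟨a, ha, rfl⟩, hw⟩, rfl⟩

section Point

variable {F}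
variable {l : Function.End V} {a : CornerUnit F.he} {w : Fin (minRank μ) → V}
  (hl : l ∈ F.L) (ha : a ∈ F.gGroup) (hw : w ∈ F.W)

include hl ha hw

theorem point_mem : F.point l a w ∈ F.LGW := F.mem_LGW.2 ⟨l, hl, a, ha, w, hw, rfl⟩

theorem coords_point : F.coords (F.point l a w) = (l, a.val, w) :=
  F.W_inj.leftInvOn_invFunOn (show (l, a.val, w) ∈ F.L ×ˢ F.G ×ˢ F.W from
    ⟨hl, F.mem_gGroup.1 ha, hw⟩)

theorem projL_point : F.projL (F.point l a w) = l := by rw [projL, coords_point hl ha hw]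

theorem projG_point : F.projG (F.point l a w) = a.val := by rw [projG, coords_point hl ha hw]

theorem projW_point : F.projW (F.point l a w) = w := by rw [projW, coords_point hl ha hw]

end Point

/-- A support element of a limit point in coordinates: `z = l b r`. -/
theorem exists_factorization {ρ : PMF (Function.End V)} (hρ : ρ ∈ powerLimits μ)
    {z : Function.End V} (hz : z ∈ ρ.support) : ∃ l ∈ F.L, ∃ b ∈ F.gGroup,
      ∃ r ∈ (rightLaw F.e F.η).support, z = l * b.val * r ∧
        b.val ∈ (dirac F.e * ρ * dirac F.e).support := by
  obtain ⟨g, hg⟩ := (dirac F.e * ρ * dirac F.e).support_nonempty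
  obtain ⟨a, rfl⟩ := exists_cornerUnit_of_mem_compress F.hμ F.hη F.he F.heη hρ hg
  have hH : groupFactor F.e F.η.support = groupSet F.hGroup := F.groupSet_hGroup.symm
  rw [limit_eq F.hμ F.hη F.he F.heη hρ hg, mem_support_mul] at hz
  obtain ⟨y, hy, r, hr, rfl⟩ := hz
  rw [mul_assoc, mem_support_mul] at hy
  obtain ⟨l, hl, d, hd, rfl⟩ := hy
  have hd' := hd
  rw [hH, mem_support_dirac_mul_unif] at hd
  obtain ⟨b, hb, rfl⟩ := hd
  refine ⟨l, support_leftLaw_subset F.hη F.he F.heη hl, a * b,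
    mul_mem ⟨ρ, hρ, hg⟩ (F.hGroup_le_gGroup hb), r, hr, rfl, ?_⟩
  rwa [(compress_eq F.hμ F.hη F.he F.heη hρ hg).1]

/-- An element of the kernel moves a point of `LGW` to a point whose `L`-coordinate does not
depend on the point. -/
theorem projL_act_of_mem_kernel {z : Function.End V} (hz : z ∈ F.ν.support)
    {x : Fin (minRank μ) → V} (hx : x ∈ F.LGW) :
    F.projL (act z x) = z * F.e * F.inv (F.e * z * F.e) := by
  obtain ⟨ρ, hρ, hz⟩ := (mem_support_average F.hμ F.hη F.heη F.ν_eq F.he).1 hz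
  obtain ⟨l, hl, b, hb, r, hr, rfl, -⟩ := F.exists_factorization hρ hz
  obtain ⟨l', hl', a, ha, w, hw, rfl⟩ := F.mem_LGW.1 hx
  obtain ⟨hr1, hr2, hr3⟩ := support_rightLaw_subset F.hη F.he F.heη hr
  obtain ⟨h1, h2, h3⟩ := F.L_spec hl'
  obtain ⟨h1', h2', h3'⟩ := F.L_spec hl
  have hrl : r * l' ∈ F.H :=
    ⟨r * l', mul_mem_support_of_idempotent F.hη hr1 h3, by
      simp only [← mul_assoc, hr2]; rw [mul_assoc, h2]⟩
  rw [← groupSet_hGroup] at hrl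
  obtain ⟨c, hc, hcr⟩ := hrl
  have h4 : act (l * b.val * r) (F.point l' a w) = F.point l (b * c * a) w := by
    simp only [point, ← act_mul, CornerUnit.val_mul, hcr, mul_assoc]
  rw [h4, projL_point hl (mul_mem (mul_mem hb (F.hGroup_le_gGroup hc)) ha) hw]
  have h5 : F.e * (l * b.val * r) * F.e = b.val := by
    rw [mul_assoc F.e, mul_assoc (l * b.val), hr3, mul_assoc l, b.val_mul_e, ← mul_assoc, h1',
      b.e_mul_val]
  rw [h5, F.inv_val hb, mul_assoc (l * b.val), hr3, mul_assoc l, b.val_mul_e, mul_assoc,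
    b.val_mul_val_inv, h2']

/-- A map in the support of `μ` moves `l ∈ L` to `l' b` with `b ∈ γH`. -/
theorem step_factorization {f l : Function.End V} (hf : f ∈ μ.support) (hl : l ∈ F.L) :
    ∃ l' ∈ F.L, ∃ b ∈ F.gGroup, F.gen⁻¹ * b ∈ F.hGroup ∧ f * l = l' * b.val ∧
      b.val = F.e * f * l := by
  obtain ⟨h1, h2, h3⟩ := F.L_spec hl
  have hρ : μ * F.η ∈ powerLimits μ := by simpa using pow_mul_mem_powerLimits F.hμ 1
  obtain ⟨l', hl', b, hb, r, hr, hz, hbρ⟩ := F.exists_factorization hρ (mul_mem_support hf h3)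
  have hr3 := (support_rightLaw_subset F.hη F.he F.heη hr).2.2
  have hfl : f * l = l' * b.val := by
    rw [← h2, ← mul_assoc, hz, mul_assoc, hr3, mul_assoc, b.val_mul_e]
  refine ⟨l', hl', b, hb, ?_, hfl, ?_⟩
  · rw [(compress_eq F.hμ F.hη F.he F.heη hρ F.gen_mem_support).1,
      ← groupSet_supportGroup F.hη F.he F.heη, mem_support_dirac_mul_unif] at hbρ
    obtain ⟨c, hc, h⟩ := hbρ
    rw [CornerUnit.val_injective h, inv_mul_cancel_left]
    exact hc
  · rw [mul_assoc, hfl, ← mul_assoc, (F.L_spec hl').1, b.e_mul_val]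

theorem act_point {f l l' : Function.End V} {a b : CornerUnit F.he} {w : Fin (minRank μ) → V}
    (h : f * l = l' * b.val) : act f (F.point l a w) = F.point l' (b * a) w := by
  rw [point, ← act_mul, ← mul_assoc, h, mul_assoc]
  rfl

theorem exists_point_of_mem_image {y : Fin (minRank μ) → V} (hy : y ∈ act F.e '' tupleSet μ) :
    ∃ a ∈ F.gGroup, ∃ w ∈ F.W, y = act a.val w := by
  rw [← F.W_cover] at hy
  change y ∈ Set.image2 act F.G F.W at hy
  rw [← groupSet_gGroup] at hy
  obtain ⟨_, ⟨a, ha, rfl⟩, w, hw, rfl⟩ := hy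
  exact ⟨a, ha, w, hw, rfl⟩

theorem act_mem_image {x : Fin (minRank μ) → V} (hx : x ∈ tupleSet μ) {r : Function.End V}
    (hr : r ∈ (rightLaw F.e F.η).support) : act r x ∈ act F.e '' tupleSet μ := by
  obtain ⟨h1, h2, -⟩ := support_rightLaw_subset F.hη F.he F.heη hr
  refine ⟨act r x, act_mem_tupleSet (support_subset_genSemigroup F.hμ h1) hx, ?_⟩
  rw [← act_mul, h2]

theorem act_mem_LGW_of_mem_tupleSet {x : Fin (minRank μ) → V} (hx : x ∈ tupleSet μ)
    {z : Function.End V} (hz : z ∈ F.η.support) : act z x ∈ F.LGW := by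
  obtain ⟨l, hl, b, hb, r, hr, rfl, -⟩ := F.exists_factorization F.hμ hz
  obtain ⟨a, ha, w, hw, h⟩ := F.exists_point_of_mem_image (F.act_mem_image hx hr)
  rw [act_mul, h, ← act_mul, mul_assoc]
  exact point_mem (a := b * a) hl (mul_mem hb ha) hw

/-! ### The right action of `G` -/

/-- The right action of `G` on `LGW`, `(l g w) · c = l (g c) w`. It commutes with the left action
of the maps in the support of `μ`. -/
def shift (c : CornerUnit F.he) (x : Fin (minRank μ) → V) : Fin (minRank μ) → V :=
  act (F.projL x * (F.projG x * c.val)) (F.projW x)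

variable {F} in
theorem shift_point {l : Function.End V} {a : CornerUnit F.he} {w : Fin (minRank μ) → V}
    (hl : l ∈ F.L) (ha : a ∈ F.gGroup) (hw : w ∈ F.W) (c : CornerUnit F.he) :
    F.shift c (F.point l a w) = F.point l (a * c) w := by
  rw [shift, projL_point hl ha hw, projG_point hl ha hw, projW_point hl ha hw]
  rfl

theorem shift_mem {c : CornerUnit F.he} (hc : c ∈ F.gGroup) {x : Fin (minRank μ) → V}
    (hx : x ∈ F.LGW) : F.shift c x ∈ F.LGW := by
  obtain ⟨l, hl, a, ha, w, hw, rfl⟩ := F.mem_LGW.1 hx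
  rw [shift_point hl ha hw]
  exact point_mem hl (mul_mem ha hc) hw

theorem shift_shift_inv {c : CornerUnit F.he} (hc : c ∈ F.gGroup) {x : Fin (minRank μ) → V}
    (hx : x ∈ F.LGW) : F.shift c (F.shift c⁻¹ x) = x := by
  obtain ⟨l, hl, a, ha, w, hw, rfl⟩ := F.mem_LGW.1 hx
  rw [shift_point hl ha hw, shift_point hl (mul_mem ha (inv_mem hc)) hw, inv_mul_cancel_right]

theorem shift_inv_shift {c : CornerUnit F.he} (hc : c ∈ F.gGroup) {x : Fin (minRank μ) → V}
    (hx : x ∈ F.LGW) : F.shift c⁻¹ (F.shift c x) = x := by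
  simpa using F.shift_shift_inv (inv_mem hc) hx

theorem act_shift {c : CornerUnit F.he} {f : Function.End V}
    (hf : f ∈ μ.support) {x : Fin (minRank μ) → V} (hx : x ∈ F.LGW) :
    act f (F.shift c x) = F.shift c (act f x) := by
  obtain ⟨l, hl, a, ha, w, hw, rfl⟩ := F.mem_LGW.1 hx
  obtain ⟨l', hl', b, hb, -, h, -⟩ := F.step_factorization hf hl
  rw [shift_point hl ha hw, F.act_point h, F.act_point h, shift_point hl' (mul_mem hb ha) hw,
    mul_assoc]

/-- Laws of the form `η^L ω_K Λ'` are invariant under the right action of `K`. -/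
theorem apply_shift_eq {K : Subgroup (CornerUnit F.he)} (hK : K ≤ F.gGroup)
    (hKn : ∀ a ∈ F.gGroup, ∀ c ∈ K, a * c * a⁻¹ ∈ K) {Q : PMF (Fin (minRank μ) → V)}
    (hQ : ∀ y ∈ Q.support, y ∈ act F.e '' tupleSet μ) {c : CornerUnit F.he} (hc : c ∈ K)
    {x : Fin (minRank μ) → V} (hx : x ∈ F.LGW) :
    actLaw (leftLaw F.e F.η * unif (groupSet K)) Q (F.shift c x) =
      actLaw (leftLaw F.e F.η * unif (groupSet K)) Q x := by
  set Λ := actLaw (leftLaw F.e F.η * unif (groupSet K)) Q with hΛ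
  have hsupp : ∀ f ∈ (leftLaw F.e F.η * unif (groupSet K)).support,
      ∃ l ∈ F.L, ∃ k ∈ K, f = l * k.val := by
    intro f hf
    obtain ⟨l, hl, _, hg, rfl⟩ := mem_support_mul.1 hf
    rw [support_unif (groupSet_nonempty K)] at hg
    obtain ⟨k, hk, rfl⟩ := hg
    exact ⟨l, support_leftLaw_subset F.hη F.he F.heη hl, k, hk, rfl⟩
  have hΛL : ∀ y ∈ Λ.support, y ∈ F.LGW := by
    intro y hy
    obtain ⟨f, hf, z, hz, rfl⟩ := mem_support_actLaw.1 hy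
    obtain ⟨l, hl, k, hk, rfl⟩ := hsupp f hf
    obtain ⟨a, ha, w, hw, rfl⟩ := F.exists_point_of_mem_image (hQ z hz)
    rw [← act_mul, mul_assoc]
    exact point_mem (a := k * a) hl (mul_mem (hK hk) ha) hw
  have hmap : Λ.map (F.shift c) = Λ := by
    rw [hΛ, actLaw_eq_bind, PMF.map_bind]
    refine bind_congr_support fun y hy => ?_
    obtain ⟨a, ha, w, hw, rfl⟩ := F.exists_point_of_mem_image (hQ y hy)
    have hd := hKn a ha c hc
    have h1 : leftLaw F.e F.η * unif (groupSet K) =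
        leftLaw F.e F.η * unif (groupSet K) * dirac (a * c * a⁻¹).val := by
      rw [mul_assoc, unif_mul_dirac K hd]
    conv_rhs => rw [h1, mul_dirac, PMF.map_comp]
    rw [PMF.map_comp]
    simp only [← PMF.bind_pure_comp]
    refine bind_congr_support fun f hf => ?_
    obtain ⟨l, hl, k, hk, rfl⟩ := hsupp f hf
    simp only [Function.comp_apply]
    congr 1
    have h2 : act (l * k.val) (act a.val w) = F.point l (k * a) w := by
      rw [← act_mul, mul_assoc]; rfl
    have h3 : act (l * k.val * (a * c * a⁻¹).val) (act a.val w) =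
        F.point l (k * (a * c * a⁻¹) * a) w := by
      simp only [point, ← act_mul, CornerUnit.val_mul, mul_assoc]
    rw [h2, h3, shift_point hl (mul_mem (hK hk) ha) hw]
    congr 1
    group
  conv_lhs => rw [← hmap, PMF.map_apply]
  rw [tsum_eq_single x]
  · rw [if_pos rfl]
  · intro y hy
    split_ifs with h
    · rw [PMF.apply_eq_zero_iff]
      intro hyΛ
      have := F.shift_inv_shift (hK hc) (hΛL y hyΛ)
      rw [← h, F.shift_inv_shift (hK hc) hx] at this
      exact hy this.symm
    · rfl

/-- A law `ηQ` with `Q` carried by `W_μ` is invariant under the right action of `H`. -/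
theorem actLaw_idempotent_shift {Q : PMF (Fin (minRank μ) → V)}
    (hQ : ∀ y ∈ Q.support, y ∈ tupleSet μ) {c : CornerUnit F.he} (hc : c ∈ F.hGroup)
    {x : Fin (minRank μ) → V} (hx : x ∈ F.LGW) :
    actLaw F.η Q (F.shift c x) = actLaw F.η Q x := by
  have h1 : (1 : CornerUnit F.he).val ∈ (dirac F.e * F.η * dirac F.e).support := by
    rw [dirac_mul_idempotent_mul_dirac F.hη F.he F.heη, ← groupSet_supportGroup F.hη F.he F.heη,
      support_unif (groupSet_nonempty _)]
    exact ⟨1, one_mem _, rfl⟩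
  have h2 := limit_eq F.hμ F.hη F.he F.heη F.hμ h1
  have hH : groupFactor F.e F.η.support = groupSet F.hGroup := F.groupSet_hGroup.symm
  rw [hH, mul_assoc (leftLaw _ _), dirac_mul_unif _ (one_mem _)] at h2
  have h3 : actLaw F.η Q = actLaw (leftLaw F.e F.η * unif (groupSet F.hGroup))
      (actLaw (rightLaw F.e F.η) Q) := by
    rw [← actLaw_mul, ← h2]
  rw [h3]
  refine F.apply_shift_eq F.hGroup_le_gGroup (fun a ha c hc => F.conj_mem_hGroup ha hc) ?_ hc hx
  intro y hy
  obtain ⟨r, hr, z, hz, rfl⟩ := mem_support_actLaw.1 hy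
  exact F.act_mem_image (hQ z hz) hr

end Frame

/-! ### Invariant laws -/

section Invariant

variable {V : Type u} {μ : PMF (Function.End V)} {m : ℕ} {Λ : PMF (Fin m → V)}

theorem IsInvariant.pow (h : IsInvariant μ Λ) (n : ℕ) : actLaw (μ ^ n) Λ = Λ := by
  induction n with
  | zero => rw [pow_zero, actLaw_one]
  | succ n ih => rw [pow_succ, actLaw_mul, ← h, ih]

theorem IsInvariant.limit [Finite V] (h : IsInvariant μ Λ) {ρ : PMF (Function.End V)}
    (hρ : ρ ∈ powerLimits μ) : actLaw ρ Λ = Λ := by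
  obtain ⟨φ, -, hφ⟩ := hρ
  have h1 : Tendsto (fun n => actLaw (μ ^ φ n) Λ) atTop (𝓝 (actLaw ρ Λ)) :=
    (continuous_actLaw.tendsto (ρ, Λ)).comp (hφ.prodMk_nhds tendsto_const_nhds)
  simp only [h.pow] at h1
  exact tendsto_nhds_unique h1 tendsto_const_nhds

theorem IsInvariant.act_mem_support (h : IsInvariant μ Λ) {f : Function.End V}
    (hf : f ∈ genSemigroup μ) {x : Fin m → V} (hx : x ∈ Λ.support) : act f x ∈ Λ.support := by
  induction hf using Subsemigroup.closure_induction generalizing x with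
  | mem f hf =>
    rw [h]
    exact mem_support_actLaw.2 ⟨f, hf, x, hx, rfl⟩
  | mul f g _ _ ih1 ih2 => exact ih1 (ih2 hx)

theorem IsInvariant.mem_tupleSet {Λ : PMF (Fin (minRank μ) → V)} (h : IsInvariant μ Λ)
    (hΛ : ∀ x ∈ Λ.support, Function.Injective x) {x : Fin (minRank μ) → V}
    (hx : x ∈ Λ.support) : x ∈ tupleSet μ :=
  ⟨hΛ x hx, fun _ hf => hΛ _ (h.act_mem_support hf hx)⟩

end Invariant

namespace Frame

variable {V : Type u} [Fintype V] [Nonempty V] {μ : PMF (Function.End V)} (F : Frame μ)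
  {Λ : PMF (Fin (minRank μ) → V)} (h : IsInvariant μ Λ)
  (hΛ : ∀ x ∈ Λ.support, Function.Injective x)

include h

theorem mem_LGW_of_mem_support (hΛ : ∀ x ∈ Λ.support, Function.Injective x)
    {x : Fin (minRank μ) → V} (hx : x ∈ Λ.support) : x ∈ F.LGW := by
  rw [← h.limit F.hμ, mem_support_actLaw] at hx
  obtain ⟨z, hz, y, hy, rfl⟩ := hx
  exact F.act_mem_LGW_of_mem_tupleSet (h.mem_tupleSet hΛ hy) hz

/-- `eΛ = a ω_H η^R Λ` for every `a ∈ G`: it does not matter which limit point is used. -/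
theorem actLaw_dirac_e {a : CornerUnit F.he} (ha : a ∈ F.gGroup) :
    actLaw (dirac F.e) Λ =
      actLaw (dirac a.val * unif (groupSet F.hGroup) * rightLaw F.e F.η) Λ := by
  obtain ⟨ρ, hρ, haρ⟩ := ha
  have h1 := limit_eq F.hμ F.hη F.he F.heη hρ haρ
  have hH : groupFactor F.e F.η.support = groupSet F.hGroup := F.groupSet_hGroup.symm
  conv_lhs => rw [← h.limit hρ, ← actLaw_mul, h1, hH]
  simp only [← mul_assoc]
  rw [F.dirac_mul_leftLaw, dirac_mul_dirac, a.e_mul_val]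

/-- For an invariant law `Λ`, the law `eΛ` is invariant under the left action of `G`. -/
theorem actLaw_gGroup {a : CornerUnit F.he} (ha : a ∈ F.gGroup) :
    actLaw (dirac a.val) (actLaw (dirac F.e) Λ) = actLaw (dirac F.e) Λ := by
  conv_rhs => rw [F.actLaw_dirac_e h ha]
  rw [F.actLaw_dirac_e h (one_mem _), ← actLaw_mul, ← mul_assoc, ← mul_assoc,
    dirac_mul_dirac, ← CornerUnit.val_mul, mul_one]

/-- An invariant law satisfies `Λ = η^L (eΛ)`. -/
theorem eq_leftLaw_actLaw : Λ = actLaw (leftLaw F.e F.η) (actLaw (dirac F.e) Λ) := by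
  have h1 : (1 : CornerUnit F.he).val ∈ (dirac F.e * F.η * dirac F.e).support := by
    rw [dirac_mul_idempotent_mul_dirac F.hη F.he F.heη, ← groupSet_supportGroup F.hη F.he F.heη,
      support_unif (groupSet_nonempty _)]
    exact ⟨1, one_mem _, rfl⟩
  have h2 := limit_eq F.hμ F.hη F.he F.heη F.hμ h1
  have hH : groupFactor F.e F.η.support = groupSet F.hGroup := F.groupSet_hGroup.symm
  rw [F.actLaw_dirac_e h (one_mem _), ← actLaw_mul]
  conv_lhs => rw [← h.limit F.hμ, h2, hH]
  simp only [mul_assoc]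

include hΛ

/-- The law of the `W`-coordinate is carried by `W`. -/
theorem support_map_projW : (Λ.map F.projW).support ⊆ F.W := by
  intro w hw
  rw [PMF.mem_support_map_iff] at hw
  obtain ⟨x, hx, rfl⟩ := hw
  obtain ⟨l, hl, a, ha, w, hw, rfl⟩ := F.mem_LGW.1 (F.mem_LGW_of_mem_support h hΛ hx)
  rwa [projW_point hl ha hw]

/-- `Λ = η^L ω_G Λ_W`. -/
theorem eq_actLaw_map_projW :
    Λ = actLaw (leftLaw F.e F.η * unif (groupSet F.gGroup)) (Λ.map F.projW) := by
  have h1 : actLaw (unif (groupSet F.gGroup)) (actLaw (dirac F.e) Λ) = actLaw (dirac F.e) Λ := by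
    rw [actLaw_eq_bind_dirac]
    refine (bind_congr_support fun f hf => ?_).trans (PMF.bind_const _ _)
    rw [support_unif (groupSet_nonempty _)] at hf
    obtain ⟨a, ha, rfl⟩ := hf
    exact F.actLaw_gGroup h ha
  have h2 : actLaw (unif (groupSet F.gGroup)) (actLaw (dirac F.e) Λ) =
      actLaw (unif (groupSet F.gGroup)) (Λ.map F.projW) := by
    rw [actLaw_dirac, actLaw_eq_bind, actLaw_eq_bind, PMF.bind_map, PMF.bind_map]
    refine bind_congr_support fun x hx => ?_
    obtain ⟨l, hl, a, ha, w, hw, rfl⟩ := F.mem_LGW.1 (F.mem_LGW_of_mem_support h hΛ hx)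
    simp only [Function.comp_apply]
    rw [projW_point hl ha hw]
    have h3 : act F.e (F.point l a w) = act a.val w := by
      rw [point, ← act_mul, ← mul_assoc, (F.L_spec hl).1, a.e_mul_val]
    conv_rhs => rw [← unif_mul_dirac _ ha, mul_dirac, PMF.map_comp]
    rw [h3]
    rfl
  conv_lhs => rw [F.eq_leftLaw_actLaw h, ← h1, h2, ← actLaw_mul]

/-- Invariance of `Λ` under the right action of the whole group `G`. -/
theorem apply_shift_eq_of_isInvariant {c : CornerUnit F.he} (hc : c ∈ F.gGroup)
    {x : Fin (minRank μ) → V} (hx : x ∈ F.LGW) : Λ (F.shift c x) = Λ x := by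
  rw [F.eq_actLaw_map_projW h hΛ]
  refine F.apply_shift_eq le_rfl (fun a ha c hc => mul_mem (mul_mem ha hc) (inv_mem ha)) ?_ hc hx
  intro y hy
  exact F.W_subset (F.support_map_projW h hΛ hy)

/-- Under an invariant law the `L`-coordinate has law `η^L`. -/
theorem map_projL : Λ.map F.projL = leftLaw F.e F.η := by
  conv_lhs => rw [F.eq_actLaw_map_projW h hΛ, actLaw_mul]
  rw [actLaw, PMF.map_bind]
  refine (bind_congr_support (g := PMF.pure) fun l hl => ?_).trans (PMF.bind_pure _)
  replace hl := support_leftLaw_subset F.hη F.he F.heη hl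
  rw [PMF.map_comp, ← PMF.bind_pure_comp]
  refine (bind_congr_support (g := fun _ => PMF.pure l) fun y hy => ?_).trans (PMF.bind_const _ _)
  obtain ⟨_, hg, w, hw, rfl⟩ := mem_support_actLaw.1 hy
  rw [support_unif (groupSet_nonempty _)] at hg
  obtain ⟨a, ha, rfl⟩ := hg
  have := projL_point hl ha (F.support_map_projW h hΛ hw)
  rw [point, act_mul] at this
  simp only [Function.comp_apply, this]

end Frame

/-! ### Coordinates along trajectories -/

namespace Frame

variable {V : Type u} [Fintype V] [Nonempty V] {μ : PMF (Function.End V)} (F : Frame μ)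

theorem exists_unitG (x : Fin (minRank μ) → V) :
    ∃ a ∈ F.gGroup, x ∈ F.LGW → a.val = F.projG x := by
  by_cases hx : x ∈ F.LGW
  · obtain ⟨l, hl, a, ha, w, hw, rfl⟩ := F.mem_LGW.1 hx
    exact ⟨a, ha, fun _ => (projG_point hl ha hw).symm⟩
  · exact ⟨1, one_mem _, fun h => absurd h hx⟩

/-- The `G`-coordinate as a unit of the corner (an arbitrary element of `G` outside `LGW`). -/
def unitG (x : Fin (minRank μ) → V) : CornerUnit F.he := (F.exists_unitG x).choose

theorem unitG_mem (x : Fin (minRank μ) → V) : F.unitG x ∈ F.gGroup :=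
  (F.exists_unitG x).choose_spec.1

theorem unitG_val {x : Fin (minRank μ) → V} (hx : x ∈ F.LGW) : (F.unitG x).val = F.projG x :=
  (F.exists_unitG x).choose_spec.2 hx

variable {F} in
theorem unitG_point {l : Function.End V} {a : CornerUnit F.he} {w : Fin (minRank μ) → V}
    (hl : l ∈ F.L) (ha : a ∈ F.gGroup) (hw : w ∈ F.W) : F.unitG (F.point l a w) = a := by
  apply CornerUnit.val_injective
  rw [F.unitG_val (point_mem hl ha hw), projG_point hl ha hw]

/-- The index `i < p` of the coset `γ^i H` which contains `γ^{-k} x^G`. -/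
def phase (k : ℤ) (x : Fin (minRank μ) → V) : ℕ :=
  (F.existsUnique_coset (mul_mem (inv_mem (F.gen_zpow_mem k)) (F.unitG_mem x))).choose

theorem phase_lt (k : ℤ) (x : Fin (minRank μ) → V) : F.phase k x < period μ :=
  (F.existsUnique_coset
    (mul_mem (inv_mem (F.gen_zpow_mem k)) (F.unitG_mem x))).choose_spec.1.1

/-- The factor `h ∈ H` in `x^G = γ^k γ^i h`, where `i` is the phase of `x`. -/
def hPart (k : ℤ) (x : Fin (minRank μ) → V) : CornerUnit F.he :=
  (F.gen ^ F.phase k x)⁻¹ * ((F.gen ^ k)⁻¹ * F.unitG x)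

theorem hPart_mem (k : ℤ) (x : Fin (minRank μ) → V) : F.hPart k x ∈ F.hGroup :=
  (F.existsUnique_coset
    (mul_mem (inv_mem (F.gen_zpow_mem k)) (F.unitG_mem x))).choose_spec.1.2

theorem phase_eq {k : ℤ} {x : Fin (minRank μ) → V} {i : ℕ} (hi : i < period μ)
    (h : (F.gen ^ i)⁻¹ * ((F.gen ^ k)⁻¹ * F.unitG x) ∈ F.hGroup) : F.phase k x = i :=
  ((F.existsUnique_coset
    (mul_mem (inv_mem (F.gen_zpow_mem k)) (F.unitG_mem x))).choose_spec.2 i ⟨hi, h⟩).symm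

theorem unitG_eq (k : ℤ) (x : Fin (minRank μ) → V) :
    F.unitG x = F.gen ^ k * F.gen ^ F.phase k x * F.hPart k x := by
  rw [hPart]; group

theorem unitG_shift {c : CornerUnit F.he} {x : Fin (minRank μ) → V}
    (hc : c ∈ F.gGroup) (hx : x ∈ F.LGW) : F.unitG (F.shift c x) = F.unitG x * c := by
  obtain ⟨l, hl, a, ha, w, hw, rfl⟩ := F.mem_LGW.1 hx
  rw [shift_point hl ha hw, unitG_point hl ha hw, unitG_point hl (mul_mem ha hc) hw]

theorem projW_shift {c : CornerUnit F.he} {x : Fin (minRank μ) → V}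
    (hc : c ∈ F.gGroup) (hx : x ∈ F.LGW) : F.projW (F.shift c x) = F.projW x := by
  obtain ⟨l, hl, a, ha, w, hw, rfl⟩ := F.mem_LGW.1 hx
  rw [shift_point hl ha hw, projW_point hl ha hw, projW_point hl (mul_mem ha hc) hw]

/-- The right action of `H` preserves the phase and acts on the `H`-factor by multiplication. -/
theorem hPart_shift {c : CornerUnit F.he} (k : ℤ) {x : Fin (minRank μ) → V}
    (hc : c ∈ F.hGroup) (hx : x ∈ F.LGW) : F.hPart k (F.shift c x) = F.hPart k x * c := by
  have h1 := F.unitG_shift (F.hGroup_le_gGroup hc) hx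
  have h2 : F.phase k (F.shift c x) = F.phase k x := by
    refine F.phase_eq (F.phase_lt k x) ?_
    rw [h1]
    have := mul_mem (F.hPart_mem k x) hc
    simpa only [hPart, mul_assoc] using this
  rw [hPart, h1, h2, hPart]
  simp only [mul_assoc]

/-- The right action of `γ^{j - i}` moves the phase `i` to the phase `j`. -/
theorem phase_zero_shift {i j : ℕ} (hj : j < period μ) {x : Fin (minRank μ) → V}
    (hx : x ∈ F.LGW) (hi : F.phase 0 x = i) :
    F.phase 0 (F.shift ((F.gen ^ i)⁻¹ * F.gen ^ j) x) = j := by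
  have hc : (F.gen ^ i)⁻¹ * F.gen ^ j ∈ F.gGroup :=
    mul_mem (inv_mem (pow_mem F.gen_mem i)) (pow_mem F.gen_mem j)
  refine F.phase_eq hj ?_
  rw [F.unitG_shift hc hx, F.unitG_eq 0 x, hi]
  have := F.conj_mem_hGroup' hc (F.hPart_mem 0 x)
  convert this using 1
  group

/-- A two-sided trajectory in `LGW` driven by maps in the support of `μ`. -/
structure IsPath (x : ℤ → Fin (minRank μ) → V) (f : ℤ → Function.End V) : Prop where
  mem_LGW : ∀ k, x k ∈ F.LGW
  mem_support : ∀ k, f k ∈ μ.support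
  step : ∀ k, x k = act (f k) (x (k - 1))

theorem eq_point {x : Fin (minRank μ) → V} (hx : x ∈ F.LGW) :
    x = F.point (F.projL x) (F.unitG x) (F.projW x) := by
  obtain ⟨l, hl, a, ha, w, hw, rfl⟩ := F.mem_LGW.1 hx
  rw [projL_point hl ha hw, unitG_point hl ha hw, projW_point hl ha hw]

theorem projW_mem {x : Fin (minRank μ) → V} (hx : x ∈ F.LGW) : F.projW x ∈ F.W := by
  obtain ⟨l, hl, a, ha, w, hw, rfl⟩ := F.mem_LGW.1 hx
  rwa [projW_point hl ha hw]

/-- One step of the dynamics: the `W`-coordinate is constant, and the `G`-coordinate is multiplied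
by an element of `γH` which only depends on the map applied and on the old `L`-coordinate. -/
theorem act_coordinates {f : Function.End V} (hf : f ∈ μ.support) {x : Fin (minRank μ) → V}
    (hx : x ∈ F.LGW) : F.projW (act f x) = F.projW x ∧
      ∃ b ∈ F.gGroup, F.gen⁻¹ * b ∈ F.hGroup ∧ F.unitG (act f x) = b * F.unitG x ∧
        b.val = F.e * f * F.projL x := by
  obtain ⟨l, hl, a, ha, w, hw, rfl⟩ := F.mem_LGW.1 hx
  obtain ⟨l', hl', b, hb, hbH, h, hbv⟩ := F.step_factorization hf hl
  rw [F.act_point h, projW_point hl' (mul_mem hb ha) hw, projW_point hl ha hw,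
    projL_point hl ha hw, unitG_point hl' (mul_mem hb ha) hw, unitG_point hl ha hw]
  exact ⟨rfl, b, hb, hbH, rfl, hbv⟩

/-- A map in the support of `μ` moves the coset of the `G`-coordinate from `γ ^ i H` to
`γ ^ (i + 1) H`. -/
theorem phase_act {f : Function.End V} (hf : f ∈ μ.support) {x : Fin (minRank μ) → V}
    (hx : x ∈ F.LGW) (k : ℤ) : F.phase k (act f x) = F.phase (k - 1) x := by
  obtain ⟨-, b, hb, hbH, h, -⟩ := F.act_coordinates hf hx
  refine F.phase_eq (F.phase_lt _ x) ?_
  have h1 := F.hPart_mem (k - 1) x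
  have h2 := mul_mem h1 (F.conj_mem_hGroup' (F.unitG_mem x) hbH)
  rw [h]
  convert h2 using 1
  rw [hPart, zpow_sub_one]
  group

section Path

variable {F}
variable {x : ℤ → Fin (minRank μ) → V} {f : ℤ → Function.End V} (h : F.IsPath x f)

include h

/-- Along a trajectory the coset of `γ^{-k} x_k^G` does not depend on `k`. -/
theorem IsPath.phase_eq (k : ℤ) : F.phase k (x k) = F.phase 0 (x 0) := by
  have hs : ∀ k, F.phase k (x k) = F.phase (k - 1) (x (k - 1)) := fun k => by
    rw [h.step k, F.phase_act (h.mem_support k) (h.mem_LGW _)]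
  induction k using Int.induction_on with
  | zero => rfl
  | succ n ih => rw [hs, add_sub_cancel_right, ih]
  | pred n ih => rw [← hs, ih]

theorem IsPath.projW_eq (k : ℤ) : F.projW (x k) = F.projW (x 0) := by
  have hs : ∀ k, F.projW (x k) = F.projW (x (k - 1)) := fun k => by
    rw [h.step k, (F.act_coordinates (h.mem_support k) (h.mem_LGW _)).1]
  induction k using Int.induction_on with
  | zero => rfl
  | succ n ih => rw [hs, add_sub_cancel_right, ih]
  | pred n ih => rw [← hs, ih]

theorem IsPath.mul_inv_eq (k j : ℤ) : F.projG (x k) * F.inv (F.projG (x j)) =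
    (F.unitG (x k) * (F.unitG (x j))⁻¹).val := by
  rw [← F.unitG_val (h.mem_LGW k), ← F.unitG_val (h.mem_LGW j), F.inv_val (F.unitG_mem _)]
  rfl

theorem IsPath.inv_mul_inv_eq (k j : ℤ) : F.inv (F.projG (x k) * F.inv (F.projG (x j))) =
    (F.unitG (x j) * (F.unitG (x k))⁻¹).val := by
  rw [h.mul_inv_eq, F.inv_val (mul_mem (F.unitG_mem _) (inv_mem (F.unitG_mem _))),
    mul_inv_rev, inv_inv]

/-- The increment of the `G`-coordinate is a function of the driving map and of the previous
`L`-coordinate. -/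
theorem IsPath.increment_eq (k : ℤ) : F.projG (x k) * F.inv (F.projG (x (k - 1))) =
    F.e * f k * F.projL (x (k - 1)) := by
  obtain ⟨-, b, -, -, h1, h2⟩ := F.act_coordinates (h.mem_support k) (h.mem_LGW (k - 1))
  rw [h.mul_inv_eq, ← h2, h.step k, h1, mul_inv_cancel_right]

theorem IsPath.projG_eq (k : ℤ) : F.projG (x k) =
    F.γpow k * (F.gen ^ F.phase 0 (x 0)).val * (F.hPart k (x k)).val := by
  rw [← F.unitG_val (h.mem_LGW k), F.unitG_eq k (x k), h.phase_eq k, F.γpow_eq]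
  rfl

theorem IsPath.eq_act (k j : ℤ) : x j = act (F.projL (x j) *
    F.inv (F.projG (x k) * F.inv (F.projG (x j))) *
      (F.γpow k * (F.gen ^ F.phase 0 (x 0)).val) * (F.hPart k (x k)).val) (F.projW (x 0)) := by
  have h1 : (F.unitG (x j)).val = F.inv (F.projG (x k) * F.inv (F.projG (x j))) *
      (F.γpow k * (F.gen ^ F.phase 0 (x 0)).val * (F.hPart k (x k)).val) := by
    rw [← h.projG_eq, h.inv_mul_inv_eq, ← F.unitG_val (h.mem_LGW k), ← CornerUnit.val_mul,
      inv_mul_cancel_right]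
  conv_lhs => rw [F.eq_point (h.mem_LGW j), point, h1, h.projW_eq]
  simp only [mul_assoc]

theorem IsPath.telescope (j : ℤ) (n : ℕ) : F.projG (x (j + n)) * F.inv (F.projG (x j)) =
    F.e * ((List.range n).map fun i : ℕ =>
      F.projG (x (j + n - i)) * F.inv (F.projG (x (j + n - i - 1)))).prod := by
  simp only [h.mul_inv_eq]
  induction n with
  | zero => simp [CornerUnit.val_one]
  | succ n ih =>
    have h1 : ∀ i : ℕ, j + ((n + 1 : ℕ) : ℤ) - ((i + 1 : ℕ) : ℤ) = j + n - i := fun i => by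
      push_cast; ring
    have h2 : j + ((n + 1 : ℕ) : ℤ) - ((0 : ℕ) : ℤ) - 1 = j + n := by push_cast; ring
    rw [List.range_succ_eq_map, List.map_cons, List.map_map, List.prod_cons]
    simp only [Function.comp_def, Nat.succ_eq_add_one, h1, h2]
    have h3 : ∀ (A : CornerUnit F.he) z, A.val * z = A.val * (F.e * z) := fun A z => by
      rw [← mul_assoc, A.val_mul_e]
    rw [h3, ← ih, ← CornerUnit.val_mul, CornerUnit.e_mul_val]
    congr 1
    simp only [Nat.cast_zero, sub_zero]
    group

/-- The state at time `j` is the image of the state at time `j - n` under the product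
`g j n = f_j f_{j-1} ⋯ f_{j-n+1}` of the driving maps. -/
theorem IsPath.eq_act_prod (j : ℤ) (g : ℤ → ℕ → Function.End V) (hg0 : ∀ j, g j 0 = 1)
    (hg : ∀ j n, g j (n + 1) = f j * g (j - 1) n) (n : ℕ) : x j = act (g j n) (x (j - n)) := by
  induction n generalizing j with
  | zero => rw [hg0]; simp; rfl
  | succ n ih =>
    rw [hg, act_mul, h.step j, ih (j - 1)]
    congr 3
    push_cast
    ring

end Path

/-- Sums over two sets exchanged by the right action of `c` and `c⁻¹` agree for a weight which is
invariant under `c`. -/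
theorem sum_shift_eq {q : (Fin (minRank μ) → V) → ENNReal} {c : CornerUnit F.he}
    (hc : c ∈ F.gGroup) (hq : ∀ x ∈ F.LGW, q (F.shift c x) = q x)
    (s t : Set (Fin (minRank μ) → V)) [DecidablePred (· ∈ s)] [DecidablePred (· ∈ t)]
    (hs : s ⊆ F.LGW) (ht : t ⊆ F.LGW)
    (hst : ∀ x ∈ s, F.shift c x ∈ t) (hts : ∀ x ∈ t, F.shift c⁻¹ x ∈ s) :
    ∑ x with x ∈ s, q x = ∑ x with x ∈ t, q x := by
  refine Finset.sum_nbij' (F.shift c) (F.shift c⁻¹) ?_ ?_ ?_ ?_ ?_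
  · simpa using hst
  · simpa using hts
  · intro x hx
    exact F.shift_inv_shift hc (hs (by simpa using hx))
  · intro x hx
    exact F.shift_shift_inv hc (ht (by simpa using hx))
  · intro x hx
    exact (hq x (hs (by simpa using hx))).symm

end Frame

/-! ### Random variables with finitely many values -/

section FiniteValued

instance (V : Type u) : DiscreteMeasurableSpace (Function.End V) := ⟨fun _ => trivial⟩

variable {Ω : Type v} [MeasurableSpace Ω] {P : Measure Ω} {β : Type u} [Finite β]
  [MeasurableSpace β] [DiscreteMeasurableSpace β]

open scoped Classical in
theorem measure_inter_preimage [Fintype β] {Y : Ω → β} (hY : Measurable Y) {D : Set Ω}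
    (hD : MeasurableSet D) (s : Set β) :
    P (D ∩ Y ⁻¹' s) = ∑ y with y ∈ s, P (D ∩ Y ⁻¹' {y}) := by
  rw [← measure_biUnion_finset]
  · congr 1
    ext ω
    simp
  · intro a _ b _ hab
    rw [Function.onFun, Set.disjoint_left]
    rintro ω ⟨-, ha⟩ ⟨-, hb⟩
    exact hab (ha.symm.trans hb)
  · exact fun y _ => hD.inter (hY (measurableSet_singleton y))

theorem measure_inter_preimage_eq_mul {Y : Ω → β} (hY : Measurable Y) {D : Set Ω}
    (hD : MeasurableSet D) {ρ : PMF β} (h : ∀ y, P (D ∩ Y ⁻¹' {y}) = P D * ρ y) (s : Set β) :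
    P (D ∩ Y ⁻¹' s) = P D * ρ.toMeasure s := by
  classical
  cases nonempty_fintype β
  rw [measure_inter_preimage hY hD, PMF.toMeasure_apply_fintype, Finset.mul_sum]
  simp only [h, Finset.sum_filter, Set.indicator_apply, mul_ite, mul_zero]

theorem hasLaw_of_measure_preimage [IsProbabilityMeasure P] {Y : Ω → β} (hY : Measurable Y)
    {ρ : PMF β} (h : ∀ y, P (Y ⁻¹' {y}) = ρ y) : HasLaw Y ρ.toMeasure P := by
  refine ⟨hY.aemeasurable, Measure.ext fun s _ => ?_⟩
  rw [Measure.map_apply hY (Set.toFinite s).measurableSet]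
  have := measure_inter_preimage_eq_mul (P := P) hY MeasurableSet.univ (ρ := ρ)
    (by simpa using h) s
  simpa using this

theorem measure_preimage_of_hasLaw {Y : Ω → β} (hY : Measurable Y) {ρ : PMF β}
    (h : HasLaw Y ρ.toMeasure P) (s : Set β) : P (Y ⁻¹' s) = ρ.toMeasure s := by
  rw [← h.map_eq, Measure.map_apply hY (Set.toFinite s).measurableSet]

theorem measure_preimage_singleton_of_hasLaw {Y : Ω → β} (hY : Measurable Y) {ρ : PMF β}
    (h : HasLaw Y ρ.toMeasure P) (y : β) : P (Y ⁻¹' {y}) = ρ y := by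
  rw [measure_preimage_of_hasLaw hY h, PMF.toMeasure_apply_singleton _ _ (measurableSet_singleton y)]

theorem ae_mem_support_of_hasLaw {Y : Ω → β} (hY : Measurable Y) {ρ : PMF β}
    (h : HasLaw Y ρ.toMeasure P) : ∀ᵐ ω ∂P, Y ω ∈ ρ.support := by
  have h1 := measure_preimage_of_hasLaw hY h ρ.supportᶜ
  rw [(PMF.toMeasure_apply_eq_zero_iff _ (Set.toFinite _).measurableSet).2
    disjoint_compl_right] at h1
  exact h1

/-- Equal probabilities on `A` give a multiple of the uniform law. -/
theorem measure_inter_preimage_eq_mul_unif [Nonempty β] {Y : Ω → β} (hY : Measurable Y)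
    {D : Set Ω} (hD : MeasurableSet D) {A : Set β} (hA : A.Nonempty) (hYA : ∀ ω, Y ω ∈ A)
    (h : ∀ a ∈ A, ∀ b ∈ A, P (D ∩ Y ⁻¹' {a}) = P (D ∩ Y ⁻¹' {b})) (y : β) :
    P (D ∩ Y ⁻¹' {y}) = P D * unif A y := by
  classical
  cases nonempty_fintype β
  rw [unif_apply hA]
  split_ifs with hy
  · have h1 := measure_inter_preimage (P := P) hY hD A
    have h2 : D ∩ Y ⁻¹' A = D := Set.inter_eq_left.2 fun ω _ => hYA ω
    rw [h2, Finset.sum_congr rfl fun z hz => h z (by simpa using hz) y hy, Finset.sum_const,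
      nsmul_eq_mul] at h1
    have h3 : A.ncard = (Finset.univ.filter fun z => z ∈ A).card := by
      rw [← Set.ncard_coe_finset]
      congr 1
      ext
      simp
    rw [h1, ← h3, mul_comm, ← mul_assoc, ENNReal.inv_mul_cancel, one_mul]
    · exact_mod_cast (Set.ncard_pos (Set.toFinite A)).2 hA |>.ne'
    · exact ENNReal.natCast_ne_top _
  · rw [mul_zero]
    convert measure_empty (μ := P)
    rw [Set.eq_empty_iff_forall_notMem]
    rintro ω ⟨-, rfl⟩
    exact hy (hYA ω)

omit [MeasurableSpace Ω] in
theorem measurable_comp₂ {α β γ : Type*} [Finite α] [Finite β] [MeasurableSpace α]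
    [MeasurableSpace β] [MeasurableSpace γ] [DiscreteMeasurableSpace α]
    [DiscreteMeasurableSpace β] (φ : α → β → γ) {m : MeasurableSpace Ω} {f : Ω → α} {g : Ω → β}
    (hf : Measurable[m] f) (hg : Measurable[m] g) : Measurable[m] fun ω => φ (f ω) (g ω) :=
  (Measurable.of_discrete (f := Function.uncurry φ)).comp (hf.prodMk hg)

omit [MeasurableSpace Ω] in
theorem measurable_comp₁ {α γ : Type*} [MeasurableSpace α] [DiscreteMeasurableSpace α]
    [MeasurableSpace γ] (φ : α → γ) {m : MeasurableSpace Ω} {f : Ω → α}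
    (hf : Measurable[m] f) : Measurable[m] fun ω => φ (f ω) :=
  (Measurable.of_discrete (f := φ)).comp hf

end FiniteValued

/-! ### σ-fields up to null events -/

section NullEvents

variable {Ω : Type v} {m m₀ : MeasurableSpace Ω} [mΩ : MeasurableSpace Ω] {P : Measure Ω}

theorem nullField_le : nullField P ≤ mΩ :=
  MeasurableSpace.generateFrom_le fun _ hs => hs.1

/-- A σ-field containing the null events is closed under a.s. equality of events. -/
theorem measurableSet_of_ae_eq (hm : nullField P ≤ m) (hm' : m ≤ mΩ)
    {A B : Set Ω} (hA : MeasurableSet A) (hB : MeasurableSet[m] B)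
    (h : ∀ᵐ ω ∂P, ω ∈ A ↔ ω ∈ B) : MeasurableSet[m] A := by
  have hB' : MeasurableSet B := hm' B hB
  have h0 : P (B \ A) = 0 ∧ P (A \ B) = 0 := by
    constructor
    · refine measure_mono_null ?_ (ae_iff.1 h)
      rintro ω ⟨h1, h2⟩ h3
      exact h2 (h3.2 h1)
    · refine measure_mono_null ?_ (ae_iff.1 h)
      rintro ω ⟨h1, h2⟩ h3
      exact h2 (h3.1 h1)
  have h1 : MeasurableSet[m] (B \ A) :=
    hm _ (MeasurableSpace.measurableSet_generateFrom ⟨hB'.diff hA, h0.1⟩)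
  have h2 : MeasurableSet[m] (A \ B) :=
    hm _ (MeasurableSpace.measurableSet_generateFrom ⟨hA.diff hB', h0.2⟩)
  have h3 : A = (B \ (B \ A)) ∪ (A \ B) := by
    ext ω
    simp only [Set.mem_union, Set.mem_sdiff]
    tauto
  rw [h3]
  exact (hB.diff h1).union h2

theorem measurable_of_ae_eq {β : Type u} [MeasurableSpace β]
    (hm : nullField P ≤ m) (hm' : m ≤ mΩ) {f g : Ω → β} (hf : Measurable f)
    (hg : Measurable[m] g) (h : ∀ᵐ ω ∂P, f ω = g ω) : Measurable[m] f := by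
  intro s hs
  refine measurableSet_of_ae_eq hm hm' (hf hs) (hg hs) ?_
  filter_upwards [h] with ω hω
  simp only [Set.mem_preimage, hω]

/-- Every event of `m` completed by the null events coincides a.s. with an event of `m`. -/
theorem exists_ae_iff_of_measurableSet_sup {A : Set Ω}
    (hA : MeasurableSet[m ⊔ nullField P] A) :
    ∃ B, MeasurableSet[m] B ∧ ∀ᵐ ω ∂P, ω ∈ A ↔ ω ∈ B := by
  let m' : MeasurableSpace Ω :=
    { MeasurableSet' := fun A => ∃ B, MeasurableSet[m] B ∧ ∀ᵐ ω ∂P, ω ∈ A ↔ ω ∈ B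
      measurableSet_empty := ⟨∅, @MeasurableSet.empty Ω m, by simp⟩
      measurableSet_compl := by
        rintro A ⟨B, hB, h⟩
        refine ⟨Bᶜ, hB.compl, ?_⟩
        filter_upwards [h] with ω hω
        simp only [Set.mem_compl_iff, hω]
      measurableSet_iUnion := by
        intro A hA
        choose B hB h using hA
        refine ⟨⋃ i, B i, MeasurableSet.iUnion hB, ?_⟩
        filter_upwards [ae_all_iff.2 h] with ω hω
        simp only [Set.mem_iUnion, hω] }
  have h1 : m ≤ m' := fun A hA => ⟨A, hA, by simp⟩
  have h2 : nullField P ≤ m' := by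
    refine MeasurableSpace.generateFrom_le ?_
    rintro A ⟨-, hA⟩
    refine ⟨∅, @MeasurableSet.empty Ω m, ?_⟩
    filter_upwards [measure_eq_zero_iff_ae_notMem.1 hA] with ω hω
    simp [hω]
  exact sup_le h1 h2 A hA

omit mΩ in
/-- Given the value of a variable `T`, every event of `m ∨ σ(T)` coincides with an event of `m`. -/
theorem exists_forall_ae_iff_of_measurableSet_sup_comap {β : Type u} [MeasurableSpace β]
    {T : Ω → β} {A : Set Ω}
    (hA : MeasurableSet[m ⊔ MeasurableSpace.comap T inferInstance] A) (c : β) :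
    ∃ B, MeasurableSet[m] B ∧ ∀ ω, T ω = c → (ω ∈ A ↔ ω ∈ B) := by
  let m' : MeasurableSpace Ω :=
    { MeasurableSet' := fun A => ∃ B, MeasurableSet[m] B ∧ ∀ ω, T ω = c → (ω ∈ A ↔ ω ∈ B)
      measurableSet_empty := ⟨∅, @MeasurableSet.empty Ω m, by simp⟩
      measurableSet_compl := by
        rintro A ⟨B, hB, h⟩
        refine ⟨Bᶜ, hB.compl, fun ω hω => ?_⟩
        simp only [Set.mem_compl_iff, h ω hω]
      measurableSet_iUnion := by
        intro A hA
        choose B hB h using hA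
        refine ⟨⋃ i, B i, MeasurableSet.iUnion hB, fun ω hω => ?_⟩
        simp only [Set.mem_iUnion, fun i => h i ω hω] }
  have h1 : m ≤ m' := fun A hA => ⟨A, hA, by simp⟩
  have h2 : MeasurableSpace.comap T inferInstance ≤ m' := by
    rintro _ ⟨s, -, rfl⟩
    by_cases hc : c ∈ s
    · exact ⟨Set.univ, @MeasurableSet.univ Ω m, fun ω hω => by simp [hω, hc]⟩
    · exact ⟨∅, @MeasurableSet.empty Ω m, fun ω hω => by simp [hω, hc]⟩
  exact sup_le h1 h2 A hA

/-- If `m` is independent of `m₀`, then an event of `m₀` which belongs a.s. to `m ∨ σ(T)`, with `T`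
an a.s. `m₀`-measurable variable with finitely many values, belongs a.s. to `σ(T)`. -/
theorem measurableSet_comap_of_indep [IsProbabilityMeasure P] {β : Type u} [Finite β]
    [MeasurableSpace β] [DiscreteMeasurableSpace β]
    (hm₀ : m₀ ≤ mΩ) (hind : Indep m m₀ P) {T : Ω → β} (hT : Measurable T)
    (hT₀ : Measurable[m₀ ⊔ nullField P] T) {A : Set Ω} (hA₀ : MeasurableSet[m₀] A)
    (hA : MeasurableSet[m ⊔ MeasurableSpace.comap T inferInstance ⊔ nullField P] A) :
    MeasurableSet[MeasurableSpace.comap T inferInstance ⊔ nullField P] A := by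
  obtain ⟨A', hA', hAA'⟩ := exists_ae_iff_of_measurableSet_sup hA
  have hmul : ∀ {B C : Set Ω}, MeasurableSet[m] B → MeasurableSet[m₀ ⊔ nullField P] C →
      P (B ∩ C) = P B * P C := by
    intro B C hB hC
    obtain ⟨C', hC', hCC'⟩ := exists_ae_iff_of_measurableSet_sup hC
    have h1 : P C = P C' := measure_congr (eventuallyEq_set.2 hCC')
    have h2 : P (B ∩ C) = P (B ∩ C') := measure_congr (by
      refine eventuallyEq_set.2 ?_
      filter_upwards [hCC'] with ω hω
      simp only [Set.mem_inter_iff, hω])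
    rw [h1, h2]
    exact (Indep_iff _ _ _).1 hind B C' hB hC'
  have hAm : MeasurableSet A := hm₀ A hA₀
  -- on each atom `{T = c}` the event `A` has conditional probability zero or one
  have hatom : ∀ c, P (A ∩ T ⁻¹' {c}) = 0 ∨ P (T ⁻¹' {c} \ A) = 0 := by
    intro c
    have hTc : MeasurableSet (T ⁻¹' {c}) := hT (measurableSet_singleton c)
    obtain ⟨B, hB, hBA⟩ := exists_forall_ae_iff_of_measurableSet_sup_comap hA' c
    have hTc₀ : MeasurableSet[m₀ ⊔ nullField P] (T ⁻¹' {c}) := hT₀ (measurableSet_singleton c)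
    have hA₀' : MeasurableSet[m₀ ⊔ nullField P] A := (le_sup_left : m₀ ≤ m₀ ⊔ nullField P) A hA₀
    have h1 : P (A ∩ T ⁻¹' {c}) = P B * P (A ∩ T ⁻¹' {c}) := by
      rw [← hmul hB (hA₀'.inter hTc₀)]
      refine measure_congr (eventuallyEq_set.2 ?_)
      filter_upwards [hAA'] with ω hω
      simp only [Set.mem_inter_iff, Set.mem_preimage, Set.mem_singleton_iff]
      constructor
      · rintro ⟨h2, h3⟩
        exact ⟨(hBA ω h3).1 (hω.1 h2), h2, h3⟩
      · exact fun h => h.2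
    have h2 : P (A ∩ T ⁻¹' {c}) = P B * P (T ⁻¹' {c}) := by
      rw [← hmul hB hTc₀]
      refine measure_congr (eventuallyEq_set.2 ?_)
      filter_upwards [hAA'] with ω hω
      simp only [Set.mem_inter_iff, Set.mem_preimage, Set.mem_singleton_iff]
      constructor
      · rintro ⟨h2, h3⟩
        exact ⟨(hBA ω h3).1 (hω.1 h2), h3⟩
      · rintro ⟨h2, h3⟩
        exact ⟨hω.2 ((hBA ω h3).2 h2), h3⟩
    rcases eq_or_ne (P (A ∩ T ⁻¹' {c})) 0 with h0 | h0
    · exact Or.inl h0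
    · right
      have hB1 : P B = 1 := by
        have h3 : P B * P (A ∩ T ⁻¹' {c}) = 1 * P (A ∩ T ⁻¹' {c}) := by rw [← h1, one_mul]
        exact (ENNReal.mul_left_inj h0 (measure_ne_top _ _)).1 h3
      rw [hB1, one_mul] at h2
      have h4 : T ⁻¹' {c} \ A = T ⁻¹' {c} \ (A ∩ T ⁻¹' {c}) := by
        ext ω
        simp only [Set.mem_sdiff, Set.mem_inter_iff]
        tauto
      rw [h4, measure_sdiff Set.inter_subset_right (hAm.inter hTc).nullMeasurableSet
        (measure_ne_top _ _), h2, tsub_self]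
  have hle : MeasurableSpace.comap T inferInstance ⊔ nullField P ≤ mΩ :=
    sup_le hT.comap_le nullField_le
  refine measurableSet_of_ae_eq le_sup_right hle hAm
    (B := T ⁻¹' {c | P (A ∩ T ⁻¹' {c}) ≠ 0}) ?_ ?_
  · exact (le_sup_left : _ ≤ MeasurableSpace.comap T inferInstance ⊔ nullField P) _
      ⟨_, (Set.toFinite _).measurableSet, rfl⟩
  · have h1 : ∀ᵐ ω ∂P, ∀ c, ω ∈ T ⁻¹' {c} → (ω ∈ A ↔ P (A ∩ T ⁻¹' {c}) ≠ 0) := by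
      rw [ae_all_iff]
      intro c
      by_cases h0 : P (A ∩ T ⁻¹' {c}) = 0
      · filter_upwards [measure_eq_zero_iff_ae_notMem.1 h0] with ω hω hωc
        simp only [h0, ne_eq, not_true_eq_false, iff_false]
        exact fun h => hω ⟨h, hωc⟩
      · filter_upwards [measure_eq_zero_iff_ae_notMem.1 ((hatom c).resolve_left h0)] with ω hω hωc
        simp only [h0, ne_eq, not_false_eq_true, iff_true]
        by_contra h
        exact hω ⟨hωc, h⟩
    filter_upwards [h1] with ω hω
    exact hω (T ω) rfl

end NullEvents

/-! ### Past σ-fields -/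

section Past

variable {Ω : Type v} {β : Type u} {γ : Type w} [MeasurableSpace β] [MeasurableSpace γ]

theorem measurable_past {Z : ℤ → Ω → β} {j k : ℤ} (h : j ≤ k) : Measurable[past Z k] (Z j) :=
  Measurable.of_comap_le (le_iSup₂ (f := fun (j : ℤ) (_ : j ≤ k) =>
    MeasurableSpace.comap (Z j) inferInstance) j h)

theorem past_le_of_measurable {m : MeasurableSpace Ω} {Z : ℤ → Ω → β} {k : ℤ}
    (h : ∀ j ≤ k, Measurable[m] (Z j)) : past Z k ≤ m :=
  iSup₂_le fun j hj => (h j hj).comap_le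

theorem past_mono {Z : ℤ → Ω → β} {j k : ℤ} (h : j ≤ k) : past Z j ≤ past Z k :=
  past_le_of_measurable fun _ hi => measurable_past (hi.trans h)

theorem remotePast_le_past (Z : ℤ → Ω → β) (k : ℤ) : remotePast Z ≤ past Z k := iInf_le _ k

/-- A variable which is a.s. a function of the state at each time is a.s. measurable with respect
to the remote past. -/
theorem measurable_remotePast_of_ae_eq [mΩ : MeasurableSpace Ω] {P : Measure Ω}
    {Z : ℤ → Ω → β} (hZ : ∀ k, Measurable (Z k)) {Y : Ω → γ} (hY : Measurable Y)
    {φ : ℤ → β → γ} (hφ : ∀ k, Measurable (φ k)) (h : ∀ k, ∀ᵐ ω ∂P, Y ω = φ k (Z k ω)) :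
    Measurable[remotePast Z ⊔ nullField P] Y := by
  have hle : remotePast Z ≤ mΩ :=
    (remotePast_le_past Z 0).trans (past_le_of_measurable fun j _ => hZ j)
  intro s hs
  let A : ℕ → Set Ω := fun m => (fun ω => φ (-m) (Z (-m) ω)) ⁻¹' s
  let E : ℕ → Set Ω := fun n => ⋂ m, A (n + m)
  have hE : Monotone E := by
    intro i j hij ω hω
    simp only [E, Set.mem_iInter] at hω ⊢
    intro m
    have := hω (j - i + m)
    rwa [show i + (j - i + m) = j + m by omega] at this
  refine measurableSet_of_ae_eq le_sup_right (sup_le hle nullField_le) (hY hs)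
    (B := ⋃ n, E n) ?_ ?_
  · refine (le_sup_left : remotePast Z ≤ remotePast Z ⊔ nullField P) _ ?_
    rw [remotePast, MeasurableSpace.measurableSet_iInf]
    intro k
    rw [← hE.iUnion_nat_add (-k).toNat]
    refine MeasurableSet.iUnion fun n => MeasurableSet.iInter fun m => ?_
    exact ((hφ _).comp (measurable_past (by omega))) hs
  · filter_upwards [ae_all_iff.2 h] with ω hω
    simp only [Set.mem_preimage, Set.mem_iUnion, Set.mem_iInter, E, A, ← hω]
    simp

end Past

/-! ### Evolutions -/

/-- Enumeration of the maps. It is a local instance only, since a global one would offer a second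
path to the finiteness of `Function.End V`. -/
@[reducible]
def endFintype (V : Type u) [Fintype V] : Fintype (Function.End V) := Fintype.ofFinite _

attribute [local instance] endFintype

section Evolution

variable {V : Type u} [Fintype V] [MeasurableSpace V] [DiscreteMeasurableSpace V]
  {Ω : Type v} [mΩ : MeasurableSpace Ω] {P : Measure Ω} [IsProbabilityMeasure P]
  {μ : PMF (Function.End V)} {m : ℕ} {X : ℤ → Ω → Fin m → V} {N : ℤ → Ω → Function.End V}

namespace IsEvolution

variable (hE : IsEvolution P μ X N)

include hE

theorem past_pair_le (k : ℤ) : past (fun j ω => (X j ω, N j ω)) k ≤ mΩ :=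
  past_le_of_measurable fun j _ => (hE.measurable_X j).prodMk (hE.measurable_N j)

theorem past_X_le (k : ℤ) : past X k ≤ mΩ := past_le_of_measurable fun j _ => hE.measurable_X j

theorem past_N_le (k : ℤ) : past N k ≤ mΩ := past_le_of_measurable fun j _ => hE.measurable_N j

theorem remotePast_le : remotePast X ≤ mΩ := (remotePast_le_past X 0).trans (hE.past_X_le 0)

omit [Fintype V] [DiscreteMeasurableSpace V] [IsProbabilityMeasure P] hE in
theorem past_X_le_pair (k : ℤ) : past X k ≤ past (fun j ω => (X j ω, N j ω)) k :=
  past_le_of_measurable fun _ hj => measurable_fst.comp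
    (measurable_past (Z := fun j ω => (X j ω, N j ω)) hj)

omit [Fintype V] [DiscreteMeasurableSpace V] [IsProbabilityMeasure P] hE in
theorem past_N_le_pair (k : ℤ) : past N k ≤ past (fun j ω => (X j ω, N j ω)) k :=
  past_le_of_measurable fun _ hj => measurable_snd.comp
    (measurable_past (Z := fun j ω => (X j ω, N j ω)) hj)

theorem measure_inter_preimage_N {k : ℤ} {D : Set Ω}
    (hD : MeasurableSet[past (fun j ω => (X j ω, N j ω)) (k - 1)] D) (s : Set (Function.End V)) :
    P (D ∩ N k ⁻¹' s) = P D * P (N k ⁻¹' s) := by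
  have := (Indep_iff _ _ _).1 (hE.indep k) (N k ⁻¹' s) D
    ⟨s, (Set.toFinite _).measurableSet, rfl⟩ hD
  rw [Set.inter_comm, this, mul_comm]

theorem measure_preimage_N (k : ℤ) (f : Function.End V) : P (N k ⁻¹' {f}) = μ f :=
  measure_preimage_singleton_of_hasLaw (hE.measurable_N k) (hE.law k) f

open scoped Classical in
/-- The one-step transition formula. -/
theorem measure_inter_step {k : ℤ} {D : Set Ω}
    (hD : MeasurableSet[past (fun j ω => (X j ω, N j ω)) (k - 1)] D) (s : Set (Function.End V))
    (x : Fin m → V) :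
    P (D ∩ N k ⁻¹' s ∩ X k ⁻¹' {x}) =
      ∑ f with f ∈ s, μ f * ∑ y with act f y = x, P (D ∩ X (k - 1) ⁻¹' {y}) := by
  have hX : Measurable[past (fun j ω => (X j ω, N j ω)) (k - 1)] (X (k - 1)) :=
    measurable_fst.comp (measurable_past (Z := fun j ω => (X j ω, N j ω)) le_rfl)
  have hDm : MeasurableSet D := hE.past_pair_le _ D hD
  have h1 : P (D ∩ N k ⁻¹' s ∩ X k ⁻¹' {x}) =
      P ((D ∩ {ω | act (N k ω) (X (k - 1) ω) = x}) ∩ N k ⁻¹' s) := by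
    refine measure_congr (eventuallyEq_set.2 ?_)
    filter_upwards [hE.step k] with ω hω
    simp only [Set.mem_inter_iff, Set.mem_preimage, Set.mem_singleton_iff, hω]
    exact ⟨fun h => ⟨⟨h.1.1, h.2⟩, h.1.2⟩, fun h => ⟨⟨h.1.1, h.2⟩, h.1.2⟩⟩
  have hm : MeasurableSet {ω | act (N k ω) (X (k - 1) ω) = x} :=
    measurable_comp₂ act (hE.measurable_N k) (hE.measurable_X (k - 1)) (measurableSet_singleton x)
  rw [h1, measure_inter_preimage (hE.measurable_N k) (hDm.inter hm)]
  refine Finset.sum_congr rfl fun f _ => ?_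
  have h2 : D ∩ {ω | act (N k ω) (X (k - 1) ω) = x} ∩ N k ⁻¹' {f} =
      (D ∩ X (k - 1) ⁻¹' {y | act f y = x}) ∩ N k ⁻¹' {f} := by
    ext ω
    simp only [Set.mem_inter_iff, Set.mem_preimage, Set.mem_singleton_iff]
    constructor
    · rintro ⟨⟨h3, h4⟩, rfl⟩
      exact ⟨⟨h3, h4⟩, rfl⟩
    · rintro ⟨⟨h3, h4⟩, rfl⟩
      exact ⟨⟨h3, h4⟩, rfl⟩
  rw [h2, hE.measure_inter_preimage_N (hD.inter (hX (Set.toFinite _).measurableSet)),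
    hE.measure_preimage_N, mul_comm, measure_inter_preimage (hE.measurable_X _) hDm]
  simp only [Set.mem_ofPred_eq]

/-- Conditionally on an event `B` of the remote past, the law of the state at time `k` is a law
`ηQ`. Indeed the conditional laws satisfy `Q_k = μ^n Q_{k-n}`, and one can pass to the limit along a
subsequence, by compactness. -/
theorem exists_conditional_law {η : PMF (Function.End V)} (hη : η ∈ powerLimits μ)
    (hηη : η * η = η) {B : Set Ω} (hB : MeasurableSet[remotePast X] B) (hB0 : P B ≠ 0) (k : ℤ) :
    ∃ Q : PMF (Fin m → V), (∀ x, P (B ∩ X k ⁻¹' {x}) = P B * Q x) ∧ actLaw η Q = Q := by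
  classical
  have hBm : MeasurableSet B := hE.remotePast_le B hB
  have hsum : ∀ j, ∑ x, (P B)⁻¹ * P (B ∩ X j ⁻¹' {x}) = 1 := by
    intro j
    have := measure_inter_preimage (P := P) (hE.measurable_X j) hBm Set.univ
    simp only [Set.preimage_univ, Set.inter_univ, Set.mem_univ, Finset.filter_true] at this
    rw [← Finset.mul_sum, ← this, ENNReal.inv_mul_cancel hB0 (measure_ne_top _ _)]
  let Q : ℤ → PMF (Fin m → V) := fun j => PMF.ofFintype _ (hsum j)
  have hQ : ∀ j x, Q j x = (P B)⁻¹ * P (B ∩ X j ⁻¹' {x}) := fun j x => rfl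
  have hstep : ∀ j, Q j = actLaw μ (Q (j - 1)) := by
    intro j
    ext x
    have h1 := hE.measure_inter_step (k := j)
      (((remotePast_le_past X (j - 1)).trans (past_X_le_pair (j - 1))) B hB) Set.univ x
    simp only [Set.preimage_univ, Set.inter_univ, Set.mem_univ, Finset.filter_true] at h1
    rw [hQ, h1, actLaw, PMF.bind_apply, tsum_fintype, Finset.mul_sum]
    refine Finset.sum_congr rfl fun f _ => ?_
    rw [PMF.map_apply, tsum_fintype, Finset.sum_filter, mul_left_comm, Finset.mul_sum]
    refine congrArg _ (Finset.sum_congr rfl fun y _ => ?_)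
    simp only [eq_comm (a := x), hQ, mul_ite, mul_zero]
  have hpow : ∀ n : ℕ, Q k = actLaw (μ ^ n) (Q (k - n)) := by
    intro n
    induction n with
    | zero => rw [pow_zero, actLaw_one]; simp
    | succ n ih =>
      rw [ih, hstep, pow_succ, actLaw_mul]
      congr 3
      push_cast
      ring
  obtain ⟨φ, hφ, hlim⟩ := hη
  obtain ⟨Q', -, τ, hτ, hQ'⟩ := isCompact_univ.isSeqCompact
    (x := fun n => Q (k - φ n)) fun _ => trivial
  have hlim' : Tendsto (fun n => actLaw (μ ^ φ (τ n)) (Q (k - φ (τ n)))) atTop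
      (𝓝 (actLaw η Q')) :=
    (continuous_actLaw.tendsto (η, Q')).comp ((hlim.comp hτ.tendsto_atTop).prodMk_nhds hQ')
  have hQk : Q k = actLaw η Q' := by
    refine tendsto_nhds_unique ?_ hlim'
    refine tendsto_const_nhds.congr fun n => ?_
    exact hpow (φ (τ n))
  refine ⟨Q k, fun x => ?_, ?_⟩
  · rw [hQ, ← mul_assoc, ENNReal.mul_inv_cancel hB0 (measure_ne_top _ _), one_mul]
  · rw [hQk, ← actLaw_mul, hηη]

/-- The products `N_j N_{j-1} ⋯ N_{j-n+1}` have law `μ^n`. -/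
theorem measure_prod_eq (g : ℤ → ℕ → Ω → Function.End V) (hg0 : ∀ j ω, g j 0 ω = 1)
    (hg : ∀ j n ω, g j (n + 1) ω = N j ω * g (j - 1) n ω) (n : ℕ) (j : ℤ) :
    Measurable[past N j] (g j n) ∧ ∀ f, P (g j n ⁻¹' {f}) = (μ ^ n) f := by
  classical
  induction n generalizing j with
  | zero =>
    have h1 : g j 0 = fun _ => 1 := funext fun ω => hg0 j ω
    refine ⟨h1 ▸ measurable_const, fun f => ?_⟩
    rw [h1, pow_zero]
    change _ = PMF.pure 1 f
    rw [PMF.pure_apply]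
    split_ifs with h
    · subst h
      simp
    · convert measure_empty (μ := P)
      ext ω
      simp [Ne.symm h]
  | succ n ih =>
    obtain ⟨hm, hl⟩ := ih (j - 1)
    have h1 : g j (n + 1) = fun ω => N j ω * g (j - 1) n ω := funext fun ω => hg j n ω
    have hm' : Measurable (g (j - 1) n) := hm.mono (hE.past_N_le _) le_rfl
    refine ⟨?_, fun f => ?_⟩
    · rw [h1]
      exact measurable_comp₂ (· * ·) (measurable_past le_rfl)
        (hm.mono (past_mono (by omega)) le_rfl)
    · have h2 := measure_inter_preimage (P := P) (hE.measurable_N j)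
        (D := g j (n + 1) ⁻¹' {f}) (by
          rw [h1]
          exact measurable_comp₂ (· * ·) (hE.measurable_N j) hm' (measurableSet_singleton f))
        Set.univ
      simp only [Set.preimage_univ, Set.inter_univ, Set.mem_univ, Finset.filter_true] at h2
      rw [h2, pow_succ', mul_def, PMF.bind_apply, tsum_fintype]
      refine Finset.sum_congr rfl fun a _ => ?_
      have h3 : g j (n + 1) ⁻¹' {f} ∩ N j ⁻¹' {a} =
          g (j - 1) n ⁻¹' {b | a * b = f} ∩ N j ⁻¹' {a} := by
        ext ω
        simp only [Set.mem_inter_iff, Set.mem_preimage, Set.mem_singleton_iff, h1]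
        constructor
        · rintro ⟨h4, rfl⟩
          exact ⟨h4, rfl⟩
        · rintro ⟨h4, rfl⟩
          exact ⟨h4, rfl⟩
      have h5 := measure_inter_preimage (P := P) hm' MeasurableSet.univ {b | a * b = f}
      simp only [Set.univ_inter] at h5
      rw [h3, hE.measure_inter_preimage_N
        ((past_N_le_pair (j - 1)) _ (hm (Set.toFinite _).measurableSet)), hE.measure_preimage_N,
        mul_comm, h5, PMF.map_apply, tsum_fintype, Finset.sum_filter]
      refine congrArg _ (Finset.sum_congr rfl fun y _ => ?_)
      simp only [Set.mem_ofPred_eq, eq_comm (a := f), hl]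

/-- Almost surely some product `N_j ⋯ N_{j-n+1}` lies in the support of a limit point. -/
theorem ae_exists_prod_mem (g : ℤ → ℕ → Ω → Function.End V) (hg0 : ∀ j ω, g j 0 ω = 1)
    (hg : ∀ j n ω, g j (n + 1) ω = N j ω * g (j - 1) n ω) {η : PMF (Function.End V)}
    (hη : η ∈ powerLimits μ) (j : ℤ) : ∀ᵐ ω ∂P, ∃ n, g j n ω ∈ η.support := by
  classical
  obtain ⟨φ, -, hlim⟩ := hη
  rw [tendsto_pmf_iff] at hlim
  have h1 : ∀ n, P (g j n ⁻¹' η.supportᶜ) = ∑ f with f ∈ η.supportᶜ, (μ ^ n) f := by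
    intro n
    obtain ⟨hm, hl⟩ := hE.measure_prod_eq g hg0 hg n j
    have := measure_inter_preimage (P := P) (hm.mono (hE.past_N_le _) le_rfl)
      MeasurableSet.univ η.supportᶜ
    simp only [Set.univ_inter, hl] at this
    convert this
  have h2 : Tendsto (fun n => ∑ f with f ∈ η.supportᶜ, (μ ^ φ n) f) atTop
      (𝓝 (∑ f with f ∈ η.supportᶜ, η f)) := tendsto_finsetSum _ fun f _ => hlim f
  have h3 : ∑ f with f ∈ η.supportᶜ, η f = 0 := by
    refine Finset.sum_eq_zero fun f hf => ?_
    rw [PMF.apply_eq_zero_iff]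
    simpa using hf
  rw [h3] at h2
  rw [ae_iff]
  refine le_antisymm (ge_of_tendsto' h2 fun n => ?_) zero_le
  rw [← h1]
  refine measure_mono ?_
  intro ω hω
  simp only [Set.mem_ofPred_eq, not_exists] at hω
  exact hω (φ n)

end IsEvolution

end Evolution

/-! ### Independence of the driving maps, the remote past and the factor in `H` -/

section Independence

variable {V : Type u} [Fintype V] [Nonempty V] [MeasurableSpace V] [DiscreteMeasurableSpace V]
  {Ω : Type v} [mΩ : MeasurableSpace Ω] {P : Measure Ω} [IsProbabilityMeasure P]
  {μ : PMF (Function.End V)} (F : Frame μ)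
  {X : ℤ → Ω → Fin (minRank μ) → V} {N : ℤ → Ω → Function.End V}

/-- The law of `X` conditional on the event `D` is invariant under the right action of `H`. It is
stated for `P(D ∩ {X = x})`, so that null events need no separate treatment. -/
def ShiftInvariant (P : Measure Ω) (X : Ω → Fin (minRank μ) → V) (D : Set Ω) : Prop :=
  ∀ x ∈ F.LGW, ∀ c ∈ F.hGroup, P (D ∩ X ⁻¹' {F.shift c x}) = P (D ∩ X ⁻¹' {x})

variable (hE : IsEvolution P μ X N)

include hE

/-- The right action commutes with the dynamics, so that invariance propagates to the events of
the future driving maps. -/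
theorem ShiftInvariant.step (hL : ∀ k, ∀ᵐ ω ∂P, X k ω ∈ F.LGW) {k : ℤ} {D : Set Ω}
    (hD : MeasurableSet[past (fun j ω => (X j ω, N j ω)) (k - 1)] D)
    (h : ShiftInvariant F P (X (k - 1)) D) (s : Set (Function.End V)) :
    ShiftInvariant F P (X k) (D ∩ N k ⁻¹' s) := by
  classical
  intro x hx c hc
  have hcG := F.hGroup_le_gGroup hc
  rw [hE.measure_inter_step hD, hE.measure_inter_step hD]
  refine Finset.sum_congr rfl fun f _ => ?_
  by_cases hf : f ∈ μ.support
  · congr 1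
    have h0 : ∀ z, ∑ y with act f y = z, P (D ∩ X (k - 1) ⁻¹' {y}) =
        ∑ y with y ∈ {y | y ∈ F.LGW ∧ act f y = z}, P (D ∩ X (k - 1) ⁻¹' {y}) := by
      intro z
      refine (Finset.sum_subset ?_ ?_).symm
      · intro y
        simp only [Finset.mem_filter, Finset.mem_univ, true_and, Set.mem_ofPred_eq]
        exact fun h => h.2
      · intro y hy hy'
        simp only [Finset.mem_filter, Finset.mem_univ, true_and, Set.mem_ofPred_eq] at hy hy'
        have hyL : y ∉ F.LGW := fun h => hy' ⟨h, hy⟩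
        refine measure_mono_null ?_ (ae_iff.1 (hL (k - 1)))
        rintro ω ⟨-, rfl⟩
        exact hyL
    rw [h0, h0]
    refine (F.sum_shift_eq hcG (fun y hy => h y hy c hc) _ _ (fun y hy => hy.1)
      (fun y hy => hy.1) ?_ ?_).symm
    · rintro y ⟨hy, hyx⟩
      exact ⟨F.shift_mem hcG hy, by rw [F.act_shift hf hy, hyx]⟩
    · rintro y ⟨hy, hyx⟩
      exact ⟨F.shift_mem (inv_mem hcG) hy, by
        rw [F.act_shift hf hy, hyx, F.shift_inv_shift hcG hx]⟩
  · rw [(μ.apply_eq_zero_iff f).2 hf, zero_mul, zero_mul]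

variable {Λ : PMF (Fin (minRank μ) → V)} (hΛ : ∀ x ∈ Λ.support, Function.Injective x)
  (hinv : IsInvariant μ Λ) (hX : ∀ k, HasLaw (X k) Λ.toMeasure P)

include hΛ hinv hX

theorem ae_mem_LGW (k : ℤ) : ∀ᵐ ω ∂P, X k ω ∈ F.LGW := by
  filter_upwards [ae_mem_support_of_hasLaw (hE.measurable_X k) (hX k)] with ω hω
  exact F.mem_LGW_of_mem_support hinv hΛ hω

theorem ae_isPath : ∀ᵐ ω ∂P, F.IsPath (fun k => X k ω) fun k => N k ω := by
  have h1 := ae_all_iff.2 (ae_mem_LGW F hE hΛ hinv hX)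
  have h2 : ∀ᵐ ω ∂P, ∀ k, N k ω ∈ μ.support :=
    ae_all_iff.2 fun k => ae_mem_support_of_hasLaw (hE.measurable_N k) (hE.law k)
  filter_upwards [h1, h2, ae_all_iff.2 hE.step] with ω h3 h4 h5
  exact ⟨h3, h4, h5⟩

/-- Conditionally on an event of the remote past, the law of `X_k` is of the form `ηQ`, hence
invariant under the right action of `H`. -/
theorem shiftInvariant_of_remotePast {B : Set Ω} (hB : MeasurableSet[remotePast X] B) (k : ℤ) :
    ShiftInvariant F P (X k) B := by
  intro x hx c hc
  rcases eq_or_ne (P B) 0 with h0 | h0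
  · rw [measure_mono_null Set.inter_subset_left h0, measure_mono_null Set.inter_subset_left h0]
  · obtain ⟨Q, hQ, hQη⟩ := hE.exists_conditional_law F.hμ F.hη hB h0 k
    rw [hQ, hQ, ← hQη, F.actLaw_idempotent_shift ?_ hc hx]
    intro y hy
    refine hinv.mem_tupleSet hΛ ?_
    intro hy0
    rw [← measure_preimage_singleton_of_hasLaw (hE.measurable_X k) (hX k)] at hy0
    have h1 := hQ y
    rw [measure_mono_null Set.inter_subset_right hy0] at h1
    exact hy ((mul_eq_zero.1 h1.symm).resolve_left h0)

/-- For a cylinder event of the driving maps up to time `k` and an event of the remote past of `X`: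
their intersection belongs to the past, the law of `X_k` conditional on it is invariant under the
right action of `H`, and the two events are independent. The last two statements follow by
induction on the last time constrained by the cylinder. -/
theorem cylinder_inter_remotePast (s : ℤ → Set (Function.End V)) {B : Set Ω}
    (hB : MeasurableSet[remotePast X] B) (t : Finset ℤ) (k : ℤ) (htk : ∀ i ∈ t, i ≤ k) :
    MeasurableSet[past (fun j ω => (X j ω, N j ω)) k] ((⋂ i ∈ t, N i ⁻¹' s i) ∩ B) ∧
    ShiftInvariant F P (X k) ((⋂ i ∈ t, N i ⁻¹' s i) ∩ B) ∧
    P ((⋂ i ∈ t, N i ⁻¹' s i) ∩ B) = P (⋂ i ∈ t, N i ⁻¹' s i) * P B := by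
  have hL := ae_mem_LGW F hE hΛ hinv hX
  have hmeas : ∀ {B : Set Ω}, MeasurableSet[remotePast X] B → ∀ (t : Finset ℤ) (k : ℤ),
      (∀ i ∈ t, i ≤ k) →
      MeasurableSet[past (fun j ω => (X j ω, N j ω)) k] ((⋂ i ∈ t, N i ⁻¹' s i) ∩ B) := by
    intro B hB t k htk
    have h1 : MeasurableSet[past (fun j ω => (X j ω, N j ω)) k] (⋂ i ∈ t, N i ⁻¹' s i) := by
      refine Finset.measurableSet_biInter _ fun i hi => ?_
      exact (IsEvolution.past_N_le_pair k) _
        (measurable_past (htk i hi) (Set.toFinite (s i)).measurableSet)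
    exact h1.inter (((remotePast_le_past X k).trans (IsEvolution.past_X_le_pair k)) B hB)
  refine ⟨hmeas hB t k htk, ?_, ?_⟩
  · -- invariance propagates from the last constrained time to `k`
    have hprop : ∀ {D : Set Ω} {a : ℤ},
        MeasurableSet[past (fun j ω => (X j ω, N j ω)) a] D → ShiftInvariant F P (X a) D →
        ∀ n : ℕ, ShiftInvariant F P (X (a + n)) D := by
      intro D a hD h n
      induction n with
      | zero => simpa using h
      | succ n ih =>
        have h1 : a + ((n + 1 : ℕ) : ℤ) - 1 = a + n := by push_cast; ring
        have := ShiftInvariant.step F hE hL (k := a + ((n + 1 : ℕ) : ℤ)) (D := D)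
          (by rw [h1]; exact past_mono (by omega) D hD) (by rwa [h1]) Set.univ
        simpa using this
    induction t using Finset.induction_on_max generalizing k with
    | empty => simpa using shiftInvariant_of_remotePast F hE hΛ hinv hX hB k
    | insert a t ha ih =>
      have hak : a ≤ k := htk a (Finset.mem_insert_self a t)
      have hta : ∀ i ∈ t, i ≤ a - 1 := fun i hi => by have := ha i hi; omega
      have h1 := ShiftInvariant.step F hE hL (hmeas hB t (a - 1) hta) (ih (a - 1) hta) (s a)
      have h2 : (⋂ i ∈ insert a t, N i ⁻¹' s i) ∩ B =
          (⋂ i ∈ t, N i ⁻¹' s i) ∩ B ∩ N a ⁻¹' s a := by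
        rw [Finset.set_biInter_insert]
        ext ω
        simp only [Set.mem_inter_iff]
        tauto
      rw [← h2] at h1
      have h3 := hprop (hmeas hB (insert a t) a fun i hi => by
        rcases Finset.mem_insert.1 hi with rfl | hi
        · exact le_rfl
        · exact (ha i hi).le) h1 (k - a).toNat
      rwa [show a + ((k - a).toNat : ℤ) = k by omega] at h3
  · induction t using Finset.induction_on_max generalizing k with
    | empty => simp
    | insert a t ha ih =>
      have hta : ∀ i ∈ t, i ≤ a - 1 := fun i hi => by have := ha i hi; omega
      have h2 : (⋂ i ∈ insert a t, N i ⁻¹' s i) ∩ B =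
          (⋂ i ∈ t, N i ⁻¹' s i) ∩ B ∩ N a ⁻¹' s a := by
        rw [Finset.set_biInter_insert]
        ext ω
        simp only [Set.mem_inter_iff]
        tauto
      have h3 : (⋂ i ∈ insert a t, N i ⁻¹' s i) = (⋂ i ∈ t, N i ⁻¹' s i) ∩ N a ⁻¹' s a := by
        rw [Finset.set_biInter_insert, Set.inter_comm]
      have h4 := hmeas (B := Set.univ) MeasurableSet.univ t (a - 1) hta
      rw [Set.inter_univ] at h4
      rw [h2, h3, hE.measure_inter_preimage_N (hmeas hB t (a - 1) hta),
        hE.measure_inter_preimage_N h4, ih (a - 1) hta]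
      ring

omit [Fintype V] [Nonempty V] [MeasurableSpace V] [DiscreteMeasurableSpace V]
  [IsProbabilityMeasure P] hE hΛ hinv hX in
/-- The events generating `σ(N_j : j ≤ k)` as finite intersections are cylinder events. -/
theorem exists_cylinder {k : ℤ} {A : Set Ω}
    (hA : A ∈ piiUnionInter (fun j => {s | MeasurableSet[MeasurableSpace.comap (N j) inferInstance] s})
      (Set.Iic k)) : ∃ (t : Finset ℤ) (s : ℤ → Set (Function.End V)), (∀ i ∈ t, i ≤ k) ∧
        A = ⋂ i ∈ t, N i ⁻¹' s i := by
  obtain ⟨t, ht, f, hf, rfl⟩ := hA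
  have : ∀ i, ∃ s : Set (Function.End V), i ∈ t → N i ⁻¹' s = f i := by
    intro i
    by_cases hi : i ∈ t
    · obtain ⟨s, -, hs⟩ := hf i hi
      exact ⟨s, fun _ => hs⟩
    · exact ⟨∅, fun h => absurd h hi⟩
  choose s hs using this
  exact ⟨t, s, fun i hi => ht hi, Set.iInter₂_congr fun i hi => (hs i hi).symm⟩

omit [Fintype V] [Nonempty V] [MeasurableSpace V] [DiscreteMeasurableSpace V]
  [IsProbabilityMeasure P] hE hΛ hinv hX in
theorem past_eq_generateFrom (k : ℤ) : past N k = MeasurableSpace.generateFrom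
    (piiUnionInter (fun j => {s | MeasurableSet[MeasurableSpace.comap (N j) inferInstance] s})
      (Set.Iic k)) :=
  (generateFrom_piiUnionInter_measurableSet
    (fun j => MeasurableSpace.comap (N j) inferInstance) (Set.Iic k)).symm

omit [Fintype V] [Nonempty V] [MeasurableSpace V] [DiscreteMeasurableSpace V]
  [IsProbabilityMeasure P] hE hΛ hinv hX in
theorem isPiSystem_cylinders (k : ℤ) : IsPiSystem
    (piiUnionInter (fun j => {s | MeasurableSet[MeasurableSpace.comap (N j) inferInstance] s})
      (Set.Iic k)) :=
  isPiSystem_piiUnionInter _ (fun j => @MeasurableSpace.isPiSystem_measurableSet Ω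
    (MeasurableSpace.comap (N j) inferInstance)) _

include F in
/-- The driving maps up to time `k` are independent of the remote past of `X`. -/
theorem indep_past_remotePast (k : ℤ) : Indep (past N k) (remotePast X) P := by
  refine IndepSets.indep (hE.past_N_le k) hE.remotePast_le (isPiSystem_cylinders k)
    (@MeasurableSpace.isPiSystem_measurableSet Ω (remotePast X)) (past_eq_generateFrom k)
    (@MeasurableSpace.generateFrom_measurableSet Ω (remotePast X)).symm ?_
  rw [IndepSets_iff]
  intro A B hA hB
  obtain ⟨t, s, ht, rfl⟩ := exists_cylinder hA
  exact (cylinder_inter_remotePast F hE hΛ hinv hX s hB t k ht).2.2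

/-- Conditionally on an event of `σ(N_j : j ≤ k)` and an event of the remote past of `X`, the law
of `X_k` is invariant under the right action of `H`. -/
theorem shiftInvariant_inter {k : ℤ} {A B : Set Ω} (hA : MeasurableSet[past N k] A)
    (hB : MeasurableSet[remotePast X] B) : ShiftInvariant F P (X k) (A ∩ B) := by
  have hBm := hE.remotePast_le B hB
  intro x hx c hc
  have hm : ∀ y, MeasurableSet (B ∩ X k ⁻¹' {y}) := fun y =>
    hBm.inter (hE.measurable_X k (measurableSet_singleton y))
  have h0 : ∀ t : Finset ℤ, ∀ s : ℤ → Set (Function.End V), (∀ i ∈ t, i ≤ k) →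
      P ((⋂ i ∈ t, N i ⁻¹' s i) ∩ (B ∩ X k ⁻¹' {F.shift c x})) =
        P ((⋂ i ∈ t, N i ⁻¹' s i) ∩ (B ∩ X k ⁻¹' {x})) := by
    intro t s ht
    have := (cylinder_inter_remotePast F hE hΛ hinv hX s hB t k ht).2.1 x hx c hc
    rwa [Set.inter_assoc, Set.inter_assoc] at this
  rw [Set.inter_assoc, Set.inter_assoc]
  clear hB hBm
  have hgen := past_eq_generateFrom (N := N) k
  have hpi := isPiSystem_cylinders (N := N) k
  induction A, hA using MeasurableSpace.induction_on_inter hgen hpi with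
  | empty => simp
  | basic A hA =>
    obtain ⟨t, s, ht, rfl⟩ := exists_cylinder hA
    exact h0 t s ht
  | compl A hA ih =>
    have h1 := h0 ∅ (fun _ => ∅) (by simp)
    simp only [Finset.notMem_empty, Set.iInter_of_empty, Set.iInter_univ, Set.univ_inter] at h1
    have hAm := hE.past_N_le k A hA
    have h2 : ∀ E : Set Ω, Aᶜ ∩ E = E \ (A ∩ E) := by
      intro E
      ext ω
      simp only [Set.mem_inter_iff, Set.mem_compl_iff, Set.mem_sdiff]
      tauto
    rw [h2, h2, measure_sdiff Set.inter_subset_right (hAm.inter (hm _)).nullMeasurableSet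
      (measure_ne_top _ _), measure_sdiff Set.inter_subset_right
      (hAm.inter (hm _)).nullMeasurableSet (measure_ne_top _ _), ih, h1]
  | iUnion A hd hA ih =>
    rw [Set.iUnion_inter, Set.iUnion_inter, measure_iUnion, measure_iUnion]
    · exact tsum_congr ih
    · exact fun i j hij => (hd hij).mono Set.inter_subset_left Set.inter_subset_left
    · exact fun i => (hE.past_N_le k _ (hA i)).inter (hm _)
    · exact fun i j hij => (hd hij).mono Set.inter_subset_left Set.inter_subset_left
    · exact fun i => (hE.past_N_le k _ (hA i)).inter (hm _)

/-- The right action of `H` is transitive on the values of the factor in `H`, which is therefore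
uniform conditionally on an event with the invariance property. -/
theorem measure_inter_hPart {k : ℤ} {D : Set Ω} (hD : MeasurableSet D)
    (h : ShiftInvariant F P (X k) D) (u : Function.End V) :
    P (D ∩ (fun ω => (F.hPart k (X k ω)).val) ⁻¹' {u}) = P D * unif F.H u := by
  classical
  have hL := ae_mem_LGW F hE hΛ hinv hX k
  rw [← F.groupSet_hGroup]
  have hm : Measurable fun ω => (F.hPart k (X k ω)).val :=
    measurable_comp₁ (fun x => (F.hPart k x).val) (hE.measurable_X k)
  refine measure_inter_preimage_eq_mul_unif hm hD (groupSet_nonempty _)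
    (fun ω => ⟨_, F.hPart_mem k _, rfl⟩) ?_ u
  rintro _ ⟨a, ha, rfl⟩ _ ⟨b, hb, rfl⟩
  have h1 : ∀ d : CornerUnit F.he, P (D ∩ (fun ω => (F.hPart k (X k ω)).val) ⁻¹' {d.val}) =
      ∑ x with x ∈ {x | x ∈ F.LGW ∧ F.hPart k x = d}, P (D ∩ X k ⁻¹' {x}) := by
    intro d
    refine Eq.trans ?_ ((measure_inter_preimage (P := P) (hE.measurable_X k) hD
      {x | x ∈ F.LGW ∧ F.hPart k x = d}).trans (by congr))
    refine measure_congr (eventuallyEq_set.2 ?_)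
    filter_upwards [hL] with ω hω
    simp only [Set.mem_inter_iff, Set.mem_preimage, Set.mem_singleton_iff, Set.mem_ofPred_eq, hω,
      true_and, CornerUnit.val_injective.eq_iff]
  have hc : a⁻¹ * b ∈ F.hGroup := mul_mem (inv_mem ha) hb
  have hcG := F.hGroup_le_gGroup hc
  rw [h1, h1]
  refine F.sum_shift_eq hcG (fun y hy => h y hy _ hc) _ _ (fun y hy => hy.1)
    (fun y hy => hy.1) ?_ ?_
  · rintro y ⟨hy, hya⟩
    exact ⟨F.shift_mem hcG hy, by rw [F.hPart_shift k hc hy, hya, mul_inv_cancel_left]⟩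
  · rintro y ⟨hy, hya⟩
    refine ⟨F.shift_mem (inv_mem hcG) hy, ?_⟩
    rw [F.hPart_shift k (inv_mem hc) hy, hya]
    group

theorem measure_inter_inter_hPart {k : ℤ} {A B : Set Ω} (hA : MeasurableSet[past N k] A)
    (hB : MeasurableSet[remotePast X] B) (s : Set (Function.End V)) :
    P (A ∩ B ∩ (fun ω => (F.hPart k (X k ω)).val) ⁻¹' s) =
      P A * P B * (unif F.H).toMeasure s := by
  have hm : Measurable fun ω => (F.hPart k (X k ω)).val :=
    measurable_comp₁ (fun x => (F.hPart k x).val) (hE.measurable_X k)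
  have hD := (hE.past_N_le k A hA).inter (hE.remotePast_le B hB)
  rw [measure_inter_preimage_eq_mul hm hD (measure_inter_hPart F hE hΛ hinv hX hD
    (shiftInvariant_inter F hE hΛ hinv hX hA hB)) s,
    (Indep_iff _ _ _).1 (indep_past_remotePast F hE hΛ hinv hX k) A B hA hB]

theorem hasLaw_hPart (k : ℤ) :
    HasLaw (fun ω => (F.hPart k (X k ω)).val) (unif F.H).toMeasure P := by
  have hm : Measurable fun ω => (F.hPart k (X k ω)).val :=
    measurable_comp₁ (fun x => (F.hPart k x).val) (hE.measurable_X k)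
  refine hasLaw_of_measure_preimage hm fun u => ?_
  have := measure_inter_hPart F hE hΛ hinv hX (k := k) MeasurableSet.univ
    (shiftInvariant_of_remotePast F hE hΛ hinv hX MeasurableSet.univ k) u
  simpa using this

theorem iIndep_past_remotePast_hPart (k : ℤ) : iIndep ![past N k, remotePast X,
    MeasurableSpace.comap (fun ω => (F.hPart k (X k ω)).val) inferInstance] P := by
  have hm : Measurable fun ω => (F.hPart k (X k ω)).val :=
    measurable_comp₁ (fun x => (F.hPart k x).val) (hE.measurable_X k)
  have key : ∀ {A B C : Set Ω}, MeasurableSet[past N k] A → MeasurableSet[remotePast X] B →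
      MeasurableSet[MeasurableSpace.comap (fun ω => (F.hPart k (X k ω)).val) inferInstance] C →
      P (A ∩ (B ∩ C)) = P A * P B * P C := by
    rintro A B _ hA hB ⟨s, -, rfl⟩
    rw [← Set.inter_assoc, measure_inter_inter_hPart F hE hΛ hinv hX hA hB s,
      measure_preimage_of_hasLaw hm (hasLaw_hPart F hE hΛ hinv hX k)]
  rw [iIndep_iff]
  intro S f hf
  -- events outside the index set are replaced by the sure event
  classical
  let g : Fin 3 → Set Ω := fun i => if i ∈ S then f i else Set.univ
  have hg : ∀ i, MeasurableSet[![past N k, remotePast X,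
      MeasurableSpace.comap (fun ω => (F.hPart k (X k ω)).val) inferInstance] i] (g i) := by
    intro i
    by_cases hi : i ∈ S
    · simpa only [g, if_pos hi] using hf i hi
    · simp only [g, if_neg hi]
      exact MeasurableSet.univ
  have h1 : ⋂ i ∈ S, f i = g 0 ∩ (g 1 ∩ g 2) := by
    ext ω
    have h2 : ω ∈ ⋂ i ∈ S, f i ↔ ∀ i, ω ∈ g i := by
      simp only [Set.mem_iInter, g]
      refine forall_congr' fun i => ?_
      by_cases hi : i ∈ S <;> simp [hi]
    rw [h2, Fin.forall_fin_succ, Fin.forall_fin_two]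
    rfl
  have h3 : ∏ i ∈ S, P (f i) = ∏ i, P (g i) := by
    rw [← Finset.prod_subset (Finset.subset_univ S)]
    · refine Finset.prod_congr rfl fun i hi => ?_
      simp only [g, if_pos hi]
    · intro i _ hi
      simp only [g, if_neg hi, measure_univ]
  rw [h1, h3, Fin.prod_univ_three]
  exact key (hg 0) (hg 1) (hg 2)

end Independence

/-! ### The σ-fields of the evolution -/

section Fields

variable {V : Type u} [Fintype V] [Nonempty V] [MeasurableSpace V] [DiscreteMeasurableSpace V]
  {Ω : Type v} {m : MeasurableSpace Ω} [mΩ : MeasurableSpace Ω] {P : Measure Ω}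
  [IsProbabilityMeasure P]
  {μ : PMF (Function.End V)} (F : Frame μ)
  {X : ℤ → Ω → Fin (minRank μ) → V} {N : ℤ → Ω → Function.End V}
  {Λ : PMF (Fin (minRank μ) → V)}

/-- The product `f_j f_{j-1} ⋯ f_{j-n+1}`, as a function of `n` and `j`. -/
def iterMap {M : Type u} [Monoid M] (f : ℤ → M) : ℕ → ℤ → M
  | 0, _ => 1
  | n + 1, j => f j * iterMap f n (j - 1)

theorem support_η_subset : F.η.support ⊆ F.ν.support := fun _ hz =>
  (mem_support_average F.hμ F.hη F.heη F.ν_eq F.he).2 ⟨F.η, F.hμ, hz⟩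

/-- Along almost every trajectory a product `N_j ⋯ N_{j-n+1}` eventually falls in the kernel, where
the `L`-coordinate of the image no longer depends on the starting point. -/
theorem measurable_projL_past (hE : IsEvolution P μ X N)
    (hp : ∀ᵐ ω ∂P, F.IsPath (fun k => X k ω) fun k => N k ω) (j : ℤ) :
    Measurable[past N j ⊔ nullField P] fun ω => F.projL (X j ω) := by
  have hle : past N j ⊔ nullField P ≤ mΩ := sup_le (hE.past_N_le j) nullField_le
  have hm := fun n => (hE.measure_prod_eq (fun j n ω => iterMap (fun k => N k ω) n j)
    (fun _ _ => rfl) (fun _ _ _ => rfl) n j).1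
  have hex := hE.ae_exists_prod_mem (fun j n ω => iterMap (fun k => N k ω) n j)
    (fun _ _ => rfl) (fun _ _ _ => rfl) F.hμ j
  intro s _
  let B : Set (Function.End V) :=
    {z | z ∈ F.ν.support ∧ z * F.e * F.inv (F.e * z * F.e) ∈ s}
  have hB : MeasurableSet[past N j ⊔ nullField P]
      (⋃ n : ℕ, (fun ω => iterMap (fun k => N k ω) n j) ⁻¹' B) :=
    MeasurableSet.iUnion fun n => le_sup_left (b := nullField P) _
      (hm n (Set.toFinite B).measurableSet)
  refine measurableSet_of_ae_eq le_sup_right hle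
    (measurable_comp₁ F.projL (hE.measurable_X j) (Set.toFinite s).measurableSet) hB ?_
  filter_upwards [hp, hex] with ω h1 ⟨n, hn⟩
  have h2 : ∀ n, iterMap (fun k => N k ω) n j ∈ F.ν.support →
      F.projL (X j ω) = iterMap (fun k => N k ω) n j * F.e *
        F.inv (F.e * iterMap (fun k => N k ω) n j * F.e) := by
    intro n hn
    have h3 := h1.eq_act_prod j (fun j n => iterMap (fun k => N k ω) n j) (fun _ => rfl)
      (fun _ _ => rfl) n
    rw [← F.projL_act_of_mem_kernel hn (h1.mem_LGW (j - n)), ← h3]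
  simp only [Set.mem_preimage, Set.mem_iUnion, B, Set.mem_ofPred_eq]
  constructor
  · intro h
    exact ⟨n, support_η_subset F hn, by rwa [← h2 n (support_η_subset F hn)]⟩
  · rintro ⟨n, h3, h4⟩
    rwa [h2 n h3]

theorem measurable_MG_past (hE : IsEvolution P μ X N)
    (hp : ∀ᵐ ω ∂P, F.IsPath (fun k => X k ω) fun k => N k ω) (j : ℤ) :
    Measurable[past N j ⊔ nullField P] (F.MG X j (j - 1)) := by
  have hle : past N j ⊔ nullField P ≤ mΩ := sup_le (hE.past_N_le j) nullField_le
  have h1 : Measurable[past N j ⊔ nullField P] fun ω => F.projL (X (j - 1) ω) :=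
    (measurable_projL_past F hE hp (j - 1)).mono
      (sup_le_sup_right (past_mono (by omega)) _) le_rfl
  have h2 : Measurable[past N j ⊔ nullField P] (N j) :=
    (measurable_past le_rfl).mono le_sup_left le_rfl
  refine measurable_of_ae_eq le_sup_right hle
    (measurable_comp₂ (fun x y => F.projG x * F.inv (F.projG y)) (hE.measurable_X j)
      (hE.measurable_X (j - 1)))
    (measurable_comp₂ (fun f l => F.e * f * l) h2 h1) ?_
  filter_upwards [hp] with ω hω
  exact hω.increment_eq j

theorem past_coordinates_le (hE : IsEvolution P μ X N)
    (hp : ∀ᵐ ω ∂P, F.IsPath (fun k => X k ω) fun k => N k ω) (k : ℤ) :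
    past (fun j ω => (F.projL (X j ω), F.MG X j (j - 1) ω)) k ≤ past N k ⊔ nullField P := by
  refine past_le_of_measurable fun j hj => ?_
  exact ((measurable_projL_past F hE hp j).prodMk (measurable_MG_past F hE hp j)).mono
    (sup_le_sup_right (past_mono hj) _) le_rfl

/-- The past of `X` is recovered from the `L`-coordinates, the increments of the `G`-coordinates,
and the factors of the current `G`- and `W`-coordinates. -/
theorem past_le_of_measurable_coordinates (hE : IsEvolution P μ X N)
    (hp : ∀ᵐ ω ∂P, F.IsPath (fun k => X k ω) fun k => N k ω)
    (hnull : nullField P ≤ m) (hm : m ≤ mΩ) {k : ℤ}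
    (hL : ∀ j ≤ k, Measurable[m] fun ω => F.projL (X j ω))
    (hM : ∀ j ≤ k, Measurable[m] (F.MG X j (j - 1)))
    {Y : Ω → Function.End V} {Z : Ω → Fin (minRank μ) → V}
    (hY : Measurable[m] Y) (hZ : Measurable[m] Z)
    (hYX : ∀ᵐ ω ∂P, (F.gen ^ F.phase 0 (X 0 ω)).val = Y ω)
    (hZX : ∀ᵐ ω ∂P, F.projW (X 0 ω) = Z ω)
    (hU : Measurable[m] fun ω => (F.hPart k (X k ω)).val) : past X k ≤ m := by
  have hMG : ∀ (n : ℕ) (j : ℤ), j + n ≤ k → Measurable[m] (F.MG X (j + n) j) := by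
    intro n
    induction n with
    | zero =>
      intro j _
      refine measurable_of_ae_eq hnull hm
        (measurable_comp₂ (fun x y => F.projG x * F.inv (F.projG y)) (hE.measurable_X _)
          (hE.measurable_X j)) (measurable_const (a := F.e)) ?_
      filter_upwards [hp] with ω hω
      have h1 := hω.mul_inv_eq j j
      rw [mul_inv_cancel] at h1
      simpa [Frame.MG, CornerUnit.val_one] using h1
    | succ n ih =>
      intro j hj
      have hj' : j + ((n + 1 : ℕ) : ℤ) - 1 = j + n := by push_cast; ring
      have h1 := ih j (by push_cast at hj; omega)
      have h2 := hM (j + ((n + 1 : ℕ) : ℤ)) hj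
      rw [hj'] at h2
      refine measurable_of_ae_eq hnull hm
        (measurable_comp₂ (fun x y => F.projG x * F.inv (F.projG y)) (hE.measurable_X _)
          (hE.measurable_X j)) (measurable_comp₂ (fun a b => a * b) h2 h1) ?_
      filter_upwards [hp] with ω hω
      simp only [Frame.MG]
      rw [hω.mul_inv_eq, hω.mul_inv_eq, hω.mul_inv_eq, ← CornerUnit.val_mul]
      congr 1
      group
  refine past_le_of_measurable fun j hj => ?_
  have h1 := hMG (k - j).toNat j (by omega)
  rw [show j + ((k - j).toNat : ℤ) = k by omega] at h1
  have h2 := measurable_comp₂ (fun l a => l * F.inv a) (hL j hj) h1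
  have h3 := measurable_comp₂ (fun a y => a * (F.γpow k * y)) h2 hY
  have h4 := measurable_comp₂ (fun a h => a * h) h3 hU
  refine measurable_of_ae_eq hnull hm (hE.measurable_X j)
    (measurable_comp₂ (fun f x => act f x) h4 hZ) ?_
  filter_upwards [hp, hYX, hZX] with ω h5 h6 h7
  have := h5.eq_act k j
  rw [h6, h7] at this
  exact this

variable {Y : Ω → Function.End V} {Z : Ω → Fin (minRank μ) → V}

theorem measurable_remotePast_phase (hE : IsEvolution P μ X N)
    (hp : ∀ᵐ ω ∂P, F.IsPath (fun k => X k ω) fun k => N k ω) (hY : Measurable Y)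
    (hYX : ∀ᵐ ω ∂P, (F.gen ^ F.phase 0 (X 0 ω)).val = Y ω) :
    Measurable[remotePast X ⊔ nullField P] Y := by
  refine measurable_remotePast_of_ae_eq hE.measurable_X hY
    (φ := fun k x => (F.gen ^ F.phase k x).val) (fun k => measurable_of_finite _) fun k => ?_
  filter_upwards [hp, hYX] with ω h1 h2
  rw [← h2, ← h1.phase_eq k]

theorem measurable_remotePast_projW (hE : IsEvolution P μ X N)
    (hp : ∀ᵐ ω ∂P, F.IsPath (fun k => X k ω) fun k => N k ω) (hZ : Measurable Z)
    (hZX : ∀ᵐ ω ∂P, F.projW (X 0 ω) = Z ω) :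
    Measurable[remotePast X ⊔ nullField P] Z := by
  refine measurable_remotePast_of_ae_eq hE.measurable_X hZ
    (φ := fun _ => F.projW) (fun k => measurable_of_finite _) fun k => ?_
  filter_upwards [hp, hZX] with ω h1 h2
  rw [← h2, ← h1.projW_eq k]

/-- The `σ`-field of the past of `X` decomposes into three parts, see
`past_le_of_measurable_coordinates` for the non-trivial inclusion. -/
theorem asEq_past (hE : IsEvolution P μ X N)
    (hp : ∀ᵐ ω ∂P, F.IsPath (fun k => X k ω) fun k => N k ω) (hY : Measurable Y)
    (hZ : Measurable Z) (hYX : ∀ᵐ ω ∂P, (F.gen ^ F.phase 0 (X 0 ω)).val = Y ω)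
    (hZX : ∀ᵐ ω ∂P, F.projW (X 0 ω) = Z ω) (k : ℤ) :
    AsEq P (past X k) (past (fun j ω => (F.projL (X j ω), F.MG X j (j - 1) ω)) k ⊔
      remotePast X ⊔ MeasurableSpace.comap (fun ω => (F.hPart k (X k ω)).val) inferInstance) := by
  have hGX : past (fun j ω => (F.projL (X j ω), F.MG X j (j - 1) ω)) k ≤ past X k := by
    refine past_le_of_measurable fun j hj => ?_
    have h1 : Measurable[past X k] (X j) := measurable_past hj
    have h2 : Measurable[past X k] (X (j - 1)) := measurable_past (by omega)
    exact (measurable_comp₁ F.projL h1).prodMk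
      (measurable_comp₂ (fun x y => F.projG x * F.inv (F.projG y)) h1 h2)
  have hRX : past (fun j ω => (F.projL (X j ω), F.MG X j (j - 1) ω)) k ⊔ remotePast X ⊔
      MeasurableSpace.comap (fun ω => (F.hPart k (X k ω)).val) inferInstance ≤ past X k :=
    sup_le (sup_le hGX (remotePast_le_past X k)) (Measurable.comap_le
      (measurable_comp₁ (fun x => (F.hPart k x).val) (measurable_past le_rfl)))
  refine le_antisymm (sup_le ?_ le_sup_right) (sup_le_sup_right hRX _)
  refine past_le_of_measurable_coordinates F hE hp le_sup_right
    (sup_le (hRX.trans (hE.past_X_le k)) nullField_le) (fun j hj => ?_) (fun j hj => ?_)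
    ((measurable_remotePast_phase F hE hp hY hYX).mono
      (sup_le_sup_right (le_sup_right.trans le_sup_left) _) le_rfl)
    ((measurable_remotePast_projW F hE hp hZ hZX).mono
      (sup_le_sup_right (le_sup_right.trans le_sup_left) _) le_rfl) hYX hZX
    ((comap_measurable _).mono (le_sup_right.trans le_sup_left) le_rfl)
  · exact (measurable_fst.comp (measurable_past
      (Z := fun j ω => (F.projL (X j ω), F.MG X j (j - 1) ω)) hj)).mono
      (le_sup_left.trans (le_sup_left.trans le_sup_left)) le_rfl
  · exact (measurable_snd.comp (measurable_past
      (Z := fun j ω => (F.projL (X j ω), F.MG X j (j - 1) ω)) hj)).mono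
      (le_sup_left.trans (le_sup_left.trans le_sup_left)) le_rfl

/-- The remote past is generated by the phase and the `W`-coordinate: it is contained in the field
generated by them, `N_j` for `j ≤ 0` and the `H`-factor at time `0`, and it is independent of the
latter two. -/
theorem asEq_remotePast (hE : IsEvolution P μ X N)
    (hp : ∀ᵐ ω ∂P, F.IsPath (fun k => X k ω) fun k => N k ω)
    (hind : iIndep ![past N 0, remotePast X,
      MeasurableSpace.comap (fun ω => (F.hPart 0 (X 0 ω)).val) inferInstance] P)
    (hY : Measurable Y) (hZ : Measurable Z)
    (hYX : ∀ᵐ ω ∂P, (F.gen ^ F.phase 0 (X 0 ω)).val = Y ω)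
    (hZX : ∀ᵐ ω ∂P, F.projW (X 0 ω) = Z ω) :
    AsEq P (remotePast X) (MeasurableSpace.comap (fun ω => (Y ω, Z ω)) inferInstance) := by
  have hYr := measurable_remotePast_phase F hE hp hY hYX
  have hZr := measurable_remotePast_projW F hE hp hZ hZX
  have hT := hYr.prodMk hZr
  have hUm : Measurable fun ω => (F.hPart 0 (X 0 ω)).val :=
    measurable_comp₁ (fun x => (F.hPart 0 x).val) (hE.measurable_X 0)
  refine le_antisymm (sup_le ?_ le_sup_right) (sup_le (Measurable.comap_le hT) le_sup_right)
  have hU_le := Measurable.comap_le hUm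
  have hT_le := Measurable.comap_le (hY.prodMk hZ)
  have hind' : Indep (past N 0 ⊔
      MeasurableSpace.comap (fun ω => (F.hPart 0 (X 0 ω)).val) inferInstance)
      (remotePast X) P := by
    have h1 := indep_iSup_of_disjoint (m := ![past N 0, remotePast X,
      MeasurableSpace.comap (fun ω => (F.hPart 0 (X 0 ω)).val) inferInstance])
      (fun i => ?_) hind (S := {0, 2}) (T := {1}) (by simp)
    · refine indep_of_indep_of_le_left (indep_of_indep_of_le_right h1 ?_) ?_
      · exact le_iSup₂_of_le 1 (by simp) le_rfl
      · exact sup_le (le_iSup₂_of_le 0 (by simp) le_rfl) (le_iSup₂_of_le 2 (by simp) le_rfl)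
    · fin_cases i
      · exact hE.past_N_le 0
      · exact hE.remotePast_le
      · exact hU_le
  have hcoord : ∀ j ≤ (0 : ℤ), past N j ⊔ nullField P ≤ past N 0 ⊔
      MeasurableSpace.comap (fun ω => (F.hPart 0 (X 0 ω)).val) inferInstance ⊔
      MeasurableSpace.comap (fun ω => (Y ω, Z ω)) inferInstance ⊔ nullField P := fun j hj =>
    sup_le_sup_right ((past_mono hj).trans (le_sup_left.trans le_sup_left)) _
  have key : past X 0 ≤ past N 0 ⊔
      MeasurableSpace.comap (fun ω => (F.hPart 0 (X 0 ω)).val) inferInstance ⊔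
      MeasurableSpace.comap (fun ω => (Y ω, Z ω)) inferInstance ⊔ nullField P := by
    refine past_le_of_measurable_coordinates F hE hp le_sup_right
      (sup_le (sup_le (sup_le (hE.past_N_le 0) hU_le) hT_le) nullField_le)
      (fun j hj => (measurable_projL_past F hE hp j).mono (hcoord j hj) le_rfl)
      (fun j hj => (measurable_MG_past F hE hp j).mono (hcoord j hj) le_rfl)
      ((measurable_fst.comp (comap_measurable _)).mono (le_sup_right.trans le_sup_left) le_rfl)
      ((measurable_snd.comp (comap_measurable _)).mono (le_sup_right.trans le_sup_left) le_rfl)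
      hYX hZX ?_
    exact (comap_measurable _).mono (le_sup_right.trans (le_sup_left.trans le_sup_left)) le_rfl
  intro A hA
  exact measurableSet_comap_of_indep hE.remotePast_le hind' (hY.prodMk hZ) hT hA
    (key A (remotePast_le_past X 0 A hA))

end Fields

/-! ### The law of the phase and of the coordinate in `W` -/

section PhaseLaw

variable {V : Type u} [Fintype V] [Nonempty V] [MeasurableSpace V] [DiscreteMeasurableSpace V]
  {Ω : Type v} [mΩ : MeasurableSpace Ω] {P : Measure Ω} [IsProbabilityMeasure P]
  {μ : PMF (Function.End V)} (F : Frame μ)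
  {X : Ω → Fin (minRank μ) → V} {Λ : PMF (Fin (minRank μ) → V)}
  {Y : Ω → Function.End V} {Z : Ω → Fin (minRank μ) → V}

theorem hasLaw_comp {α β : Type*} [MeasurableSpace α] [DiscreteMeasurableSpace α] [Countable α]
    [MeasurableSpace β] {X : Ω → α} {ρ : PMF α} (h : HasLaw X ρ.toMeasure P) (φ : α → β) :
    HasLaw (fun ω => φ (X ω)) (ρ.map φ).toMeasure P := by
  have hφ : Measurable φ := Measurable.of_discrete
  have h1 : HasLaw φ (ρ.map φ).toMeasure ρ.toMeasure :=
    ⟨hφ.aemeasurable, PMF.toMeasure_map φ ρ hφ⟩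
  exact h1.comp h

/-- The elements `γ ^ i`, `i < p`, lie in distinct cosets of `H`, so they are distinct. -/
theorem gen_pow_inj {i j : ℕ} (hi : i < period μ) (hj : j < period μ)
    (h : (F.gen ^ i).val = (F.gen ^ j).val) : i = j := by
  have h1 := CornerUnit.val_injective h
  refine (F.existsUnique_coset (pow_mem F.gen_mem j)).unique ⟨hi, ?_⟩ ⟨hj, ?_⟩
  · rw [h1, inv_mul_cancel]
    exact one_mem _
  · rw [inv_mul_cancel]
    exact one_mem _

/-- `Λ` is invariant under the right action of `G`, which moves the phases transitively and fixes
the `W`-coordinate. -/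
theorem measure_inter_phase (hΛ : ∀ x ∈ Λ.support, Function.Injective x)
    (hinv : IsInvariant μ Λ) (hXm : Measurable X) (hX : HasLaw X Λ.toMeasure P)
    (hY : Measurable Y) (hZ : Measurable Z) (hYC : ∀ ω, Y ω ∈ F.C)
    (hYX : ∀ᵐ ω ∂P, (F.gen ^ F.phase 0 (X ω)).val = Y ω)
    (hZX : ∀ᵐ ω ∂P, F.projW (X ω) = Z ω) (t : Set (Fin (minRank μ) → V))
    (y : Function.End V) : P (Z ⁻¹' t ∩ Y ⁻¹' {y}) = P (Z ⁻¹' t) * unif F.C y := by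
  classical
  have hL : ∀ᵐ ω ∂P, X ω ∈ F.LGW := by
    filter_upwards [ae_mem_support_of_hasLaw hXm hX] with ω hω
    exact F.mem_LGW_of_mem_support hinv hΛ hω
  obtain ⟨ω₀⟩ : Nonempty Ω := nonempty_of_isProbabilityMeasure P
  refine measure_inter_preimage_eq_mul_unif hY (hZ (Set.toFinite t).measurableSet)
    ⟨_, hYC ω₀⟩ hYC ?_ y
  intro a ha b hb
  obtain ⟨i, hi, rfl⟩ := F.mem_C.1 ha
  obtain ⟨j, hj, rfl⟩ := F.mem_C.1 hb
  have h1 : ∀ i < period μ, P (Z ⁻¹' t ∩ Y ⁻¹' {(F.gen ^ i).val}) =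
      ∑ x with x ∈ {x | x ∈ F.LGW ∧ F.projW x ∈ t ∧ F.phase 0 x = i}, Λ x := by
    intro i hi
    have h2 := measure_inter_preimage (P := P) hXm MeasurableSet.univ
      {x | x ∈ F.LGW ∧ F.projW x ∈ t ∧ F.phase 0 x = i}
    simp only [Set.univ_inter, measure_preimage_singleton_of_hasLaw hXm hX] at h2
    refine Eq.trans ?_ (h2.trans (by congr))
    refine measure_congr (eventuallyEq_set.2 ?_)
    filter_upwards [hL, hYX, hZX] with ω h3 h4 h5
    simp only [Set.mem_inter_iff, Set.mem_preimage, Set.mem_singleton_iff, Set.mem_ofPred_eq, h3,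
      true_and, h5, ← h4]
    refine and_congr_right fun _ => ⟨fun h => ?_, fun h => by rw [h]⟩
    exact gen_pow_inj F (F.phase_lt 0 _) hi h
  have hc : ∀ i j : ℕ, (F.gen ^ i)⁻¹ * F.gen ^ j ∈ F.gGroup := fun i j =>
    mul_mem (inv_mem (pow_mem F.gen_mem i)) (pow_mem F.gen_mem j)
  rw [h1 i hi, h1 j hj]
  refine F.sum_shift_eq (hc i j) (fun x hx => F.apply_shift_eq_of_isInvariant hinv hΛ (hc i j) hx)
    _ _ (fun x hx => hx.1) (fun x hx => hx.1) ?_ ?_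
  · rintro x ⟨hx, hxt, hxi⟩
    exact ⟨F.shift_mem (hc i j) hx, by rwa [F.projW_shift (hc i j) hx],
      F.phase_zero_shift hj hx hxi⟩
  · rintro x ⟨hx, hxt, hxj⟩
    have h3 : ((F.gen ^ i)⁻¹ * F.gen ^ j)⁻¹ = (F.gen ^ j)⁻¹ * F.gen ^ i := by group
    rw [h3]
    exact ⟨F.shift_mem (hc j i) hx, by rwa [F.projW_shift (hc j i) hx],
      F.phase_zero_shift hi hx hxj⟩

end PhaseLaw

section Existence

variable {V : Type u} [Fintype V] [Nonempty V]

theorem idempotents_support_nonempty {η : PMF (Function.End V)} (h : η * η = η) :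
    (idempotents η.support).Nonempty := by
  let _ : TopologicalSpace (Function.End V) := ⊥
  have : DiscreteTopology (Function.End V) := ⟨rfl⟩
  obtain ⟨e, he, hee⟩ := exists_idempotent_in_compact_subsemigroup
    (fun r => continuous_of_discreteTopology) η.support η.support_nonempty
    (Set.toFinite η.support).isCompact fun x hx y hy => by
      rw [← h]; exact mul_mem_support hx hy
  exact ⟨e, he, hee⟩

end Existence

end ActionEvolution

end

open ActionEvolution
theorem mainTheorem1 {V : Type*} [Fintype V] [Nonempty V]
    [MeasurableSpace V] [DiscreteMeasurableSpace V] (μ : PMF (Function.End V)) :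
    -- the choices can be made, for every idempotent `e` in the support of `η`
    (∃ η ∈ subseqLimits μ, conv η η = η ∧ (idempotents η.support).Nonempty ∧
      ∀ e ∈ idempotents η.support, ∃ F : Frame μ, F.η = η ∧ F.e = e) ∧
    ∀ (F : Frame μ) (Λ : PMF (Fin (minRank μ) → V)),
      (∀ x ∈ Λ.support, Function.Injective x) → IsInvariant μ Λ →
      ∀ {Ω : Type*} [MeasurableSpace Ω] (P : Measure Ω) [IsProbabilityMeasure P]
        (X : ℤ → Ω → Fin (minRank μ) → V) (N : ℤ → Ω → Function.End V),
        IsEvolution P μ X N → IsStationary P X N → (∀ k, HasLaw (X k) Λ.toMeasure P) →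
        -- (i)
        (∀ k, (∀ᵐ ω ∂P, X k ω ∈ F.LGW) ∧
          HasLaw (fun ω => F.projL (X k ω)) (leftLaw F.e F.η).toMeasure P) ∧
        ∃ (Y : Ω → Function.End V) (U : ℤ → Ω → Function.End V) (Z : Ω → Fin (minRank μ) → V),
          Measurable Y ∧ (∀ k, Measurable (U k)) ∧ Measurable Z ∧
          (∀ ω, Y ω ∈ F.C) ∧ (∀ k ω, U k ω ∈ F.H) ∧ (∀ ω, Z ω ∈ F.W) ∧
          -- (ii)
          (∀ k, ∀ᵐ ω ∂P, F.projG (X k ω) = F.γpow k * Y ω * U k ω) ∧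
          (∀ k, HasLaw (U k) (unif F.H).toMeasure P) ∧
          -- (iii)
          (∀ k, ∀ᵐ ω ∂P, F.projW (X k ω) = Z ω) ∧
          -- (iv)
          (∀ (j : ℤ) (n : ℕ), ∀ᵐ ω ∂P, F.MG X (j + n) j ω =
            F.e * ((List.range n).map fun i : ℕ => F.MG X (j + n - i) (j + n - i - 1) ω).prod) ∧
          (∀ j k : ℤ, j ≤ k → ∀ᵐ ω ∂P, X j ω =
            act (F.projL (X j ω) * F.inv (F.MG X k j ω) * (F.γpow k * Y ω) * U k ω) (Z ω)) ∧
          -- (v)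
          (∀ k, AsEq P (past X k)
            (past (fun j ω => (F.projL (X j ω), F.MG X j (j - 1) ω)) k ⊔ remotePast X ⊔
              MeasurableSpace.comap (U k) inferInstance)) ∧
          (∀ k, AsLe P (past (fun j ω => (F.projL (X j ω), F.MG X j (j - 1) ω)) k) (past N k)) ∧
          (∀ k, iIndep ![past N k, remotePast X, MeasurableSpace.comap (U k) inferInstance] P) ∧
          AsEq P (remotePast X) (MeasurableSpace.comap (fun ω => (Y ω, Z ω)) inferInstance) ∧
          -- (vi)
          HasLaw Y (unif F.C).toMeasure P ∧
          (F.e * F.γ ^ period μ = F.e → F.C = Set.range F.γpow) ∧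
          (∃ ΛW : PMF (Fin (minRank μ) → V), ΛW.support ⊆ F.W ∧
            Λ = actLaw (conv (leftLaw F.e F.η) (unif F.G)) ΛW ∧ HasLaw Z ΛW.toMeasure P) ∧
          IndepFun Y Z P := by
  refine ⟨?_, ?_⟩
  · obtain ⟨η, hμ, hη⟩ := exists_idempotent_powerLimits μ
    refine ⟨η, (subseqLimits_eq_powerLimits μ).symm ▸ hμ, (conv_eq_mul η η).trans hη,
      idempotents_support_nonempty hη, ?_⟩
    rintro e ⟨heη, he⟩
    exact exists_frame hμ hη heη he
  intro F Λ hΛ hinv Ω _ P _ X N hE _ hX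
  have hL := ae_mem_LGW F hE hΛ hinv hX
  have hp := ae_isPath F hE hΛ hinv hX
  obtain ⟨x₀, hx₀⟩ := Λ.support_nonempty
  have hw₀ : F.projW x₀ ∈ F.W := F.projW_mem (F.mem_LGW_of_mem_support hinv hΛ hx₀)
  classical
  let φY : (Fin (minRank μ) → V) → Function.End V := fun x => (F.gen ^ F.phase 0 x).val
  -- outside `LGW`, a null event, the value of `Z` is a fixed element of `W`
  let φZ : (Fin (minRank μ) → V) → Fin (minRank μ) → V := fun x =>
    if x ∈ F.LGW then F.projW x else F.projW x₀
  have hφZ : ∀ x, φZ x ∈ F.W := by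
    intro x
    by_cases hx : x ∈ F.LGW
    · simpa only [φZ, if_pos hx] using F.projW_mem hx
    · simpa only [φZ, if_neg hx] using hw₀
  have hY : Measurable fun ω => φY (X 0 ω) := measurable_comp₁ φY (hE.measurable_X 0)
  have hZ : Measurable fun ω => φZ (X 0 ω) := measurable_comp₁ φZ (hE.measurable_X 0)
  have hYX : ∀ᵐ ω ∂P, (F.gen ^ F.phase 0 (X 0 ω)).val = φY (X 0 ω) := ae_of_all _ fun _ => rfl
  have hZX : ∀ᵐ ω ∂P, F.projW (X 0 ω) = φZ (X 0 ω) := by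
    filter_upwards [hL 0] with ω hω
    simp only [φZ, if_pos hω]
  have hYC : ∀ ω, φY (X 0 ω) ∈ F.C := fun ω => F.mem_C.2 ⟨_, F.phase_lt 0 _, rfl⟩
  have hphase := measure_inter_phase F hΛ hinv (hE.measurable_X 0) (hX 0) hY hZ hYC hYX hZX
  have hYlaw : HasLaw (fun ω => φY (X 0 ω)) (unif F.C).toMeasure P :=
    hasLaw_of_measure_preimage hY fun y => by simpa using hphase Set.univ y
  refine ⟨fun k => ⟨hL k, F.map_projL hinv hΛ ▸ hasLaw_comp (hX k) F.projL⟩,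
    fun ω => φY (X 0 ω), fun k ω => (F.hPart k (X k ω)).val, fun ω => φZ (X 0 ω), hY,
    fun k => measurable_comp₁ (fun x => (F.hPart k x).val) (hE.measurable_X k), hZ, hYC,
    fun k ω => F.mem_hGroup.1 (F.hPart_mem k _), fun ω => hφZ _, ?_,
    hasLaw_hPart F hE hΛ hinv hX, ?_, ?_, ?_, asEq_past F hE hp hY hZ hYX hZX,
    past_coordinates_le F hE hp, iIndep_past_remotePast_hPart F hE hΛ hinv hX,
    asEq_remotePast F hE hp (iIndep_past_remotePast_hPart F hE hΛ hinv hX 0) hY hZ hYX hZX,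
    hYlaw, F.C_eq_range, ⟨Λ.map F.projW, F.support_map_projW hinv hΛ, ?_, ?_⟩, ?_⟩
  · intro k
    filter_upwards [hp] with ω hω
    exact hω.projG_eq k
  · intro k
    filter_upwards [hp, hZX] with ω hω hz
    rw [← hz]
    exact hω.projW_eq k
  · intro j n
    filter_upwards [hp] with ω hω
    exact hω.telescope j n
  · intro j k _
    filter_upwards [hp, hZX] with ω hω hz
    rw [← hz]
    exact hω.eq_act k j
  · rw [conv_eq_mul, ← F.groupSet_gGroup]
    exact F.eq_actLaw_map_projW hinv hΛ
  · exact (hasLaw_comp (hX 0) F.projW).congr (hZX.mono fun _ h => h.symm)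
  · rw [indepFun_iff_measure_inter_preimage_eq_mul]
    intro s t _ ht
    rw [Set.inter_comm, measure_inter_preimage_eq_mul hY (hZ ht) (hphase t) s,
      measure_preimage_of_hasLaw hY hYlaw s, mul_comm]
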